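/- **Setting.** A relay with $M$ antennas serves $N$ pairs of single-antenna users $T_{A,i},T_{B,i}$ ($i=1,\dots,N$). The channels between $T_{A,i}$, $T_{B,i}$ and the relay are independent, $\mathbf g_{A,i}\sim\mathcal{CN}(0,\beta_{AR,i}\mathbf I_M)$ and $\mathbf g_{B,i}\sim\mathcal{CN}(0,\beta_{RB,i}\mathbf I_M)$, with $\beta_{AR,i},\beta_{RB,i}>0$; write $\beta_{A,i}=\beta_{AR,i}$, $\beta_{B,i}=\beta_{RB,i}$, $\mathbf G_X=[\mathbf g_{X,1},\dots,\mathbf g_{X,N}]$, $\mathbf D_X=\mathrm{diag}(\beta_{X,1},\dots,\beta_{X,N})$ for $X\in\{A,B\}$, and $\bar X$ for the other element of $\{A,B\}$. The users send orthonormal pilot sequences of length $\tau_p$, the columns of $\mathbf\Phi_A,\mathbf\Phi_B\in\mathbb C^{\tau_p\times N}$ ($\mathbf\Phi_X^T\mathbf\Phi_X^*=\mathbf I_N$, $\mathbf\Phi_A^T\mathbf\Phi_B^*=\mathbf 0$), with power $p_p$ per symbol. The relay receives $\mathbf Y_p=\sqrt{\tau_pp_p}\,(\mathbf G_A\mathbf\Phi_A^T+\mathbf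 G_B\mathbf\Phi_B^T)+\mathbf N_p$, where $\mathbf N_p$ has i.i.d. $\mathcal{CN}(0,1)$ entries and is independent of the channels, and forms the MMSE estimates $\hat{\mathbf G}_X=\frac1{\sqrt{\tau_pp_p}}\mathbf Y_p\mathbf\Phi_X^*\big(\frac1{\tau_pp_p}\mathbf D_X^{-1}+\mathbf I_N\big)^{-1}$ with columns $\hat{\mathbf g}_{X,i}$; put $\mathbf e_{X,i}=\mathbf g_{X,i}-\hat{\mathbf g}_{X,i}$. All users have transmit power $p_u$; the relay has transmit power $p_r$. The decode-and-forward (DF) rates with maximum-ratio processing are as follows. With $$S_{X,i}=p_u\sum_{Y\in\{A,B\}}|\hat{\mathbf g}_{Y,i}^H\hat{\mathbf g}_{X,i}|^2,\qquad Q_i=p_u\sum_{X,Y}|\hat{\mathbf g}_{Y,i}^H\mathbf e_{X,i}|^2+p_u\sum_{j\ne i}\sum_{X,Y}|\hat{\mathbf g}_{Y,i}^H\mathbf g_{X,j}|^2+\sum_Y\|\hat{\mathbf g}_{Y,i}\|^2,$$ the first-phase rates are $$R^{DF}_{1,i}=\tfrac12\,\mathbb E\log_2\Big(1+\tfrac{S_{A,i}+S_{B,i}}{\mathbb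 E[Q_i\mid\hat{\mathbf G}_A,\hat{\mathbf G}_B]}\Big),\qquad R^{DF}_{XR,i}=\tfrac12\,\mathbb E\log_2\Big(1+\tfrac{S_{X,i}}{\mathbb E[Q_i\mid\hat{\mathbf G}_A,\hat{\mathbf G}_B]}\Big).$$ With $\rho^2=p_r/\mathbb E\big(\|\hat{\mathbf G}_A\|_F^2+\|\hat{\mathbf G}_B\|_F^2\big)$, the broadcast rates are $$R^{DF}_{RX,i}=\tfrac12\log_2\left(1+\frac{|\mathbb E\{\mathbf g_{X,i}^T\hat{\mathbf g}_{X,i}^*\}|^2}{\mathrm{Var}(\mathbf g_{X,i}^T\hat{\mathbf g}_{X,i}^*)+\mathrm{Var}(\mathbf g_{X,i}^T\hat{\mathbf g}_{\bar X,i}^*)+\sum_{j\ne i}\sum_{Y}\mathbb E|\mathbf g_{X,i}^T\hat{\mathbf g}_{Y,j}^*|^2+\rho^{-2}}\right).$$ Finally $R^{DF}_{2,i}=\min(R^{DF}_{AR,i},R^{DF}_{RB,i})+\min(R^{DF}_{BR,i},R^{DF}_{RA,i})$ and $R^{DF}_i=\min(R^{DF}_{1,i},R^{DF}_{2,i})$.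 **Theorem.** Fix $N$, $\tau_p$, the coefficients $\beta_{AR,i},\beta_{RB,i}$ and constants $E_u,E_r,E_p>0$. Let $p_u=E_u/M^{\alpha}$, $p_r=E_r/M^{\beta}$, $p_p=E_p/M^{\gamma}$ with $\alpha\ge0$, $\beta\ge0$, $\gamma>0$; if $\alpha=0$, assume moreover that $2\beta+\gamma>1$. Then all the expectations above exist and are finite, and for every $i$ $$R_i^{DF}-\min\big(\bar R^{DF}_{1,i},\bar R^{DF}_{2,i}\big)\longrightarrow0\qquad(M\to\infty),$$ where $$\bar R^{DF}_{1,i}=\tfrac12\log_2\Big(1+\tfrac{\tau_pE_uE_p}{M^{\alpha+\gamma-1}}\,\tfrac{\beta_{AR,i}^4+\beta_{RB,i}^4}{\beta_{AR,i}^2+\beta_{RB,i}^2}\Big),\qquad \bar R^{DF}_{2,i}=\min(\bar R^{DF}_{AR,i},\bar R^{DF}_{RB,i})+\min(\bar R^{DF}_{BR,i},\bar R^{DF}_{RA,i}),$$ $$\bar R^{DF}_{AR,i}=\tfrac12\log_2\Big(1+\tfrac{\tau_pE_uE_p}{M^{\alpha+\gamma-1}}\,\tfrac{\beta_{AR,i}^4}{\beta_{AR,i}^2+\beta_{RB,i}^2}\Big),\qquad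 \bar R^{DF}_{RA,i}=\tfrac12\log_2\Big(1+\tfrac{\tau_pE_rE_p}{M^{\beta+\gamma-1}}\,\tfrac{\beta_{AR,i}^4}{\sum_{j=1}^N(\beta_{AR,j}^2+\beta_{RB,j}^2)}\Big),$$ and $\bar R^{DF}_{BR,i}$, $\bar R^{DF}_{RB,i}$ are obtained from $\bar R^{DF}_{AR,i}$, $\bar R^{DF}_{RA,i}$ by exchanging the subscripts $AR$ and $RB$. -/

import Mathlib

open MeasureTheory ProbabilityTheory Filter Topology

noncomputable section

namespace TwoWayRelay

/-- The two sides of every user pair: pair `i` consists of the users `T_{A,i}` and `T_{B,i}`. -/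
inductive Side where
  | A : Side
  | B : Side
  deriving DecidableEq

instance : Fintype Side where
  elems := {Side.A, Side.B}
  complete := by intro X; cases X <;> decide

/-- The opposite side. -/
def Side.other : Side → Side
  | Side.A => Side.B
  | Side.B => Side.A

/-- The circularly symmetric complex Gaussian law `CN(0, v)`: real and imaginary parts are
independent, centred real Gaussians of variance `v / 2`. -/
def complexGaussian (v : ℝ) : Measure ℂ :=
  ((gaussianReal 0 (v / 2).toNNReal).prod (gaussianReal 0 (v / 2).toNNReal)).map
    (fun q : ℝ × ℝ => (⟨q.1, q.2⟩ : ℂ))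

/-- The variance `E |Z - E Z|²` of a complex random variable. -/
def complexVariance {Ω : Type*} [MeasurableSpace Ω] (Z : Ω → ℂ) (μ : Measure Ω) : ℝ :=
  ∫ ω, ‖Z ω - ∫ ω', Z ω' ∂μ‖ ^ 2 ∂μ

/-- The data of a multipair two-way relaying system with `N` user pairs, `M` relay antennas and
pilot sequences of length `τ`. For the side `X = A` (resp. `X = B`), `β X i` is the large-scale
fading coefficient `β_{AR,i}` (resp. `β_{RB,i}`), the columns of `Φ X` are the pilot sequences,
`p X i` is the transmit power of `T_{X,i}`, and `G X` is the random channel matrix `G_{AR}`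
(resp. `G_{RB}`), whose `i`-th column is the channel between `T_{X,i}` and the relay. Further,
`pr` is the transmit power of the relay, `pp` the power of each pilot symbol, and `Np` the
noise matrix at the relay during the training phase. -/
structure RelaySystem (M N τ : ℕ) (Ω : Type*) where
  β : Side → Fin N → ℝ
  Φ : Side → Matrix (Fin τ) (Fin N) ℂ
  p : Side → Fin N → ℝ
  pr : ℝ
  pp : ℝ
  G : Side → Ω → Matrix (Fin M) (Fin N) ℂ
  Np : Ω → Matrix (Fin M) (Fin τ) ℂ

namespace RelaySystem

variable {M N τ : ℕ} {Ω : Type*}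

/-- All the entries of the two channel matrices and of the pilot noise matrix, as one family of
complex random variables. -/
def entries (S : RelaySystem M N τ Ω) :
    (Side × Fin M × Fin N) ⊕ (Fin M × Fin τ) → Ω → ℂ
  | Sum.inl q, ω => S.G q.1 ω q.2.1 q.2.2
  | Sum.inr q, ω => S.Np ω q.1 q.2

/-- The standing assumptions of the model: the pilot sequences are orthonormal, the channels are
uncorrelated Rayleigh fading, i.e. `g_{X,i} ~ CN(0, β_{X,i} I_M)`, the pilot noise has i.i.d.
`CN(0, 1)` entries, and all channels and the noise are independent. -/
structure IsModel [MeasurableSpace Ω] (S : RelaySystem M N τ Ω) (μ : Measure Ω) : Prop where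
  orthonormal : ∀ X Y : Side,
    (S.Φ X).transpose * (S.Φ Y).map star = if X = Y then 1 else 0
  measurable : ∀ q, Measurable (S.entries q)
  channel_law : ∀ X m i, μ.map (fun ω => S.G X ω m i) = complexGaussian (S.β X i)
  noise_law : ∀ m t, μ.map (fun ω => S.Np ω m t) = complexGaussian 1
  indep : iIndepFun S.entries μ

/-- The received pilot matrix `Y_p = √(τ p_p) G_{AR} Φ_Aᵀ + √(τ p_p) G_{RB} Φ_Bᵀ + N_p`. -/
def Yp (S : RelaySystem M N τ Ω) (ω : Ω) : Matrix (Fin M) (Fin τ) ℂ :=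
  (∑ X : Side, ((Real.sqrt (τ * S.pp) : ℝ) : ℂ) • (S.G X ω * (S.Φ X).transpose)) + S.Np ω

/-- The MMSE channel estimate `(τ p_p)^{-1/2} Y_p Φ_X^* ((τ p_p)⁻¹ D_X⁻¹ + I)⁻¹`, where `D_X` is
the diagonal matrix with the entries `β_{X,i}`. -/
def Ghat (S : RelaySystem M N τ Ω) (X : Side) (ω : Ω) : Matrix (Fin M) (Fin N) ℂ :=
  ((1 / Real.sqrt (τ * S.pp) : ℝ) : ℂ) •
    (S.Yp ω * (S.Φ X).map star *
      Matrix.diagonal (fun i => (((1 / (τ * S.pp) * (S.β X i)⁻¹ + 1)⁻¹ : ℝ) : ℂ)))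

/-- The column `g_{X,i}`. -/
def g (S : RelaySystem M N τ Ω) (X : Side) (i : Fin N) (ω : Ω) : Fin M → ℂ :=
  fun m => S.G X ω m i

/-- The column `ĝ_{X,i}`. -/
def ghat (S : RelaySystem M N τ Ω) (X : Side) (i : Fin N) (ω : Ω) : Fin M → ℂ :=
  fun m => S.Ghat X ω m i

/-- The estimation error `e_{X,i} = g_{X,i} - ĝ_{X,i}`. -/
def e (S : RelaySystem M N τ Ω) (X : Side) (i : Fin N) (ω : Ω) : Fin M → ℂ :=
  S.g X i ω - S.ghat X i ω

/-- The σ-algebra generated by the channel estimates `Ĝ_{AR}` and `Ĝ_{RB}`. -/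
@[reducible] def estimateSigma (S : RelaySystem M N τ Ω) : MeasurableSpace Ω :=
  MeasurableSpace.comap
    (fun ω (q : Side × Fin M × Fin N) => S.Ghat q.1 ω q.2.1 q.2.2) MeasurableSpace.pi

/-! ### First phase -/

/-- The desired signal power of `T_{X,i}`: `p_{X,i} (|ĝ_{A,i}ᴴ ĝ_{X,i}|² + |ĝ_{B,i}ᴴ ĝ_{X,i}|²)`.
-/
def signalPower (S : RelaySystem M N τ Ω) (X : Side) (i : Fin N) (ω : Ω) : ℝ :=
  S.p X i * ∑ Y : Side, ‖star (S.ghat Y i ω) ⬝ᵥ S.ghat X i ω‖ ^ 2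

/-- The power of the estimation error. -/
def errorPower (S : RelaySystem M N τ Ω) (i : Fin N) (ω : Ω) : ℝ :=
  ∑ X : Side, S.p X i * ∑ Y : Side, ‖star (S.ghat Y i ω) ⬝ᵥ S.e X i ω‖ ^ 2

/-- The power of the inter-user interference. -/
def interferencePower (S : RelaySystem M N τ Ω) (i : Fin N) (ω : Ω) : ℝ :=
  ∑ j ∈ Finset.univ.erase i,
    ∑ X : Side, S.p X j * ∑ Y : Side, ‖star (S.ghat Y i ω) ⬝ᵥ S.g X j ω‖ ^ 2

/-- The power of the compound noise, `‖ĝ_{A,i}‖² + ‖ĝ_{B,i}‖²`. -/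
def noisePower (S : RelaySystem M N τ Ω) (i : Fin N) (ω : Ω) : ℝ :=
  ∑ Y : Side, ∑ m, ‖S.ghat Y i ω m‖ ^ 2

/-- The total power of estimation error, inter-user interference and compound noise. -/
def disturbance (S : RelaySystem M N τ Ω) (i : Fin N) (ω : Ω) : ℝ :=
  S.errorPower i ω + S.interferencePower i ω + S.noisePower i ω

variable [MeasurableSpace Ω]

/-- The disturbance averaged over the estimation errors, given the channel estimates. -/
def condDisturbance (S : RelaySystem M N τ Ω) (μ : Measure Ω) (i : Fin N) : Ω → ℝ :=
  condExp S.estimateSigma μ (S.disturbance i)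

/-- The instantaneous rate (as a function of the channel estimates) whose mean is twice the
first-phase spectral efficiency of the pair `i`. -/
def pairLog (S : RelaySystem M N τ Ω) (μ : Measure Ω) (i : Fin N) (ω : Ω) : ℝ :=
  Real.logb 2 (1 + (S.signalPower Side.A i ω + S.signalPower Side.B i ω) /
    S.condDisturbance μ i ω)

/-- The same for the link from `T_{X,i}` to the relay. -/
def uplinkLog (S : RelaySystem M N τ Ω) (μ : Measure Ω) (X : Side) (i : Fin N) (ω : Ω) : ℝ :=
  Real.logb 2 (1 + S.signalPower X i ω / S.condDisturbance μ i ω)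

/-- The ergodic spectral efficiency `R_{1,i}` of the pair `i` in the first phase. -/
def R1 (S : RelaySystem M N τ Ω) (μ : Measure Ω) (i : Fin N) : ℝ :=
  1 / 2 * ∫ ω, S.pairLog μ i ω ∂μ

/-- The ergodic spectral efficiency `R_{XR,i}` of the link from `T_{X,i}` to the relay. -/
def RUp (S : RelaySystem M N τ Ω) (μ : Measure Ω) (X : Side) (i : Fin N) : ℝ :=
  1 / 2 * ∫ ω, S.uplinkLog μ X i ω ∂μ

/-! ### Second phase -/

/-- The squared Frobenius norm of the precoding matrix `J = [Ĝ_{RB}, Ĝ_{AR}]^*`. -/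
def precoderNormSq (S : RelaySystem M N τ Ω) (ω : Ω) : ℝ :=
  ∑ X : Side, ∑ m, ∑ i, ‖S.Ghat X ω m i‖ ^ 2

/-- The normalization coefficient `ρ = √(p_r / E ‖J‖_F²)` of the relay. -/
def rho (S : RelaySystem M N τ Ω) (μ : Measure Ω) : ℝ :=
  Real.sqrt (S.pr / ∫ ω, S.precoderNormSq ω ∂μ)

/-- The effective downlink gain `g_{X,i}ᵀ ĝ_{Y,j}^*`. -/
def gain (S : RelaySystem M N τ Ω) (X : Side) (i : Fin N) (Y : Side) (j : Fin N) (ω : Ω) : ℂ :=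
  S.g X i ω ⬝ᵥ star (S.ghat Y j ω)

/-- The SINR of the link from the relay to `T_{X,i}`: desired signal over estimation error,
residual self-interference, inter-user interference and noise. -/
def sinrDown (S : RelaySystem M N τ Ω) (μ : Measure Ω) (X : Side) (i : Fin N) : ℝ :=
  ‖∫ ω, S.gain X i X i ω ∂μ‖ ^ 2 /
    (complexVariance (S.gain X i X i) μ + complexVariance (S.gain X i X.other i) μ +
      (∑ j ∈ Finset.univ.erase i, ∑ Y : Side, ∫ ω, ‖S.gain X i Y j ω‖ ^ 2 ∂μ) +
      1 / (S.rho μ) ^ 2)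

/-- The ergodic spectral efficiency `R_{RX,i}` of the link from the relay to `T_{X,i}`. -/
def RDown (S : RelaySystem M N τ Ω) (μ : Measure Ω) (X : Side) (i : Fin N) : ℝ :=
  1 / 2 * Real.logb 2 (1 + S.sinrDown μ X i)

/-- `R_{2,i} = min (R_{AR,i}, R_{RB,i}) + min (R_{BR,i}, R_{RA,i})`. -/
def R2 (S : RelaySystem M N τ Ω) (μ : Measure Ω) (i : Fin N) : ℝ :=
  min (S.RUp μ Side.A i) (S.RDown μ Side.B i) + min (S.RUp μ Side.B i) (S.RDown μ Side.A i)

/-- The ergodic spectral efficiency `R_i^{DF}` of the pair `i` under decode-and-forward. -/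
def RDF (S : RelaySystem M N τ Ω) (μ : Measure Ω) (i : Fin N) : ℝ :=
  min (S.R1 μ i) (S.R2 μ i)

/-- All expectations that enter `R_i^{DF}` exist and are finite. -/
structure ExpectationsExist (S : RelaySystem M N τ Ω) (μ : Measure Ω) (i : Fin N) : Prop where
  disturbance : Integrable (S.disturbance i) μ
  pairLog : Integrable (S.pairLog μ i) μ
  uplinkLog : ∀ X, Integrable (S.uplinkLog μ X i) μ
  precoder : Integrable S.precoderNormSq μ
  gain : ∀ X Y j, MemLp (S.gain X i Y j) 2 μ

end RelaySystem

/-! ### The asymptotic rates -/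

section Asymptotic

variable {N : ℕ} (τ : ℕ) (β : Side → Fin N → ℝ) (Eu Er Ep a b c : ℝ) (M : ℕ) (i : Fin N)

/-- `R̄_{1,i}`, for the exponents `a` (users), `b` (relay), `c` (pilots). -/
def Rbar1 : ℝ :=
  1 / 2 * Real.logb 2 (1 + τ * Eu * Ep / (M : ℝ) ^ (a + c - 1) *
    ((β Side.A i ^ 4 + β Side.B i ^ 4) / (β Side.A i ^ 2 + β Side.B i ^ 2)))

/-- `R̄_{XR,i}`. -/
def RbarUp (X : Side) : ℝ :=
  1 / 2 * Real.logb 2 (1 + τ * Eu * Ep / (M : ℝ) ^ (a + c - 1) *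
    (β X i ^ 4 / (β Side.A i ^ 2 + β Side.B i ^ 2)))

/-- `R̄_{RX,i}`. -/
def RbarDown (X : Side) : ℝ :=
  1 / 2 * Real.logb 2 (1 + τ * Er * Ep / (M : ℝ) ^ (b + c - 1) *
    (β X i ^ 4 / ∑ j, (β Side.A j ^ 2 + β Side.B j ^ 2)))

/-- `R̄_{2,i} = min (R̄_{AR,i}, R̄_{RB,i}) + min (R̄_{BR,i}, R̄_{RA,i})`. -/
def Rbar2 : ℝ :=
  min (RbarUp τ β Eu Ep a c M i Side.A) (RbarDown τ β Er Ep b c M i Side.B) +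
    min (RbarUp τ β Eu Ep a c M i Side.B) (RbarDown τ β Er Ep b c M i Side.A)

end Asymptotic

end TwoWayRelay

end

noncomputable section

namespace TwoWayRelay

/-! ### The circular complex Gaussian law and its moments. -/

section ComplexGaussian

/-! Write t = τ p_p for the pilot energy. Despreading with orthonormal pilots leaves in each entry
of the estimate only a multiple of its own channel plus noise, and the MMSE shrinkage is exactly the
one that makes estimate and error uncorrelated. Both are linear images of independent circular
Gaussians, so all their entries are independent (`IsModel.isGaussianFamily_estErr`), with variances
`estVar t β`, of order t β², and `errVar t β`, which tends to β. Conditioning on the estimates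
therefore means averaging over the errors with the estimates frozen (`condDisturbance_ae_eq`), and
the conditional disturbance becomes explicit.

Uplink: the instantaneous SINR factors exactly as s W, with s its typical value and W a ratio close
to 1. The deviation of W is controlled by a defect D, which collects the relative fluctuations of
the norms, the correlation inside the pair and the interference. Near D = 0 one has |W - 1| ≤ C √D,
and W grows at most linearly in D everywhere, so log (1 + s W) differs from log (1 + s) by O(√D + (1
+ log (1 + s)) D). Since E D = O(1/M + M^(-c)) and s = O(M), the mean error vanishes
(`integral_weightedLog_near`, `tendsto_integral_weightedLog_sub`). No lower bound on the SINR is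
needed, so all power exponents are treated at once.

Downlink: the SINR involves only second moments of the gains, so it has a closed form
(`sinrDown_eq`). In both links power M^(-d), array gain M and pilot energy M^(-c) combine into the
scaling M^(-(d + c - 1)).

The limits differ from the claimed rates by constant factors: 1 + E_u Σ β in the uplink if a = 0,
and 1 + E_r β in the downlink if b = 0. The minima in the rate hide them
(`tendsto_combinedRate_sub`). Either the whole rate tends to 0, or the link with the spurious factor
is not the bottleneck. For a = 0 the first-phase bound must exceed the sum of two downlink rates,
whose combined SINR contains the square of the downlink scaling; this is where 2b + c > 1 enters. -/

lemma measurable_complex_mk : Measurable (fun q : ℝ × ℝ => (⟨q.1, q.2⟩ : ℂ)) :=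
  Complex.measurableEquivRealProd.symm.measurable

instance (v : ℝ) : IsProbabilityMeasure (complexGaussian v) :=
  Measure.isProbabilityMeasure_map measurable_complex_mk.aemeasurable

/-- Product of two real Gaussian characteristic functions of variance v / 2. The value depends on z
only through its modulus (circular symmetry), which is why Hermitian covariances will suffice later.
-/
lemma charFun_complexGaussian {v : ℝ} (hv : 0 ≤ v) (z : ℂ) :
    charFun (complexGaussian v) z = Complex.exp (-((v * ‖z‖ ^ 2 / 4 : ℝ) : ℂ)) := by
  have h1 : charFun (complexGaussian v) z =
      charFun (gaussianReal 0 (v / 2).toNNReal) z.re *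
        charFun (gaussianReal 0 (v / 2).toNNReal) z.im := by
    rw [charFun_apply, complexGaussian, integral_map measurable_complex_mk.aemeasurable
      (by fun_prop), charFun_apply, charFun_apply, ← integral_prod_mul]
    refine integral_congr_ae (ae_of_all _ fun q => ?_)
    simp only [Complex.inner, ← Complex.exp_add]
    congr 1
    simp
    ring
  rw [h1, charFun_gaussianReal, charFun_gaussianReal, ← Complex.exp_add]
  congr 1
  rw [Complex.sq_norm, Complex.normSq_apply]
  have : (((v / 2).toNNReal : ℝ) : ℂ) = (v : ℂ) / 2 := by
    rw [Real.coe_toNNReal _ (by positivity)]; push_cast; rfl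
  rw [this]
  push_cast
  ring

/-- The scalar √v can be moved to the other slot of the inner product, so the characteristic
functions agree. It reduces the fourth moment to the case v = 1. The value of `kurt` is never
computed, because it only occurs in terms that vanish as M grows. -/
lemma map_mul_complexGaussian {v : ℝ} (hv : 0 ≤ v) :
    (complexGaussian 1).map (fun z => (Real.sqrt v : ℂ) * z) = complexGaussian v := by
  have hm : Measurable (fun z : ℂ => (Real.sqrt v : ℂ) * z) := by fun_prop
  have : IsProbabilityMeasure ((complexGaussian 1).map (fun z => (Real.sqrt v : ℂ) * z)) :=
    Measure.isProbabilityMeasure_map hm.aemeasurable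
  refine Measure.ext_of_charFun (funext fun ξ => ?_)
  rw [charFun_complexGaussian hv, charFun_apply, integral_map hm.aemeasurable (by fun_prop)]
  have h := charFun_complexGaussian zero_le_one ((Real.sqrt v : ℂ) * ξ)
  rw [charFun_apply] at h
  rw [show (∫ x : ℂ, Complex.exp (((inner ℝ ((Real.sqrt v : ℂ) * x) ξ : ℝ) : ℂ) * Complex.I)
      ∂complexGaussian 1) = ∫ x : ℂ, Complex.exp (((inner ℝ x ((Real.sqrt v : ℂ) * ξ) : ℝ) : ℂ)
        * Complex.I) ∂complexGaussian 1 from ?_, h]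
  · rw [norm_mul, mul_pow, Complex.norm_real, Real.norm_eq_abs, sq_abs, Real.sq_sqrt hv, one_mul]
  · congr 1
    ext x
    congr 3
    simp [Complex.inner]
    ring

lemma memLp_complexGaussian (v : ℝ) {p : ENNReal} (hp : p ≠ ⊤) :
    MemLp (fun z : ℂ => z) p (complexGaussian v) := by
  rw [complexGaussian, memLp_map_measure_iff (by fun_prop) measurable_complex_mk.aemeasurable]
  have h : ∀ f : ℝ × ℝ → ℝ,
      MeasurePreserving f ((gaussianReal 0 (v / 2).toNNReal).prod
        (gaussianReal 0 (v / 2).toNNReal)) (gaussianReal 0 (v / 2).toNNReal) →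
      MemLp (fun q => ((f q : ℝ) : ℂ)) p ((gaussianReal 0 (v / 2).toNNReal).prod
        (gaussianReal 0 (v / 2).toNNReal)) := fun f hf =>
    ((memLp_id_gaussianReal' p hp).comp_measurePreserving hf).ofReal
  have h2 := (h _ measurePreserving_fst).add ((h _ measurePreserving_snd).const_mul Complex.I)
  refine h2.ae_eq (ae_of_all _ fun q => ?_)
  apply Complex.ext <;> simp

lemma integral_complexGaussian (v : ℝ) : ∫ z, z ∂complexGaussian v = 0 := by
  have hi : Integrable (fun z : ℂ => z) (complexGaussian v) :=
    memLp_one_iff_integrable.1 (memLp_complexGaussian v ENNReal.one_ne_top)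
  have hre := (Complex.reCLM.integral_comp_comm hi)
  have him := (Complex.imCLM.integral_comp_comm hi)
  simp only [Complex.reCLM_apply, Complex.imCLM_apply] at hre him
  apply Complex.ext
  · rw [← hre, complexGaussian, integral_map measurable_complex_mk.aemeasurable (by fun_prop)]
    have := integral_fun_fst (μ := gaussianReal 0 (v / 2).toNNReal)
      (ν := gaussianReal 0 (v / 2).toNNReal) (f := fun x : ℝ => x)
    simp only [this, integral_id_gaussianReal]
    simp
  · rw [← him, complexGaussian, integral_map measurable_complex_mk.aemeasurable (by fun_prop)]
    have := integral_fun_snd (μ := gaussianReal 0 (v / 2).toNNReal)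
      (ν := gaussianReal 0 (v / 2).toNNReal) (f := fun x : ℝ => x)
    simp only [this, integral_id_gaussianReal]
    simp

lemma integral_norm_sq_complexGaussian {v : ℝ} (hv : 0 ≤ v) :
    ∫ z, ‖z‖ ^ 2 ∂complexGaussian v = v := by
  have h2 : ∫ x, x ^ 2 ∂gaussianReal 0 (v / 2).toNNReal = v / 2 := by
    have := variance_fun_id_gaussianReal (μ := 0) (v := (v / 2).toNNReal)
    rw [variance_of_integral_eq_zero (by fun_prop) integral_id_gaussianReal,
      Real.coe_toNNReal _ (by positivity)] at this
    exact this
  have hi : Integrable (fun x : ℝ => x ^ 2) (gaussianReal 0 (v / 2).toNNReal) :=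
    (memLp_id_gaussianReal 2).integrable_sq
  rw [complexGaussian, integral_map measurable_complex_mk.aemeasurable (by fun_prop)]
  simp only [Complex.sq_norm, Complex.normSq_apply, ← pow_two]
  rw [integral_add (hi.comp_fst _) (hi.comp_snd _)]
  have h3 := integral_fun_fst (μ := gaussianReal 0 (v / 2).toNNReal)
      (ν := gaussianReal 0 (v / 2).toNNReal) (f := fun x : ℝ => x ^ 2)
  have h4 := integral_fun_snd (μ := gaussianReal 0 (v / 2).toNNReal)
      (ν := gaussianReal 0 (v / 2).toNNReal) (f := fun x : ℝ => x ^ 2)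
  rw [h3, h4, h2]
  simp

/-- The fourth absolute moment of the law `CN(0, 1)`. -/
def kurt : ℝ := ∫ z, ‖z‖ ^ 4 ∂complexGaussian 1

lemma integral_norm_pow_four_complexGaussian {v : ℝ} (hv : 0 ≤ v) :
    ∫ z, ‖z‖ ^ 4 ∂complexGaussian v = kurt * v ^ 2 := by
  rw [← map_mul_complexGaussian hv, integral_map (by fun_prop) (by fun_prop)]
  simp only [norm_mul, mul_pow, Complex.norm_real, Real.norm_eq_abs]
  have : |Real.sqrt v| ^ 4 = v ^ 2 := by
    rw [show 4 = 2 * 2 from rfl, pow_mul, sq_abs, Real.sq_sqrt hv]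
  rw [this, integral_const_mul, kurt, mul_comm]

end ComplexGaussian

/-- A finite family of independent random variables with laws `CN(0, w q)`. -/
structure IsGaussianFamily {Ω κ : Type*} [MeasurableSpace Ω] (F : κ → Ω → ℂ) (w : κ → ℝ)
    (μ : Measure Ω) : Prop where
  measurable : ∀ q, Measurable (F q)
  nonneg : ∀ q, 0 ≤ w q
  law : ∀ q, μ.map (F q) = complexGaussian (w q)
  indep : iIndepFun F μ

/-! ### Linear images of independent circular Gaussians. -/

section LinearImage

variable {Ω ι κ : Type*} [MeasurableSpace Ω] [Fintype ι] [Fintype κ] [DecidableEq κ]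
  {μ : Measure Ω} [IsProbabilityMeasure μ] {Z : ι → Ω → ℂ} {v : ι → ℝ}

lemma IsGaussianFamily.integral_exp_inner (hZ : IsGaussianFamily Z v μ) (η : ι → ℂ) :
    ∫ ω, Complex.exp (((∑ k, inner ℝ (Z k ω) (η k) : ℝ) : ℂ) * Complex.I) ∂μ =
      Complex.exp (-((∑ k, v k * ‖η k‖ ^ 2 / 4 : ℝ) : ℂ)) := by
  have h := (iIndepFun_iff_charFun_pi (fun k => (hZ.measurable k).aemeasurable)).1 hZ.indep
    (WithLp.toLp 2 η)
  rw [charFun_apply, integral_map (by have := hZ.measurable; fun_prop) (by fun_prop)] at h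
  simp only [PiLp.inner_apply, hZ.law] at h
  rw [h, Finset.prod_congr rfl fun k _ => charFun_complexGaussian (hZ.nonneg k) (η k),
    ← Complex.exp_sum]
  push_cast
  rw [Finset.sum_neg_distrib]

/-- The hypothesis says L diag(v) Lᴴ = diag(w); the two sides are the quadratic forms of these
matrices at ξ. They are compared in ℂ, where squared norms expand bilinearly. -/
lemma sum_mul_norm_sq_of_covariance (L : κ → ι → ℂ) (w : κ → ℝ)
    (hL : ∀ q q', ∑ k, (v k : ℂ) * (L q k * star (L q' k)) = if q = q' then (w q : ℂ) else 0)
    (ξ : κ → ℂ) :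
    ∑ k, v k * ‖∑ q, star (L q k) * ξ q‖ ^ 2 = ∑ q, w q * ‖ξ q‖ ^ 2 := by
  have h : ((∑ k, v k * ‖∑ q, star (L q k) * ξ q‖ ^ 2 : ℝ) : ℂ) =
      ((∑ q, w q * ‖ξ q‖ ^ 2 : ℝ) : ℂ) := by
    push_cast
    simp only [← Complex.conj_mul', map_sum, Finset.sum_mul, Finset.mul_sum]
    rw [Finset.sum_comm]
    refine Finset.sum_congr rfl fun q _ => ?_
    rw [Finset.sum_comm]
    have h1 : ∀ q', ∑ k, (v k : ℂ) * ((starRingEnd ℂ) (star (L q' k) * ξ q') *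
        (star (L q k) * ξ q)) = (if q' = q then (w q' : ℂ) else 0) *
          ((starRingEnd ℂ) (ξ q') * ξ q) := fun q' => by
      rw [← hL, Finset.sum_mul]
      refine Finset.sum_congr rfl fun k _ => ?_
      simp
      ring
    simp only [h1]
    simp
  exact_mod_cast h

/-- Uncorrelated jointly Gaussian variables are independent. Moving L to the dual vector as its
adjoint turns the joint characteristic function of the image into that of Z, and the diagonal
covariance makes it factor. By circularity no condition on the products without conjugation is
needed. -/
lemma IsGaussianFamily.linearImage (hZ : IsGaussianFamily Z v μ) (L : κ → ι → ℂ) {w : κ → ℝ}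
    (hw : ∀ q, 0 ≤ w q)
    (hL : ∀ q q', ∑ k, (v k : ℂ) * (L q k * star (L q' k)) = if q = q' then (w q : ℂ) else 0) :
    IsGaussianFamily (fun q ω => ∑ k, L q k * Z k ω) w μ := by
  have hm : ∀ q, Measurable (fun ω => ∑ k, L q k * Z k ω) := fun q => by
    have := hZ.measurable; fun_prop
  have hF : ∀ ξ : κ → ℂ,
      ∫ ω, Complex.exp (((∑ q, inner ℝ (∑ k, L q k * Z k ω) (ξ q) : ℝ) : ℂ) * Complex.I) ∂μ =
        Complex.exp (-((∑ q, w q * ‖ξ q‖ ^ 2 / 4 : ℝ) : ℂ)) := fun ξ => by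
    rw [← Finset.sum_div, ← sum_mul_norm_sq_of_covariance L w hL ξ, Finset.sum_div,
      ← hZ.integral_exp_inner]
    congr 1
    ext ω
    congr 3
    simp only [Complex.inner, map_sum, Finset.sum_mul, Finset.mul_sum, Complex.re_sum]
    rw [Finset.sum_comm]
    refine Finset.sum_congr rfl fun k _ => Finset.sum_congr rfl fun q _ => ?_
    simp
    ring
  have hlaw : ∀ q, μ.map (fun ω => ∑ k, L q k * Z k ω) = complexGaussian (w q) := fun q => by
    have : IsProbabilityMeasure (μ.map (fun ω => ∑ k, L q k * Z k ω)) :=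
      Measure.isProbabilityMeasure_map (hm q).aemeasurable
    refine Measure.ext_of_charFun (funext fun z => ?_)
    rw [charFun_complexGaussian (hw q), charFun_apply,
      integral_map (hm q).aemeasurable (by fun_prop)]
    -- A dual vector supported at q picks out the marginal law of the q-th image.
    have h := hF (Pi.single q z)
    rw [Finset.sum_eq_single q (by intro q' _ hq; simp [Pi.single_eq_of_ne hq]) (by simp),
      Pi.single_eq_same] at h
    rw [← h]
    congr 1
    ext ω
    congr 3
    rw [Finset.sum_eq_single q (by intro q' _ hq; simp [Pi.single_eq_of_ne hq]) (by simp),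
      Pi.single_eq_same]
  refine ⟨hm, hw, hlaw, (iIndepFun_iff_charFun_pi fun q => (hm q).aemeasurable).2 fun ξ => ?_⟩
  have hm' : Measurable (fun ω => WithLp.toLp 2 fun q => ∑ k, L q k * Z k ω) :=
    (WithLp.measurable_toLp 2 _).comp (measurable_pi_lambda _ hm)
  rw [charFun_apply, integral_map hm'.aemeasurable (by fun_prop)]
  simp only [PiLp.inner_apply, hlaw]
  rw [hF, Finset.prod_congr rfl fun q _ => charFun_complexGaussian (hw q) (ξ.ofLp q),
    ← Complex.exp_sum]
  push_cast
  rw [Finset.sum_neg_distrib]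

end LinearImage

/-- The variance of an entry of the MMSE estimate, for a channel of variance `b` and total pilot
energy `t`. -/
def estVar (t b : ℝ) : ℝ := t * b ^ 2 / (1 + t * b)

/-- The variance of an entry of the MMSE estimation error. -/
def errVar (t b : ℝ) : ℝ := b / (1 + t * b)

lemma estVar_pos {t b : ℝ} (ht : 0 < t) (hb : 0 < b) : 0 < estVar t b := by
  unfold estVar; positivity

lemma errVar_pos {t b : ℝ} (ht : 0 < t) (hb : 0 < b) : 0 < errVar t b := by
  unfold errVar; positivity

lemma estVar_add_errVar {t b : ℝ} (ht : 0 < t) (hb : 0 < b) : estVar t b + errVar t b = b := by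
  unfold estVar errVar
  have : 1 + t * b ≠ 0 := by positivity
  field_simp
  ring

/-! ### MMSE estimates and errors as an independent Gaussian family. -/

namespace RelaySystem

variable {M N τ : ℕ} {Ω : Type*} (S : RelaySystem M N τ Ω)

/-- The entries of the channel estimates and of the estimation errors, as one family. -/
def estErr : (Side × Fin M × Fin N) ⊕ (Side × Fin M × Fin N) → Ω → ℂ
  | Sum.inl q, ω => S.Ghat q.1 ω q.2.1 q.2.2
  | Sum.inr q, ω => S.G q.1 ω q.2.1 q.2.2 - S.Ghat q.1 ω q.2.1 q.2.2

/-- The variances of the family `estErr`. -/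
def estErrVar : (Side × Fin M × Fin N) ⊕ (Side × Fin M × Fin N) → ℝ
  | Sum.inl q => estVar (τ * S.pp) (S.β q.1 q.2.2)
  | Sum.inr q => errVar (τ * S.pp) (S.β q.1 q.2.2)

/-- The variances of the family `entries`. -/
def entriesVar : (Side × Fin M × Fin N) ⊕ (Fin M × Fin τ) → ℝ
  | Sum.inl q => S.β q.1 q.2.2
  | Sum.inr _ => 1

/-- The shrinkage factor of the MMSE estimate. -/
def mmseGain (X : Side) (i : Fin N) : ℝ := (1 / (τ * S.pp) * (S.β X i)⁻¹ + 1)⁻¹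

/-- The matrix of the linear map from `entries` to `estErr`. -/
def estErrCoeff : (Side × Fin M × Fin N) ⊕ (Side × Fin M × Fin N) →
    (Side × Fin M × Fin N) ⊕ (Fin M × Fin τ) → ℂ
  | Sum.inl q, Sum.inl k => if q = k then (S.mmseGain q.1 q.2.2 : ℂ) else 0
  | Sum.inl q, Sum.inr k => if q.2.1 = k.1 then
      ((S.mmseGain q.1 q.2.2 / Real.sqrt (τ * S.pp) : ℝ) : ℂ) * star (S.Φ q.1 k.2 q.2.2) else 0
  | Sum.inr q, Sum.inl k => if q = k then ((1 - S.mmseGain q.1 q.2.2 : ℝ) : ℂ) else 0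
  | Sum.inr q, Sum.inr k => if q.2.1 = k.1 then
      ((-(S.mmseGain q.1 q.2.2 / Real.sqrt (τ * S.pp)) : ℝ) : ℂ) * star (S.Φ q.1 k.2 q.2.2) else 0

variable {S} [MeasurableSpace Ω] {μ : Measure Ω}

lemma IsModel.sum_pilot (hS : S.IsModel μ) (X Y : Side) (i j : Fin N) :
    ∑ s, S.Φ X s i * star (S.Φ Y s j) = if X = Y ∧ i = j then 1 else 0 := by
  have h := congrFun (congrFun (hS.orthonormal X Y) i) j
  rw [Matrix.mul_apply] at h
  simp only [Matrix.transpose_apply, Matrix.map_apply] at h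
  rw [h]
  by_cases hXY : X = Y <;> simp [hXY, Matrix.one_apply]

/-- Multiplication by the conjugate pilots removes the other side and the other pairs by
orthonormality; what remains is the own channel and despread noise, shrunk by the MMSE factor. -/
lemma IsModel.Ghat_apply (hS : S.IsModel μ) (ht : 0 < τ * S.pp) (X : Side) (ω : Ω)
    (m : Fin M) (i : Fin N) :
    S.Ghat X ω m i = (S.mmseGain X i : ℂ) * S.G X ω m i +
      ∑ s, ((S.mmseGain X i / Real.sqrt (τ * S.pp) : ℝ) : ℂ) * star (S.Φ X s i) * S.Np ω m s := by
  have h1 : S.Yp ω * (S.Φ X).map star =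
      ((Real.sqrt (τ * S.pp) : ℝ) : ℂ) • S.G X ω + S.Np ω * (S.Φ X).map star := by
    rw [Yp, Matrix.add_mul, Matrix.sum_mul]
    congr 1
    rw [Finset.sum_eq_single X]
    · rw [Matrix.smul_mul, Matrix.mul_assoc, hS.orthonormal, if_pos rfl, Matrix.mul_one]
    · intro Y _ hY
      rw [Matrix.smul_mul, Matrix.mul_assoc, hS.orthonormal, if_neg hY, Matrix.mul_zero, smul_zero]
    · simp
  have h2 : ((Real.sqrt (τ * S.pp) : ℝ) : ℂ) ≠ 0 := by
    exact_mod_cast (Real.sqrt_pos.2 ht).ne'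
  rw [Ghat, h1, Matrix.smul_apply, Matrix.mul_diagonal, Matrix.add_apply, Matrix.smul_apply,
    Matrix.mul_apply]
  simp only [smul_eq_mul, Matrix.map_apply]
  change _ * ((_ + _) * ((S.mmseGain X i : ℝ) : ℂ)) = _
  simp only [mul_assoc, ← Finset.mul_sum]
  push_cast
  rw [Finset.sum_congr rfl fun s _ => mul_comm (S.Np ω m s) _]
  field_simp

lemma IsModel.estErr_eq (hS : S.IsModel μ) (ht : 0 < τ * S.pp) :
    S.estErr = fun q ω => ∑ k, S.estErrCoeff q k * S.entries k ω := by
  funext q ω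
  rcases q with ⟨X, m, i⟩ | ⟨X, m, i⟩
  · simp only [estErr, Fintype.sum_sum_type, estErrCoeff, entries, ite_mul, zero_mul,
      Finset.sum_ite_eq, Finset.mem_univ, if_true, Fintype.sum_prod_type, Finset.sum_ite_irrel,
      Finset.sum_const_zero]
    rw [hS.Ghat_apply ht]
  · simp only [estErr, Fintype.sum_sum_type, estErrCoeff, entries, ite_mul, zero_mul,
      Finset.sum_ite_eq, Finset.mem_univ, if_true, Fintype.sum_prod_type, Finset.sum_ite_irrel,
      Finset.sum_const_zero]
    rw [hS.Ghat_apply ht]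
    simp only [Complex.ofReal_neg, neg_mul, Finset.sum_neg_distrib]
    push_cast
    ring

lemma IsModel.isGaussianFamily_entries (hS : S.IsModel μ) (hβ : ∀ X i, 0 < S.β X i) :
    IsGaussianFamily S.entries S.entriesVar μ where
  measurable := hS.measurable
  nonneg q := by
    rcases q with q | q
    · exact (hβ _ _).le
    · exact zero_le_one
  law q := by
    rcases q with q | q
    · exact hS.channel_law _ _ _
    · exact hS.noise_law _ _
  indep := hS.indep

/-- By `linearImage` only the covariance has to be diagonal. With shrinkage k = t b / (1 + t b),
estimate and error have covariance b k (1 - k) - k² / t = 0; entries with different indices decouple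
by orthonormality of the pilots. -/
lemma IsModel.isGaussianFamily_estErr [IsProbabilityMeasure μ] (hS : S.IsModel μ)
    (hβ : ∀ X i, 0 < S.β X i) (ht : 0 < τ * S.pp) :
    IsGaussianFamily S.estErr S.estErrVar μ := by
  rw [hS.estErr_eq ht]
  have hk : ∀ X i, S.mmseGain X i = τ * S.pp * S.β X i / (1 + τ * S.pp * S.β X i) := fun X i => by
    have h1 := hβ X i
    generalize hb : S.β X i = b at *
    rw [mmseGain, hb]
    generalize τ * S.pp = t at *
    field_simp
  have hs : Real.sqrt (τ * S.pp) ^ 2 = τ * S.pp := Real.sq_sqrt ht.le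
  have hs0 : 0 < Real.sqrt (τ * S.pp) := Real.sqrt_pos.2 ht
  refine (hS.isGaussianFamily_entries hβ).linearImage S.estErrCoeff (fun q => ?_) fun q q' => ?_
  · rcases q with q | q
    · exact (estVar_pos ht (hβ _ _)).le
    · exact (errVar_pos ht (hβ _ _)).le
  have key1 : ∀ (a b : Side → Fin N → ℝ) (q q' : Side × Fin M × Fin N),
      ∑ k : Side × Fin M × Fin N, (S.β k.1 k.2.2 : ℂ) *
        ((if q = k then (a q.1 q.2.2 : ℂ) else 0) *
          star (if q' = k then (b q'.1 q'.2.2 : ℂ) else 0)) =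
      if q = q' then ((S.β q.1 q.2.2 * (a q.1 q.2.2 * b q.1 q.2.2) : ℝ) : ℂ) else 0 := by
    intro a b q q'
    rw [Fintype.sum_eq_single q (by intro k hk; simp [hk.symm]), if_pos rfl]
    by_cases h : q = q'
    · subst h; simp
    · simp [h, Ne.symm h]
  have key2 : ∀ (a b : Side → Fin N → ℝ) (q q' : Side × Fin M × Fin N),
      ∑ k : Fin M × Fin τ, ((1 : ℝ) : ℂ) *
        ((if q.2.1 = k.1 then (a q.1 q.2.2 : ℂ) * star (S.Φ q.1 k.2 q.2.2) else 0) *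
          star (if q'.2.1 = k.1 then (b q'.1 q'.2.2 : ℂ) * star (S.Φ q'.1 k.2 q'.2.2) else 0)) =
      if q = q' then ((a q.1 q.2.2 * b q.1 q.2.2 : ℝ) : ℂ) else 0 := by
    intro a b q q'
    obtain ⟨X, m, i⟩ := q
    obtain ⟨Y, n, j⟩ := q'
    rw [Fintype.sum_prod_type, Fintype.sum_eq_single m (by intro k hk; simp [hk.symm])]
    by_cases h : n = m
    · subst h
      have h1 := hS.sum_pilot Y X j i
      simp only [if_true, star_mul', star_star, Complex.ofReal_one, one_mul]
      rw [Finset.sum_congr rfl fun s _ => show ((a X i : ℂ) * star (S.Φ X s i) *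
        (star (b Y j : ℂ) * S.Φ Y s j)) = (a X i * b Y j : ℂ) * (S.Φ Y s j * star (S.Φ X s i)) by
          simp; ring, ← Finset.mul_sum, h1]
      by_cases h2 : X = Y ∧ i = j
      · obtain ⟨rfl, rfl⟩ := h2; simp
      · rw [if_neg (by rintro ⟨h3, h4⟩; exact h2 ⟨h3.symm, h4.symm⟩), if_neg]
        · simp
        · intro h3; simp at h3; exact h2 h3
    · rw [if_neg (fun h1 => h (by simp at h1; exact h1.2.1.symm))]
      simp [h]
  -- All four blocks of the covariance (estimate or error against estimate or error) have this
  -- shape: a channel part with coefficients a, b and a noise part with coefficients a', b'. Only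
  -- the scalar identity for v differs.
  have hval : ∀ (a b a' b' : Side → Fin N → ℝ) (q q' : Side × Fin M × Fin N) (v : ℝ),
      S.β q.1 q.2.2 * (a q.1 q.2.2 * b q.1 q.2.2) + a' q.1 q.2.2 * b' q.1 q.2.2 = v →
      ∑ k : Side × Fin M × Fin N, (S.β k.1 k.2.2 : ℂ) *
        ((if q = k then (a q.1 q.2.2 : ℂ) else 0) *
          star (if q' = k then (b q'.1 q'.2.2 : ℂ) else 0)) +
      ∑ k : Fin M × Fin τ, ((1 : ℝ) : ℂ) *
        ((if q.2.1 = k.1 then (a' q.1 q.2.2 : ℂ) * star (S.Φ q.1 k.2 q.2.2) else 0) *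
          star (if q'.2.1 = k.1 then (b' q'.1 q'.2.2 : ℂ) * star (S.Φ q'.1 k.2 q'.2.2) else 0)) =
      if q = q' then (v : ℂ) else 0 := by
    intro a b a' b' q q' v hv
    rw [key1, key2, ← hv]
    by_cases h : q = q' <;> simp [h]
  rw [Fintype.sum_sum_type]
  rcases q with q | q <;> rcases q' with q' | q'
  · refine (hval (fun X i => S.mmseGain X i) (fun X i => S.mmseGain X i)
      (fun X i => S.mmseGain X i / Real.sqrt (τ * S.pp))
      (fun X i => S.mmseGain X i / Real.sqrt (τ * S.pp)) q q' (S.estErrVar (Sum.inl q)) ?_).trans ?_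
    · have hb := hβ q.1 q.2.2
      simp only [hk, estErrVar, estVar]
      generalize S.β q.1 q.2.2 = b at *
      rw [div_mul_div_comm _ (Real.sqrt _), ← pow_two (Real.sqrt _), hs]
      generalize τ * S.pp = t at *
      field_simp
      ring
    · by_cases h : q = q' <;> simp [h]
  · refine (hval (fun X i => S.mmseGain X i) (fun X i => 1 - S.mmseGain X i)
      (fun X i => S.mmseGain X i / Real.sqrt (τ * S.pp))
      (fun X i => -(S.mmseGain X i / Real.sqrt (τ * S.pp))) q q' 0 ?_).trans ?_
    · have hb := hβ q.1 q.2.2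
      simp only [hk]
      generalize S.β q.1 q.2.2 = b at *
      rw [mul_neg, div_mul_div_comm _ (Real.sqrt _), ← pow_two (Real.sqrt _), hs]
      generalize τ * S.pp = t at *
      field_simp
      ring
    · simp
  · refine (hval (fun X i => 1 - S.mmseGain X i) (fun X i => S.mmseGain X i)
      (fun X i => -(S.mmseGain X i / Real.sqrt (τ * S.pp)))
      (fun X i => S.mmseGain X i / Real.sqrt (τ * S.pp)) q q' 0 ?_).trans ?_
    · have hb := hβ q.1 q.2.2
      simp only [hk]
      generalize S.β q.1 q.2.2 = b at *
      rw [neg_mul, div_mul_div_comm _ (Real.sqrt _), ← pow_two (Real.sqrt _), hs]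
      generalize τ * S.pp = t at *
      field_simp
      ring
    · simp
  · refine (hval (fun X i => 1 - S.mmseGain X i) (fun X i => 1 - S.mmseGain X i)
      (fun X i => -(S.mmseGain X i / Real.sqrt (τ * S.pp)))
      (fun X i => -(S.mmseGain X i / Real.sqrt (τ * S.pp))) q q' (S.estErrVar (Sum.inr q))
      ?_).trans ?_
    · have hb := hβ q.1 q.2.2
      simp only [hk, estErrVar, errVar]
      generalize S.β q.1 q.2.2 = b at *
      rw [neg_mul_neg, div_mul_div_comm _ (Real.sqrt _), ← pow_two (Real.sqrt _), hs]
      generalize τ * S.pp = t at *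
      field_simp
      ring
    · by_cases h : q = q' <;> simp [h]

end RelaySystem

/-- The Hölder exponents that put products of two Gaussian entries in L², via their fourth moments.
-/
instance holderTriple_four_four_two : ENNReal.HolderTriple 4 4 2 := by
  constructor
  have h : (4 : ENNReal)⁻¹ = 2⁻¹ * 2⁻¹ := by
    rw [← ENNReal.mul_inv (by simp) (by simp)]; norm_num
  rw [h, ← mul_add, ENNReal.inv_two_add_inv_two, mul_one]

/-! ### Complex variances of sums of independent terms. -/

section SecondMoments

variable {Ω : Type*} [MeasurableSpace Ω] {μ : Measure Ω}

/-- Used to separate two antennas, and to separate all estimates from all errors. The index maps a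
and b may repeat values; only their images must be disjoint. -/
lemma iIndepFun_indepFun_of_forall_ne {κ σ σ' E : Type*} [Finite σ] [Finite σ']
    [MeasurableSpace E] {F : κ → Ω → E} (hF : iIndepFun F μ) (hm : ∀ q, Measurable (F q))
    {a : σ → κ} {b : σ' → κ} (hab : ∀ s s', a s ≠ b s') :
    IndepFun (fun ω s => F (a s) ω) (fun ω s => F (b s) ω) μ := by
  classical
  have := Fintype.ofFinite σ
  have := Fintype.ofFinite σ'
  have hd : Disjoint (Finset.univ.image a) (Finset.univ.image b) := by
    rw [Finset.disjoint_left]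
    intro q h1 h2
    simp only [Finset.mem_image, Finset.mem_univ, true_and] at h1 h2
    obtain ⟨s, rfl⟩ := h1
    obtain ⟨s', h⟩ := h2
    exact hab s s' h.symm
  have h := hF.indepFun_finset _ _ hd hm
  exact h.comp
    (φ := fun x s => x ⟨a s, Finset.mem_image_of_mem a (Finset.mem_univ s)⟩)
    (ψ := fun x s => x ⟨b s, Finset.mem_image_of_mem b (Finset.mem_univ s)⟩)
    (by fun_prop) (by fun_prop)

variable [IsProbabilityMeasure μ]

lemma complexVariance_eq_add_variance {Z : Ω → ℂ} (hZ : MemLp Z 2 μ) :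
    complexVariance Z μ = Var[fun ω => (Z ω).re; μ] + Var[fun ω => (Z ω).im; μ] := by
  have hi := hZ.integrable one_le_two
  have hre := Complex.reCLM.integral_comp_comm hi
  have him := Complex.imCLM.integral_comp_comm hi
  simp only [Complex.reCLM_apply, Complex.imCLM_apply] at hre him
  have h1 : MemLp (fun ω => (Z ω).re) 2 μ := hZ.re
  have h2 : MemLp (fun ω => (Z ω).im) 2 μ := hZ.im
  rw [variance_eq_integral h1.aemeasurable, variance_eq_integral h2.aemeasurable, hre, him,
    complexVariance, ← integral_add]
  · refine integral_congr_ae (ae_of_all _ fun ω => ?_)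
    simp only [Complex.sq_norm, Complex.normSq_apply, Complex.sub_re, Complex.sub_im]
    ring
  · exact (h1.sub (memLp_const _)).integrable_sq
  · exact (h2.sub (memLp_const _)).integrable_sq

lemma integral_norm_sq_eq_complexVariance_add {Z : Ω → ℂ} (hZ : MemLp Z 2 μ) :
    ∫ ω, ‖Z ω‖ ^ 2 ∂μ = complexVariance Z μ + ‖∫ ω, Z ω ∂μ‖ ^ 2 := by
  have hi := hZ.integrable one_le_two
  have hre := Complex.reCLM.integral_comp_comm hi
  have him := Complex.imCLM.integral_comp_comm hi
  simp only [Complex.reCLM_apply, Complex.imCLM_apply] at hre him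
  have h1 : MemLp (fun ω => (Z ω).re) 2 μ := hZ.re
  have h2 : MemLp (fun ω => (Z ω).im) 2 μ := hZ.im
  rw [complexVariance_eq_add_variance hZ, variance_eq_sub h1, variance_eq_sub h2, hre, him]
  simp only [Complex.sq_norm, Complex.normSq_apply, Pi.pow_apply, ← pow_two]
  rw [integral_add h1.integrable_sq h2.integrable_sq]
  ring

lemma complexVariance_sum {ι : Type*} [Fintype ι] {U : ι → Ω → ℂ} (hU : ∀ m, MemLp (U m) 2 μ)
    (hind : ∀ m n, m ≠ n → IndepFun (U m) (U n) μ) :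
    complexVariance (fun ω => ∑ m, U m ω) μ = ∑ m, complexVariance (U m) μ := by
  rw [complexVariance_eq_add_variance (memLp_finsetSum _ fun m _ => hU m)]
  simp only [complexVariance_eq_add_variance (hU _), Complex.re_sum, Complex.im_sum,
    Finset.sum_add_distrib]
  congr 1
  · rw [← IndepFun.variance_sum (X := fun m ω => (U m ω).re) (fun m _ => (hU m).re)
      (fun m _ n _ hmn => (hind m n hmn).comp Complex.measurable_re Complex.measurable_re)]
    congr 1
    ext ω
    simp
  · rw [← IndepFun.variance_sum (X := fun m ω => (U m ω).im) (fun m _ => (hU m).im)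
      (fun m _ n _ hmn => (hind m n hmn).comp Complex.measurable_im Complex.measurable_im)]
    congr 1
    ext ω
    simp

/-- The form in which inner products of channel vectors are evaluated: one summand per antenna, with
moments that do not depend on the antenna. -/
lemma complexVariance_sum_of_moments {M : ℕ} {U : Fin M → Ω → ℂ} (hU : ∀ m, MemLp (U m) 2 μ)
    (hind : ∀ m n, m ≠ n → IndepFun (U m) (U n) μ) {c : ℂ} {q : ℝ}
    (hc : ∀ m, ∫ ω, U m ω ∂μ = c) (hq : ∀ m, ∫ ω, ‖U m ω‖ ^ 2 ∂μ = q) :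
    ∫ ω, ∑ m, U m ω ∂μ = M * c ∧
      complexVariance (fun ω => ∑ m, U m ω) μ = M * (q - ‖c‖ ^ 2) := by
  constructor
  · rw [integral_finsetSum _ fun m _ => (hU m).integrable one_le_two]
    simp [hc]
  · rw [complexVariance_sum hU hind, Finset.sum_congr rfl fun m _ => show
      complexVariance (U m) μ = q - ‖c‖ ^ 2 from ?_]
    · simp [mul_sub]
    · rw [← hq m, integral_norm_sq_eq_complexVariance_add (hU m), hc]
      ring

lemma integral_norm_sq_sum_of_moments {M : ℕ} {U : Fin M → Ω → ℂ} (hU : ∀ m, MemLp (U m) 2 μ)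
    (hind : ∀ m n, m ≠ n → IndepFun (U m) (U n) μ) {q : ℝ}
    (hc : ∀ m, ∫ ω, U m ω ∂μ = 0) (hq : ∀ m, ∫ ω, ‖U m ω‖ ^ 2 ∂μ = q) :
    ∫ ω, ‖∑ m, U m ω‖ ^ 2 ∂μ = M * q := by
  obtain ⟨h1, h2⟩ := complexVariance_sum_of_moments hU hind hc hq
  rw [integral_norm_sq_eq_complexVariance_add (memLp_finsetSum _ fun m _ => hU m), h1, h2]
  simp

end SecondMoments

/-! ### Moments of products inside a Gaussian family. -/

namespace IsGaussianFamily

variable {Ω κ : Type*} [MeasurableSpace Ω] {μ : Measure Ω}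
  {F : κ → Ω → ℂ} {w : κ → ℝ}

lemma memLp (hF : IsGaussianFamily F w μ) (q : κ) {p : ENNReal} (hp : p ≠ ⊤) :
    MemLp (F q) p μ := by
  have h := memLp_complexGaussian (w q) hp
  rw [← hF.law q, memLp_map_measure_iff (by fun_prop) (hF.measurable q).aemeasurable] at h
  exact h

lemma integral_comp (hF : IsGaussianFamily F w μ) (q : κ) {E : Type*} [NormedAddCommGroup E]
    [NormedSpace ℝ E] {f : ℂ → E} (hf : StronglyMeasurable f) :
    ∫ ω, f (F q ω) ∂μ = ∫ z, f z ∂complexGaussian (w q) := by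
  rw [← hF.law q, integral_map (hF.measurable q).aemeasurable hf.aestronglyMeasurable]

lemma integral_eq_zero (hF : IsGaussianFamily F w μ) (q : κ) : ∫ ω, F q ω ∂μ = 0 := by
  rw [hF.integral_comp q (f := fun z => z) (by fun_prop), integral_complexGaussian]

lemma integral_norm_sq (hF : IsGaussianFamily F w μ) (q : κ) : ∫ ω, ‖F q ω‖ ^ 2 ∂μ = w q := by
  rw [hF.integral_comp q (f := fun z => ‖z‖ ^ 2) (by fun_prop),
    integral_norm_sq_complexGaussian (hF.nonneg q)]

lemma integral_norm_pow_four (hF : IsGaussianFamily F w μ) (q : κ) :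
    ∫ ω, ‖F q ω‖ ^ 4 ∂μ = kurt * w q ^ 2 := by
  rw [hF.integral_comp q (f := fun z => ‖z‖ ^ 4) (by fun_prop),
    integral_norm_pow_four_complexGaussian (hF.nonneg q)]

lemma integrable_norm_sq (hF : IsGaussianFamily F w μ) (q : κ) :
    Integrable (fun ω => ‖F q ω‖ ^ 2) μ := (hF.memLp q ENNReal.ofNat_ne_top).integrable_norm_pow
      two_ne_zero

lemma memLp_norm_sq (hF : IsGaussianFamily F w μ) (q : κ) :
    MemLp (fun ω => ‖F q ω‖ ^ 2) 2 μ := by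
  have h := (hF.memLp q (p := 4) ENNReal.ofNat_ne_top).norm
  have h2 : MemLp ((fun ω => ‖F q ω‖) * fun ω => ‖F q ω‖) 2 μ := h.mul h
  refine h2.ae_eq (ae_of_all _ fun ω => ?_)
  simp [pow_two]

lemma memLp_mul (hF : IsGaussianFamily F w μ) (q q' : κ) :
    MemLp (fun ω => F q ω * star (F q' ω)) 2 μ := by
  have h := (hF.memLp q (p := 4) ENNReal.ofNat_ne_top)
  have h' := (hF.memLp q' (p := 4) ENNReal.ofNat_ne_top).star
  exact h'.mul h

lemma integral_mul_star (hF : IsGaussianFamily F w μ) {q q' : κ} (h : q ≠ q') :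
    ∫ ω, F q ω * star (F q' ω) ∂μ = 0 := by
  have hi : IndepFun (F q) (fun ω => star (F q' ω)) μ :=
    (hF.indep.indepFun h).comp measurable_id continuous_star.measurable
  rw [hi.integral_fun_mul_eq_mul_integral (hF.measurable q).aestronglyMeasurable
    (continuous_star.measurable.comp (hF.measurable q')).aestronglyMeasurable, hF.integral_eq_zero, zero_mul]

lemma integral_norm_sq_mul (hF : IsGaussianFamily F w μ) {q q' : κ} (h : q ≠ q') :
    ∫ ω, ‖F q ω‖ ^ 2 * ‖F q' ω‖ ^ 2 ∂μ = w q * w q' := by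
  have hi : IndepFun (fun ω => ‖F q ω‖ ^ 2) (fun ω => ‖F q' ω‖ ^ 2) μ :=
    (hF.indep.indepFun h).comp (φ := fun z => ‖z‖ ^ 2) (ψ := fun z => ‖z‖ ^ 2)
      (by fun_prop) (by fun_prop)
  rw [hi.integral_fun_mul_eq_mul_integral
    (hF.integrable_norm_sq q).aestronglyMeasurable (hF.integrable_norm_sq q').aestronglyMeasurable,
    hF.integral_norm_sq, hF.integral_norm_sq]

lemma integrable_norm_sq_mul (hF : IsGaussianFamily F w μ) (q q' : κ) :
    Integrable (fun ω => ‖F q ω‖ ^ 2 * ‖F q' ω‖ ^ 2) μ :=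
  (hF.memLp_norm_sq q).integrable_mul (hF.memLp_norm_sq q')

variable [IsProbabilityMeasure μ]

lemma integral_add_mul_star_self (hF : IsGaussianFamily F w μ) {q q' : κ} (h : q ≠ q') :
    ∫ ω, (F q ω + F q' ω) * star (F q ω) ∂μ = w q := by
  simp only [add_mul]
  rw [integral_add ((hF.memLp_mul q q).integrable one_le_two)
    ((hF.memLp_mul q' q).integrable one_le_two), hF.integral_mul_star h.symm, add_zero,
    ← hF.integral_norm_sq q, ← integral_complex_ofReal]
  congr 1
  ext ω
  simp [Complex.mul_conj']

/-- For an estimate x and its error y, |(x + y) x̄|² = |x|⁴ + |x|² |y|² + 2 Re (y x̄ |x|²), and the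
last term has mean zero because y is centred and independent of x. -/
lemma integral_norm_sq_add_mul_star_self (hF : IsGaussianFamily F w μ) {q q' : κ} (h : q ≠ q') :
    ∫ ω, ‖(F q ω + F q' ω) * star (F q ω)‖ ^ 2 ∂μ = kurt * w q ^ 2 + w q * w q' := by
  have hi : IndepFun (fun ω => F q' ω) (fun ω => star (F q ω) * (‖F q ω‖ ^ 2 : ℝ)) μ :=
    (hF.indep.indepFun h.symm).comp (φ := fun z => z)
      (ψ := fun z : ℂ => star z * ((‖z‖ ^ 2 : ℝ) : ℂ)) (by fun_prop) (by fun_prop)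
  have h4 : MemLp (fun ω => star (F q ω) * ((‖F q ω‖ ^ 2 : ℝ) : ℂ)) 1 μ :=
    ((hF.memLp_norm_sq q).ofReal (K := ℂ)).mul (hF.memLp q (p := 2) ENNReal.ofNat_ne_top).star
  have hint : Integrable (fun ω => F q' ω * (star (F q ω) * ((‖F q ω‖ ^ 2 : ℝ) : ℂ))) μ :=
    hi.integrable_mul ((hF.memLp q' ENNReal.one_ne_top).integrable le_rfl) (h4.integrable le_rfl)
  have hz : ∫ ω, F q' ω * (star (F q ω) * ((‖F q ω‖ ^ 2 : ℝ) : ℂ)) ∂μ = 0 := by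
    rw [hi.integral_fun_mul_eq_mul_integral (hF.measurable q').aestronglyMeasurable
      h4.aestronglyMeasurable, hF.integral_eq_zero, zero_mul]
  have hz' : ∫ ω, (F q' ω * (star (F q ω) * ((‖F q ω‖ ^ 2 : ℝ) : ℂ))).re ∂μ = 0 := by
    have := Complex.reCLM.integral_comp_comm hint
    simp only [Complex.reCLM_apply] at this
    rw [this, hz, Complex.zero_re]
  have hre : Integrable (fun ω => (F q' ω * (star (F q ω) * ((‖F q ω‖ ^ 2 : ℝ) : ℂ))).re) μ :=
    hint.re
  have hfour : Integrable (fun ω => ‖F q ω‖ ^ 4) μ :=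
    (hF.memLp q (p := 4) ENNReal.ofNat_ne_top).integrable_norm_pow (by norm_num)
  have hexp : ∀ ω, ‖(F q ω + F q' ω) * star (F q ω)‖ ^ 2 =
      ‖F q ω‖ ^ 4 + ‖F q ω‖ ^ 2 * ‖F q' ω‖ ^ 2 +
        2 * (F q' ω * (star (F q ω) * ((‖F q ω‖ ^ 2 : ℝ) : ℂ))).re := fun ω => by
    rw [show ‖F q ω‖ ^ 4 = (‖F q ω‖ ^ 2) ^ 2 by ring]
    simp only [norm_mul, norm_star, mul_pow]
    generalize F q ω = x
    generalize F q' ω = y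
    rw [← mul_assoc, Complex.re_mul_ofReal]
    simp only [Complex.sq_norm, Complex.normSq_apply]
    simp
    ring
  simp only [hexp]
  rw [integral_add (f := fun ω => ‖F q ω‖ ^ 4 + ‖F q ω‖ ^ 2 * ‖F q' ω‖ ^ 2)
      (hfour.add (hF.integrable_norm_sq_mul q q')) (hre.const_mul 2),
    integral_add hfour (hF.integrable_norm_sq_mul q q'), integral_const_mul, hz',
    hF.integral_norm_pow_four, hF.integral_norm_sq_mul h]
  ring

end IsGaussianFamily

/-- Freezing: the joint law of U and V is a product, so by Fubini integrating out V with U fixed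
gives the right integral over every set of the σ-algebra of U. -/
lemma condExp_comap_of_indepFun {Ω α γ : Type*} [mΩ : MeasurableSpace Ω] {mα : MeasurableSpace α}
    [MeasurableSpace γ] {μ : Measure Ω} [IsProbabilityMeasure μ] {U : Ω → α} {V : Ω → γ}
    (hU : Measurable U) (hV : Measurable V) (hUV : IndepFun U V μ) {f : α × γ → ℝ}
    (hf : Measurable f) (hint : Integrable (fun ω => f (U ω, V ω)) μ) :
    condExp (MeasurableSpace.comap U mα) μ (fun ω => f (U ω, V ω)) =ᵐ[μ]
      fun ω => ∫ ω', f (U ω, V ω') ∂μ := by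
  have hmap := (indepFun_iff_map_prod_eq_prod_map_map hU.aemeasurable hV.aemeasurable).1 hUV
  have : IsProbabilityMeasure (μ.map U) := Measure.isProbabilityMeasure_map hU.aemeasurable
  have : IsProbabilityMeasure (μ.map V) := Measure.isProbabilityMeasure_map hV.aemeasurable
  have hint' : Integrable f ((μ.map U).prod (μ.map V)) := by
    rw [← hmap, integrable_map_measure hf.aestronglyMeasurable (hU.prodMk hV).aemeasurable]
    exact hint
  set h : α → ℝ := fun u => ∫ v, f (u, v) ∂(μ.map V) with hh
  have hhm : StronglyMeasurable h := hf.stronglyMeasurable.integral_prod_right'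
  have hrepr : (fun ω => ∫ ω', f (U ω, V ω') ∂μ) = fun ω => h (U ω) := by
    funext ω
    rw [hh]
    simp only
    rw [integral_map (f := fun v => f (U ω, v)) hV.aemeasurable
      (hf.comp measurable_prodMk_left).aestronglyMeasurable]
  rw [hrepr]
  have hhint : Integrable (fun ω => h (U ω)) μ := by
    have := hint'.integral_prod_left
    rwa [integrable_map_measure hhm.aestronglyMeasurable hU.aemeasurable] at this
  symm
  refine ae_eq_condExp_of_forall_setIntegral_eq hU.comap_le hint
    (fun s _ _ => hhint.integrableOn) ?_ ?_
  · rintro s ⟨B, hB, rfl⟩ -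
    have h1 : ∫ ω in U ⁻¹' B, h (U ω) ∂μ = ∫ u in B, h u ∂(μ.map U) :=
      (setIntegral_map hB hhm.aestronglyMeasurable hU.aemeasurable).symm
    have h2 : ∫ ω in U ⁻¹' B, f (U ω, V ω) ∂μ =
        ∫ x in B ×ˢ Set.univ, f x ∂((μ.map U).prod (μ.map V)) := by
      rw [← hmap, setIntegral_map (hB.prod MeasurableSet.univ) hf.aestronglyMeasurable
        (hU.prodMk hV).aemeasurable]
      congr 2
      ext ω
      simp
    rw [h1, h2, setIntegral_prod _ hint'.integrableOn]
    simp [hh]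
  · exact (hhm.comp_measurable (comap_measurable U)).aestronglyMeasurable

/-! ### Moments of gains, norms and inner products. -/

namespace RelaySystem

variable {M N τ : ℕ} {Ω : Type*} (S : RelaySystem M N τ Ω)

/-- The variance of the entries of `ĝ_{X,i}`. -/
def sigVar (X : Side) (i : Fin N) : ℝ := estVar (τ * S.pp) (S.β X i)

/-- The variance of the entries of `e_{X,i}`. -/
def epsVar (X : Side) (i : Fin N) : ℝ := errVar (τ * S.pp) (S.β X i)

/-- The squared norm of `ĝ_{X,i}`. -/
def normSq (X : Side) (i : Fin N) (ω : Ω) : ℝ := ∑ m, ‖S.ghat X i ω m‖ ^ 2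

/-- The inner product of `ĝ_{Y,i}` and `ĝ_{X,j}`. -/
def cross (Y : Side) (i : Fin N) (X : Side) (j : Fin N) (ω : Ω) : ℂ :=
  star (S.ghat Y i ω) ⬝ᵥ S.ghat X j ω

lemma g_apply (X : Side) (i : Fin N) (ω : Ω) (m : Fin M) :
    S.g X i ω m = S.estErr (Sum.inl (X, m, i)) ω + S.estErr (Sum.inr (X, m, i)) ω := by
  simp [g, estErr]

lemma ghat_apply (X : Side) (i : Fin N) (ω : Ω) (m : Fin M) :
    S.ghat X i ω m = S.estErr (Sum.inl (X, m, i)) ω := rfl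

lemma e_apply (X : Side) (i : Fin N) (ω : Ω) (m : Fin M) :
    S.e X i ω m = S.estErr (Sum.inr (X, m, i)) ω := rfl

lemma gain_eq (X : Side) (i : Fin N) (Y : Side) (j : Fin N) :
    S.gain X i Y j = fun ω => ∑ m, (S.estErr (Sum.inl (X, m, i)) ω +
      S.estErr (Sum.inr (X, m, i)) ω) * star (S.estErr (Sum.inl (Y, m, j)) ω) := by
  funext ω
  simp only [gain, dotProduct, g_apply, Pi.star_apply, ghat_apply]

lemma cross_eq (Y : Side) (i : Fin N) (X : Side) (j : Fin N) :
    S.cross Y i X j = fun ω => ∑ m, S.estErr (Sum.inl (X, m, j)) ω *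
      star (S.estErr (Sum.inl (Y, m, i)) ω) := by
  funext ω
  simp only [cross, dotProduct, Pi.star_apply, ghat_apply, mul_comm]

variable {S} [MeasurableSpace Ω] {μ : Measure Ω}

lemma indepFun_rows (hF : IsGaussianFamily S.estErr S.estErrVar μ) {m n : Fin M} (hmn : m ≠ n) :
    IndepFun (fun ω (s : (Side × Fin N) ⊕ (Side × Fin N)) => S.estErr
        (Sum.map (fun p => (p.1, m, p.2)) (fun p => (p.1, m, p.2)) s) ω)
      (fun ω (s : (Side × Fin N) ⊕ (Side × Fin N)) => S.estErr
        (Sum.map (fun p => (p.1, n, p.2)) (fun p => (p.1, n, p.2)) s) ω) μ := by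
  refine iIndepFun_indepFun_of_forall_ne hF.indep hF.measurable ?_
  rintro (⟨X, i⟩ | ⟨X, i⟩) (⟨Y, j⟩ | ⟨Y, j⟩) <;> simp [hmn]

section Row

variable (hF : IsGaussianFamily S.estErr S.estErrVar μ)
include hF

lemma memLp_gain_row (X : Side) (i : Fin N) (Y : Side) (j : Fin N) (m : Fin M) :
    MemLp (fun ω => (S.estErr (Sum.inl (X, m, i)) ω + S.estErr (Sum.inr (X, m, i)) ω) *
      star (S.estErr (Sum.inl (Y, m, j)) ω)) 2 μ := by
  simp only [add_mul]
  exact (hF.memLp_mul _ _).add (hF.memLp_mul _ _)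

lemma indepFun_gain_row (X : Side) (i : Fin N) (Y : Side) (j : Fin N) {m n : Fin M}
    (hmn : m ≠ n) :
    IndepFun (fun ω => (S.estErr (Sum.inl (X, m, i)) ω + S.estErr (Sum.inr (X, m, i)) ω) *
      star (S.estErr (Sum.inl (Y, m, j)) ω))
      (fun ω => (S.estErr (Sum.inl (X, n, i)) ω + S.estErr (Sum.inr (X, n, i)) ω) *
      star (S.estErr (Sum.inl (Y, n, j)) ω)) μ :=
  (indepFun_rows hF hmn).comp
    (φ := fun x : (Side × Fin N) ⊕ (Side × Fin N) → ℂ =>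
      (x (Sum.inl (X, i)) + x (Sum.inr (X, i))) * star (x (Sum.inl (Y, j))))
    (ψ := fun x : (Side × Fin N) ⊕ (Side × Fin N) → ℂ =>
      (x (Sum.inl (X, i)) + x (Sum.inr (X, i))) * star (x (Sum.inl (Y, j))))
    (by fun_prop) (by fun_prop)

lemma memLp_gain (X : Side) (i : Fin N) (Y : Side) (j : Fin N) :
    MemLp (S.gain X i Y j) 2 μ := by
  rw [gain_eq]
  exact memLp_finsetSum _ fun m _ => memLp_gain_row hF X i Y j m

lemma memLp_cross (Y : Side) (i : Fin N) (X : Side) (j : Fin N) :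
    MemLp (S.cross Y i X j) 2 μ := by
  rw [cross_eq]
  exact memLp_finsetSum _ fun m _ => hF.memLp_mul _ _

lemma memLp_normSq (X : Side) (i : Fin N) : MemLp (S.normSq X i) 2 μ :=
  memLp_finsetSum Finset.univ (f := fun m ω => ‖S.estErr (Sum.inl (X, m, i)) ω‖ ^ 2)
    fun m _ => hF.memLp_norm_sq (Sum.inl (X, m, i))

lemma integrable_precoderNormSq : Integrable S.precoderNormSq μ :=
  integrable_finsetSum _ fun X _ => integrable_finsetSum _ fun m _ => integrable_finsetSum _
    fun i _ => hF.integrable_norm_sq (Sum.inl (X, m, i))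

lemma integral_precoderNormSq :
    ∫ ω, S.precoderNormSq ω ∂μ = M * ∑ X, ∑ i, S.sigVar X i := by
  have h : ∀ X m i, Integrable (fun ω => ‖S.Ghat X ω m i‖ ^ 2) μ := fun X m i =>
    hF.integrable_norm_sq (Sum.inl (X, m, i))
  have h2 : ∀ X m i, ∫ ω, ‖S.Ghat X ω m i‖ ^ 2 ∂μ = S.sigVar X i := fun X m i =>
    hF.integral_norm_sq (Sum.inl (X, m, i))
  simp only [precoderNormSq]
  rw [integral_finsetSum _ fun X _ => integrable_finsetSum _ fun m _ => integrable_finsetSum _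
    fun i _ => h X m i, Finset.mul_sum]
  refine Finset.sum_congr rfl fun X _ => ?_
  rw [integral_finsetSum _ fun m _ => integrable_finsetSum _ fun i _ => h X m i]
  simp only [integral_finsetSum _ fun i _ => h X _ i, h2]
  simp

lemma integral_normSq (X : Side) (i : Fin N) :
    ∫ ω, S.normSq X i ω ∂μ = M * S.sigVar X i := by
  simp only [normSq, ghat_apply]
  rw [integral_finsetSum _ fun m _ => hF.integrable_norm_sq _]
  simp only [hF.integral_norm_sq]
  simp [estErrVar, sigVar]

variable [IsProbabilityMeasure μ]

/-- The variance is arranged as M σ (σ + ε) plus a multiple of kurt - 2, so that its main part has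
the same form as the second moments of the other gains and can be summed with them in `sinrDown_eq`.
-/
lemma integral_gain_self (X : Side) (i : Fin N) :
    ∫ ω, S.gain X i X i ω ∂μ = M * (S.sigVar X i : ℂ) ∧
      complexVariance (S.gain X i X i) μ =
        M * (S.sigVar X i * (S.sigVar X i + S.epsVar X i + (kurt - 2) * S.sigVar X i)) := by
  obtain ⟨h1, h2⟩ := complexVariance_sum_of_moments (μ := μ)
    (fun m => memLp_gain_row hF X i X i m) (fun m n hmn => indepFun_gain_row hF X i X i hmn)
    (c := (S.sigVar X i : ℂ)) (q := kurt * S.sigVar X i ^ 2 + S.sigVar X i * S.epsVar X i)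
    (fun m => hF.integral_add_mul_star_self (by simp))
    (fun m => hF.integral_norm_sq_add_mul_star_self (by simp))
  rw [gain_eq]
  refine ⟨h1, h2.trans ?_⟩
  rw [Complex.norm_real, Real.norm_eq_abs, sq_abs]
  ring

lemma integral_gain_row_of_ne {X : Side} {i : Fin N} {Y : Side} {j : Fin N}
    (h : (X, i) ≠ (Y, j)) (m : Fin M) :
    ∫ ω, (S.estErr (Sum.inl (X, m, i)) ω + S.estErr (Sum.inr (X, m, i)) ω) *
      star (S.estErr (Sum.inl (Y, m, j)) ω) ∂μ = 0 := by
  have h' : (X, m, i) ≠ (Y, m, j) := fun h1 => h (by simp at h1; simp [h1])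
  simp only [add_mul]
  rw [integral_add ((hF.memLp_mul _ _).integrable one_le_two)
    ((hF.memLp_mul _ _).integrable one_le_two), hF.integral_mul_star (by simpa using h'),
    hF.integral_mul_star (by simp), add_zero]

lemma integral_norm_sq_gain_row_of_ne {X : Side} {i : Fin N} {Y : Side} {j : Fin N}
    (h : (X, i) ≠ (Y, j)) (m : Fin M) :
    ∫ ω, ‖(S.estErr (Sum.inl (X, m, i)) ω + S.estErr (Sum.inr (X, m, i)) ω) *
      star (S.estErr (Sum.inl (Y, m, j)) ω)‖ ^ 2 ∂μ =
      (S.sigVar X i + S.epsVar X i) * S.sigVar Y j := by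
  have h' : (X, m, i) ≠ (Y, m, j) := fun h1 => h (by simp at h1; simp [h1])
  have hi := hF.indep.indepFun_prodMk hF.measurable (Sum.inl (X, m, i)) (Sum.inr (X, m, i))
    (Sum.inl (Y, m, j)) (by simpa using h') (by simp)
  have hi2 : IndepFun (fun ω => ‖S.estErr (Sum.inl (X, m, i)) ω +
      S.estErr (Sum.inr (X, m, i)) ω‖ ^ 2) (fun ω => ‖S.estErr (Sum.inl (Y, m, j)) ω‖ ^ 2) μ :=
    hi.comp (φ := fun x : ℂ × ℂ => ‖x.1 + x.2‖ ^ 2) (ψ := fun x : ℂ => ‖x‖ ^ 2)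
      (by fun_prop) (by fun_prop)
  have hms : ∀ q, AEStronglyMeasurable (S.estErr q) μ := fun q =>
    (hF.measurable q).aestronglyMeasurable
  have hsum : ∫ ω, ‖S.estErr (Sum.inl (X, m, i)) ω + S.estErr (Sum.inr (X, m, i)) ω‖ ^ 2 ∂μ =
      S.sigVar X i + S.epsVar X i := by
    have hL : ∀ q, MemLp (S.estErr q) 2 μ := fun q => hF.memLp q ENNReal.ofNat_ne_top
    -- The channel entry is a sum of two independent terms; indexing them by `Bool` makes
    -- `complexVariance_sum` apply.
    have hU : ∀ s : Bool, MemLp ((fun s ω => S.estErr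
      (bif s then Sum.inl (X, m, i) else Sum.inr (X, m, i)) ω) s) 2 μ := fun s => hL _
    have h0 : ∫ ω, (S.estErr (Sum.inl (X, m, i)) ω + S.estErr (Sum.inr (X, m, i)) ω) ∂μ = 0 := by
      rw [integral_add ((hL _).integrable one_le_two) ((hL _).integrable one_le_two),
        hF.integral_eq_zero, hF.integral_eq_zero, add_zero]
    have hv := complexVariance_sum hU (fun s s' hs => hF.indep.indepFun (by
      cases s <;> cases s' <;> simp_all))
    have hcv : ∀ q, complexVariance (S.estErr q) μ = S.estErrVar q := fun q => by
      rw [← hF.integral_norm_sq q, integral_norm_sq_eq_complexVariance_add (hL q),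
        hF.integral_eq_zero]
      simp
    simp only [Fintype.sum_bool, cond_true, cond_false, hcv] at hv
    have hg : MemLp (fun ω => S.estErr (Sum.inl (X, m, i)) ω +
      S.estErr (Sum.inr (X, m, i)) ω) 2 μ := (hL _).add (hL _)
    rw [integral_norm_sq_eq_complexVariance_add hg, hv, h0]
    simp [estErrVar, sigVar, epsVar]
  simp only [norm_mul, norm_star, mul_pow]
  rw [hi2.integral_fun_mul_eq_mul_integral (((hms _).add (hms _)).norm.pow 2)
    ((hms _).norm.pow 2), hsum, hF.integral_norm_sq]
  rfl

lemma integral_gain_of_ne {X : Side} {i : Fin N} {Y : Side} {j : Fin N} (h : (X, i) ≠ (Y, j)) :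
    ∫ ω, ‖S.gain X i Y j ω‖ ^ 2 ∂μ = M * ((S.sigVar X i + S.epsVar X i) * S.sigVar Y j) ∧
      complexVariance (S.gain X i Y j) μ =
        M * ((S.sigVar X i + S.epsVar X i) * S.sigVar Y j) := by
  rw [gain_eq]
  refine ⟨integral_norm_sq_sum_of_moments (fun m => memLp_gain_row hF X i Y j m)
    (fun m n hmn => indepFun_gain_row hF X i Y j hmn) (integral_gain_row_of_ne hF h)
    (integral_norm_sq_gain_row_of_ne hF h), ?_⟩
  have h2 := (complexVariance_sum_of_moments (fun m => memLp_gain_row hF X i Y j m)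
    (fun m n hmn => indepFun_gain_row hF X i Y j hmn) (integral_gain_row_of_ne hF h)
    (integral_norm_sq_gain_row_of_ne hF h)).2
  rw [h2]
  simp

lemma integral_norm_sq_cross_of_ne {Y : Side} {i : Fin N} {X : Side} {j : Fin N}
    (h : (X, j) ≠ (Y, i)) :
    ∫ ω, ‖S.cross Y i X j ω‖ ^ 2 ∂μ = M * (S.sigVar X j * S.sigVar Y i) := by
  have h' : ∀ m : Fin M, (X, m, j) ≠ (Y, m, i) := fun m h1 => h (by simp at h1; simp [h1])
  rw [cross_eq]
  refine integral_norm_sq_sum_of_moments (fun m => hF.memLp_mul _ _) (fun m n hmn => ?_)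
    (fun m => hF.integral_mul_star (by simpa using h' m)) (fun m => ?_)
  · exact (indepFun_rows hF hmn).comp
      (φ := fun x : (Side × Fin N) ⊕ (Side × Fin N) → ℂ =>
        x (Sum.inl (X, j)) * star (x (Sum.inl (Y, i))))
      (ψ := fun x : (Side × Fin N) ⊕ (Side × Fin N) → ℂ =>
        x (Sum.inl (X, j)) * star (x (Sum.inl (Y, i))))
      (by fun_prop) (by fun_prop)
  · simp only [norm_mul, norm_star, mul_pow]
    exact hF.integral_norm_sq_mul (by simpa using h' m)

/-- Channel hardening: relative to the squared mean (M σ)², this variance of a sum of independent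
terms is (kurt - 1) / M. -/
lemma integral_normSq_sub_sq (X : Side) (i : Fin N) :
    ∫ ω, (S.normSq X i ω - M * S.sigVar X i) ^ 2 ∂μ = M * ((kurt - 1) * S.sigVar X i ^ 2) := by
  have hv := variance_eq_integral (memLp_normSq hF X i).aemeasurable
  rw [integral_normSq hF] at hv
  rw [← hv]
  have h1 : S.normSq X i = ∑ m, fun ω => ‖S.estErr (Sum.inl (X, m, i)) ω‖ ^ 2 := by
    ext ω; simp [normSq, ghat_apply]
  rw [h1, IndepFun.variance_sum (fun m _ => hF.memLp_norm_sq _) (fun m _ n _ hmn =>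
    (hF.indep.indepFun (by simpa using hmn)).comp (φ := fun z => ‖z‖ ^ 2) (ψ := fun z => ‖z‖ ^ 2)
      (by fun_prop) (by fun_prop)),
    Finset.sum_congr rfl fun m _ => show _ = (kurt - 1) * S.sigVar X i ^ 2 from ?_]
  · simp
  · rw [variance_eq_sub (hF.memLp_norm_sq _), hF.integral_norm_sq]
    simp only [Pi.pow_apply, ← pow_mul]
    rw [hF.integral_norm_pow_four]
    simp only [estErrVar, sigVar]
    ring

/-- The average over one error vector with the estimates frozen: z is the part of the received
signal that the estimates determine, a is the frozen combining vector. The shift z moves the mean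
but not the variance. -/
lemma integral_norm_sq_add_sum_mul_err (z : ℂ) (a : Fin M → ℂ) (X : Side) (j : Fin N) :
    Integrable (fun ω => ‖z + ∑ m, a m * S.estErr (Sum.inr (X, m, j)) ω‖ ^ 2) μ ∧
    ∫ ω, ‖z + ∑ m, a m * S.estErr (Sum.inr (X, m, j)) ω‖ ^ 2 ∂μ =
      ‖z‖ ^ 2 + S.epsVar X j * ∑ m, ‖a m‖ ^ 2 := by
  have hL : ∀ m, MemLp (fun ω => a m * S.estErr (Sum.inr (X, m, j)) ω) 2 μ := fun m =>
    (hF.memLp _ ENNReal.ofNat_ne_top).const_mul _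
  have hsum : MemLp (fun ω => ∑ m, a m * S.estErr (Sum.inr (X, m, j)) ω) 2 μ :=
    memLp_finsetSum _ fun m _ => hL m
  have htot : MemLp (fun ω => z + ∑ m, a m * S.estErr (Sum.inr (X, m, j)) ω) 2 μ :=
    (memLp_const z).add hsum
  refine ⟨htot.integrable_norm_pow two_ne_zero, ?_⟩
  have h0 : ∀ m, ∫ ω, a m * S.estErr (Sum.inr (X, m, j)) ω ∂μ = 0 := fun m => by
    rw [integral_const_mul, hF.integral_eq_zero, mul_zero]
  have hm : ∫ ω, ∑ m, a m * S.estErr (Sum.inr (X, m, j)) ω ∂μ = 0 := by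
    rw [integral_finsetSum _ fun m _ => (hL m).integrable one_le_two]
    simp [h0]
  have hm' : ∫ ω, (z + ∑ m, a m * S.estErr (Sum.inr (X, m, j)) ω) ∂μ = z := by
    rw [integral_add (integrable_const _) (hsum.integrable one_le_two), hm]
    simp
  have hcv : complexVariance (fun ω => z + ∑ m, a m * S.estErr (Sum.inr (X, m, j)) ω) μ =
      complexVariance (fun ω => ∑ m, a m * S.estErr (Sum.inr (X, m, j)) ω) μ := by
    simp only [complexVariance, hm, hm', add_sub_cancel_left, sub_zero]
  have hind : ∀ m n : Fin M, m ≠ n → IndepFun (fun ω => a m * S.estErr (Sum.inr (X, m, j)) ω)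
      (fun ω => a n * S.estErr (Sum.inr (X, n, j)) ω) μ := fun m n hmn =>
    (hF.indep.indepFun (by simpa using hmn)).comp (φ := fun z => a m * z)
      (ψ := fun z => a n * z) (by fun_prop) (by fun_prop)
  rw [integral_norm_sq_eq_complexVariance_add htot, hm', hcv, complexVariance_sum hL hind,
    add_comm, Finset.mul_sum]
  congr 1
  refine Finset.sum_congr rfl fun m _ => ?_
  have h3 := integral_norm_sq_eq_complexVariance_add (hL m)
  rw [h0] at h3
  simp only [norm_mul, mul_pow, integral_const_mul, hF.integral_norm_sq] at h3
  simp only [norm_zero, ne_eq, OfNat.ofNat_ne_zero, not_false_eq_true, zero_pow, add_zero] at h3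
  rw [← h3]
  simp only [estErrVar, epsVar]
  ring

end Row

end RelaySystem

/-! ### The conditional disturbance. -/

namespace RelaySystem

variable {M N τ : ℕ} {Ω : Type*} (S : RelaySystem M N τ Ω)

/-- The disturbance as a function of the estimates and the estimation errors. -/
def disturbanceFun (i : Fin N)
    (x : (Side × Fin M × Fin N → ℂ) × (Side × Fin M × Fin N → ℂ)) : ℝ :=
  -- The summand 0 gives the error term the shape of `integral_norm_sq_add_sum_mul_err` with z = 0.
  ∑ X : Side, S.p X i * ∑ Y : Side, ‖0 + ∑ m, star (x.1 (Y, m, i)) * x.2 (X, m, i)‖ ^ 2 +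
  ∑ j ∈ Finset.univ.erase i, ∑ X : Side, S.p X j * ∑ Y : Side,
    ‖∑ m, star (x.1 (Y, m, i)) * x.1 (X, m, j) + ∑ m, star (x.1 (Y, m, i)) * x.2 (X, m, j)‖ ^ 2 +
  ∑ Y : Side, ∑ m, ‖x.1 (Y, m, i)‖ ^ 2

/-- The conditional expectation of the disturbance given the estimates. -/
def meanDisturbance (i : Fin N) (ω : Ω) : ℝ :=
  ∑ X : Side, S.p X i * ∑ Y : Side, S.epsVar X i * S.normSq Y i ω +
  ∑ j ∈ Finset.univ.erase i, ∑ X : Side, S.p X j * ∑ Y : Side,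
    (‖S.cross Y i X j ω‖ ^ 2 + S.epsVar X j * S.normSq Y i ω) +
  ∑ Y : Side, S.normSq Y i ω

lemma measurable_disturbanceFun (i : Fin N) : Measurable (S.disturbanceFun i) := by
  unfold disturbanceFun
  fun_prop

lemma disturbance_eq (i : Fin N) (ω : Ω) :
    S.disturbance i ω = S.disturbanceFun i
      (fun q => S.estErr (Sum.inl q) ω, fun q => S.estErr (Sum.inr q) ω) := by
  simp only [disturbance, disturbanceFun, errorPower, interferencePower, noisePower, dotProduct,
    Pi.star_apply, ghat_apply, e_apply, g_apply, mul_add, Finset.sum_add_distrib, zero_add]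

variable {S} [MeasurableSpace Ω] {μ : Measure Ω}
variable (hF : IsGaussianFamily S.estErr S.estErrVar μ)
include hF

lemma integrable_disturbance (i : Fin N) : Integrable (S.disturbance i) μ := by
  have h1 : ∀ q q', MemLp (fun ω => star (S.estErr q ω) * S.estErr q' ω) 2 μ := fun q q' => by
    simpa only [mul_comm] using hF.memLp_mul q' q
  have h2 : ∀ (X Y : Side) (j : Fin N), MemLp (fun ω => ∑ m, star (S.estErr (Sum.inl (Y, m, i)) ω) *
      S.estErr (Sum.inr (X, m, j)) ω) 2 μ := fun X Y j =>
    memLp_finsetSum Finset.univ (f := fun m ω => star (S.estErr (Sum.inl (Y, m, i)) ω) *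
      S.estErr (Sum.inr (X, m, j)) ω) fun m _ => h1 _ _
  have h3 : ∀ (X Y : Side) (j : Fin N), MemLp (fun ω => ∑ m, star (S.estErr (Sum.inl (Y, m, i)) ω) *
      S.estErr (Sum.inl (X, m, j)) ω) 2 μ := fun X Y j =>
    memLp_finsetSum Finset.univ (f := fun m ω => star (S.estErr (Sum.inl (Y, m, i)) ω) *
      S.estErr (Sum.inl (X, m, j)) ω) fun m _ => h1 _ _
  have h4 : ∀ (X Y : Side) (j : Fin N), Integrable (fun ω =>
      ‖0 + ∑ m, star (S.estErr (Sum.inl (Y, m, i)) ω) *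
        S.estErr (Sum.inr (X, m, j)) ω‖ ^ 2) μ := fun X Y j => by
    simp only [zero_add]
    exact (h2 X Y j).integrable_norm_pow two_ne_zero
  have h5 : ∀ (X Y : Side) (j : Fin N), Integrable (fun ω =>
      ‖∑ m, star (S.estErr (Sum.inl (Y, m, i)) ω) * S.estErr (Sum.inl (X, m, j)) ω +
      ∑ m, star (S.estErr (Sum.inl (Y, m, i)) ω) *
        S.estErr (Sum.inr (X, m, j)) ω‖ ^ 2) μ := fun X Y j =>
    MemLp.integrable_norm_pow ((h3 X Y j).add (h2 X Y j)) two_ne_zero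
  rw [funext (S.disturbance_eq i)]
  simp only [disturbanceFun]
  refine Integrable.add (Integrable.add ?_ ?_) ?_
  · exact integrable_finsetSum _ fun X _ => (integrable_finsetSum _ fun Y _ => h4 X Y i).const_mul _
  · exact integrable_finsetSum _ fun j _ => integrable_finsetSum _ fun X _ =>
      (integrable_finsetSum _ fun Y _ => h5 X Y j).const_mul _
  · exact integrable_finsetSum _ fun Y _ => integrable_finsetSum _ fun m _ =>
      hF.integrable_norm_sq (Sum.inl (Y, m, i))

variable [IsProbabilityMeasure μ]

lemma integral_disturbanceFun (i : Fin N) (u : Side × Fin M × Fin N → ℂ) :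
    ∫ ω, S.disturbanceFun i (u, fun q => S.estErr (Sum.inr q) ω) ∂μ =
      ∑ X : Side, S.p X i * ∑ Y : Side, S.epsVar X i * ∑ m, ‖u (Y, m, i)‖ ^ 2 +
      ∑ j ∈ Finset.univ.erase i, ∑ X : Side, S.p X j * ∑ Y : Side,
        (‖∑ m, star (u (Y, m, i)) * u (X, m, j)‖ ^ 2 + S.epsVar X j * ∑ m, ‖u (Y, m, i)‖ ^ 2) +
      ∑ Y : Side, ∑ m, ‖u (Y, m, i)‖ ^ 2 := by
  have hi := fun z Y X j => (integral_norm_sq_add_sum_mul_err hF z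
    (fun m => star (u (Y, m, i))) X j).1
  have hv := fun z Y X j => (integral_norm_sq_add_sum_mul_err hF z
    (fun m => star (u (Y, m, i))) X j).2
  have hA : Integrable (fun ω => ∑ X : Side, S.p X i * ∑ Y : Side,
      ‖0 + ∑ m, star (u (Y, m, i)) * S.estErr (Sum.inr (X, m, i)) ω‖ ^ 2) μ :=
    integrable_finsetSum _ fun X _ =>
      (integrable_finsetSum _ fun Y _ => hi 0 Y X i).const_mul _
  have hB : Integrable (fun ω => ∑ j ∈ Finset.univ.erase i, ∑ X : Side, S.p X j * ∑ Y : Side,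
      ‖∑ m, star (u (Y, m, i)) * u (X, m, j) +
        ∑ m, star (u (Y, m, i)) * S.estErr (Sum.inr (X, m, j)) ω‖ ^ 2) μ :=
    integrable_finsetSum _ fun j _ => integrable_finsetSum _ fun X _ =>
      (integrable_finsetSum _ fun Y _ => hi _ Y X j).const_mul _
  simp only [disturbanceFun]
  refine (integral_add (hA.add hB) (integrable_const _)).trans ?_
  rw [integral_add' hA hB]
  congr 1
  · congr 1
    · rw [integral_finsetSum _ fun X _ =>
        (integrable_finsetSum _ fun Y _ => hi 0 Y X i).const_mul _]
      refine Finset.sum_congr rfl fun X _ => ?_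
      rw [integral_const_mul, integral_finsetSum _ fun Y _ => hi 0 Y X i]
      simp only [hv]
      simp
    · rw [integral_finsetSum _ fun j _ => integrable_finsetSum _ fun X _ =>
        (integrable_finsetSum _ fun Y _ => hi _ Y X j).const_mul _]
      refine Finset.sum_congr rfl fun j _ => ?_
      rw [integral_finsetSum _ fun X _ =>
        (integrable_finsetSum _ fun Y _ => hi _ Y X j).const_mul _]
      refine Finset.sum_congr rfl fun X _ => ?_
      rw [integral_const_mul, integral_finsetSum _ fun Y _ => hi _ Y X j]
      simp only [hv]
      simp
  · simp

/-- `estimateSigma` is generated by the estimates, which are independent of the errors, so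
`condExp_comap_of_indepFun` reduces the conditional expectation to the frozen average
`integral_disturbanceFun`. -/
lemma condDisturbance_ae_eq (i : Fin N) :
    S.condDisturbance μ i =ᵐ[μ] S.meanDisturbance i := by
  have hU : Measurable (fun ω (q : Side × Fin M × Fin N) => S.estErr (Sum.inl q) ω) :=
    measurable_pi_lambda _ fun q => hF.measurable _
  have hV : Measurable (fun ω (q : Side × Fin M × Fin N) => S.estErr (Sum.inr q) ω) :=
    measurable_pi_lambda _ fun q => hF.measurable _
  have hint := integrable_disturbance hF i
  rw [funext (S.disturbance_eq i)] at hint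
  have h := condExp_comap_of_indepFun hU hV
    (iIndepFun_indepFun_of_forall_ne hF.indep hF.measurable (a := Sum.inl) (b := Sum.inr)
      (by simp)) (S.measurable_disturbanceFun i) hint
  rw [← funext (S.disturbance_eq i)] at h
  refine h.trans (ae_of_all _ fun ω => ?_)
  simp only
  rw [integral_disturbanceFun hF]
  rfl

end RelaySystem

/-! ### Deterministic bounds for the logarithm and the SINR ratio. -/

section RealInequalities

/-- If `W ≥ 0` then `log (1 + s W)` and `log (1 + s)` differ by at most `log (1 + s) + W`. -/
lemma abs_log_one_add_mul_sub_le {s W : ℝ} (hs : 0 ≤ s) (hW : 0 ≤ W) :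
    |Real.log (1 + s * W) - Real.log (1 + s)| ≤ Real.log (1 + s) + W := by
  have h0 : 0 ≤ s * W := by positivity
  have h1 : 0 ≤ Real.log (1 + s * W) := Real.log_nonneg (by linarith)
  have h2 : 0 ≤ Real.log (1 + s) := Real.log_nonneg (by linarith)
  have h3 : Real.log (1 + s * W) ≤ Real.log (1 + s) + W := by
    calc Real.log (1 + s * W) ≤ Real.log ((1 + s) * (1 + W)) :=
          Real.log_le_log (by linarith) (by nlinarith)
      _ = Real.log (1 + s) + Real.log (1 + W) :=
          Real.log_mul (by linarith) (by linarith)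
      _ ≤ Real.log (1 + s) + W := by
          have := Real.log_le_sub_one_of_pos (show 0 < 1 + W by linarith)
          linarith
  rw [abs_le]
  constructor <;> linarith

/-- Apply log x - log y ≤ (x - y) / y in both directions; s / (1 + s) ≤ 1, and s / (1 + s W) ≤ 2
because W ≥ 1 / 2. The bound is uniform in s, so the SINR may tend to zero, stay bounded or diverge.
-/
lemma abs_log_one_add_mul_sub_le_of_near {s W : ℝ} (hs : 0 ≤ s) (hW : |W - 1| ≤ 1 / 2) :
    |Real.log (1 + s * W) - Real.log (1 + s)| ≤ 2 * |W - 1| := by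
  have hW' := abs_le.1 hW
  have h0 : 0 ≤ s * W := by apply mul_nonneg hs; linarith
  have ha : 0 < 1 + s * W := by linarith
  have hb : 0 < 1 + s := by linarith
  have key : ∀ x y : ℝ, 0 < x → 0 < y → Real.log x - Real.log y ≤ (x - y) / y := by
    intro x y hx hy
    rw [← Real.log_div hx.ne' hy.ne', sub_div, div_self hy.ne']
    exact Real.log_le_sub_one_of_pos (by positivity)
  have h1 := key _ _ ha hb
  have h2 := key _ _ hb ha
  have h3 : (1 + s * W - (1 + s)) / (1 + s) ≤ 2 * |W - 1| := by
    rw [div_le_iff₀ hb]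
    nlinarith [le_abs_self (W - 1), abs_nonneg (W - 1)]
  have h4 : (1 + s - (1 + s * W)) / (1 + s * W) ≤ 2 * |W - 1| := by
    rw [div_le_iff₀ ha]
    have h5 : s * (1 - W) ≤ s * |W - 1| :=
      mul_le_mul_of_nonneg_left (by rw [abs_sub_comm]; exact le_abs_self _) hs
    have h6 : 0 ≤ |W - 1| * (s * (W - 1 / 2)) := by
      apply mul_nonneg (abs_nonneg _) (mul_nonneg hs (by linarith))
    nlinarith [abs_nonneg (W - 1)]
  rw [abs_le]
  constructor <;> linarith

/-- If 16 C² D ≤ 1, then W is within 1 / 2 of 1 and the near bound applies. Otherwise constants can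
be absorbed into D: 4 C ≤ 64 C³ D and C D ≤ C³ D give W ≤ 65 C³ D. -/
lemma abs_log_one_add_mul_sub_le_of_defect {s W D C : ℝ} (hs : 0 ≤ s) (hW : 0 ≤ W) (hD : 0 ≤ D)
    (hC : 1 ≤ C) (hnear : D ≤ 1 / 16 → |W - 1| ≤ C * Real.sqrt D) (hfar : W ≤ C * (4 + D)) :
    |Real.log (1 + s * W) - Real.log (1 + s)| ≤
      2 * C * Real.sqrt D + 65 * C ^ 3 * (1 + Real.log (1 + s)) * D := by
  have hL : 0 ≤ Real.log (1 + s) := Real.log_nonneg (by linarith)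
  have hd := Real.sqrt_nonneg D
  have hdd := Real.sq_sqrt hD
  have hC3 : 0 < C ^ 3 := by positivity
  by_cases h : 16 * C ^ 2 * D ≤ 1
  · have h1 : D ≤ 1 / 16 := by nlinarith
    have h2 : C * Real.sqrt D ≤ 1 / 2 := by
      by_contra hcon
      push Not at hcon
      have : 1 / 4 < (C * Real.sqrt D) ^ 2 := by nlinarith
      rw [mul_pow, hdd] at this
      linarith
    have h3 := abs_log_one_add_mul_sub_le_of_near hs ((hnear h1).trans h2)
    have h4 : 0 ≤ 65 * C ^ 3 * (1 + Real.log (1 + s)) * D := by positivity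
    linarith [hnear h1]
  · push Not at h
    have h1 := abs_log_one_add_mul_sub_le hs hW
    have h2 : Real.log (1 + s) ≤ Real.log (1 + s) * (16 * C ^ 2 * D) := le_mul_of_one_le_right hL h.le
    have h3 : W ≤ 65 * C ^ 3 * D := by
      have : C * 1 ≤ C * (16 * C ^ 2 * D) := mul_le_mul_of_nonneg_left h.le (by linarith)
      have h5 : C * D ≤ C ^ 3 * D := by
        apply mul_le_mul_of_nonneg_right _ hD
        nlinarith [sq_nonneg (C - 1)]
      nlinarith
    have h4 : Real.log (1 + s) * (16 * C ^ 2 * D) ≤ Real.log (1 + s) * (65 * C ^ 3 * D) := by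
      apply mul_le_mul_of_nonneg_left _ hL
      apply mul_le_mul_of_nonneg_right _ hD
      nlinarith [sq_nonneg C]
    have h5 : 0 ≤ 2 * C * Real.sqrt D := by positivity
    linarith

variable {aA aB nA nB r J tA tB R : ℝ}

/-- The relative deviation of the squared norms and inner products from their typical values. -/
def defect (aA aB nA nB r J : ℝ) : ℝ :=
  (nA - aA) ^ 2 / aA ^ 2 + (nB - aB) ^ 2 / aB ^ 2 + r / (aA * aB) + J / (aA + aB)

/-- The ratio of the instantaneous SINR and its typical value. -/
def sinrRatio (tA tB aA aB nA nB r J : ℝ) : ℝ :=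
  (tA * (nA ^ 2 + r) + tB * (nB ^ 2 + r)) / (tA * aA ^ 2 + tB * aB ^ 2) *
    ((aA + aB) / (nA + nB + J))

lemma defect_nonneg (hA : 0 < aA) (hB : 0 < aB) (hr : 0 ≤ r) (hJ : 0 ≤ J) :
    0 ≤ defect aA aB nA nB r J := by
  unfold defect; positivity

lemma sinrRatio_nonneg (hA : 0 < aA) (hB : 0 < aB) (hnA : 0 ≤ nA) (hnB : 0 ≤ nB) (hr : 0 ≤ r)
    (hJ : 0 ≤ J) (htA : 0 ≤ tA) (htB : 0 ≤ tB) : 0 ≤ sinrRatio tA tB aA aB nA nB r J := by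
  unfold sinrRatio; positivity

lemma weighted_sq_pos (hA : 0 < aA) (hB : 0 < aB) (htA : 0 ≤ tA) (htB : 0 ≤ tB)
    (ht : 0 < tA + tB) : 0 < tA * aA ^ 2 + tB * aB ^ 2 := by
  rcases htA.lt_or_eq with h | h
  · have := mul_pos h (pow_pos hA 2)
    have := mul_nonneg htB (sq_nonneg aB)
    linarith
  · have := mul_pos (show 0 < tB by linarith) (pow_pos hB 2)
    have := mul_nonneg htA (sq_nonneg aA)
    linarith

/-- The inequality r ≤ nA nB, which is Cauchy–Schwarz in the application, bounds the numerator by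
(tA nA + tB nB)(nA + nB + J). The random denominator cancels, so it needs no lower bound. The
constant 4 comes from using x ≤ 2 + (x - 1)² for both normalized norms. -/
lemma sinrRatio_le (hA : 0 < aA) (hB : 0 < aB) (hnA : 0 ≤ nA) (hnB : 0 ≤ nB) (hr : 0 ≤ r)
    (hrn : r ≤ nA * nB) (hJ : 0 ≤ J) (htA : 0 ≤ tA) (htB : 0 ≤ tB) (ht : 0 < tA + tB)
    (hR : 0 ≤ R) (hAB : aA ≤ R * aB) (hBA : aB ≤ R * aA) :
    sinrRatio tA tB aA aB nA nB r J ≤ (R + 1) * (4 + defect aA aB nA nB r J) := by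
  have hT := weighted_sq_pos hA hB htA htB ht
  have hD1 : 0 ≤ r / (aA * aB) := by positivity
  have hD2 : 0 ≤ J / (aA + aB) := by positivity
  have hy : ∀ n a : ℝ, 0 < a → n / a ≤ 2 + (n - a) ^ 2 / a ^ 2 := fun n a ha => by
    rw [← div_pow, sub_div, div_self ha.ne']
    nlinarith [sq_nonneg (n / a - 1 - 1 / 2)]
  have h1 : sinrRatio tA tB aA aB nA nB r J ≤ (R + 1) * (nA / aA + nB / aB) := by
    -- With vanishing denominator the ratio is 0 by the convention x / 0 = 0.
    by_cases h0 : nA + nB + J = 0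
    · simp only [sinrRatio, h0, div_zero, mul_zero]; positivity
    have hpos : 0 < nA + nB + J := lt_of_le_of_ne (by positivity) (Ne.symm h0)
    rw [sinrRatio, div_mul_div_comm, div_le_iff₀ (by positivity)]
    have e1 : tA * (nA ^ 2 + r) + tB * (nB ^ 2 + r) ≤ (tA * nA + tB * nB) * (nA + nB + J) := by
      have := mul_nonneg htA (sub_nonneg.2 hrn)
      have := mul_nonneg htB (sub_nonneg.2 hrn)
      have := mul_nonneg (add_nonneg (mul_nonneg htA hnA) (mul_nonneg htB hnB)) hJ
      nlinarith
    have e2 : (tA * nA + tB * nB) * (aA + aB) ≤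
        (R + 1) * (nA / aA + nB / aB) * (tA * aA ^ 2 + tB * aB ^ 2) := by
      have f1 : tA * nA * (aA + aB) ≤ (R + 1) * (nA / aA) * (tA * aA ^ 2) := by
        have : (R + 1) * (nA / aA) * (tA * aA ^ 2) = tA * nA * ((R + 1) * aA) := by
          field_simp
        rw [this]
        exact mul_le_mul_of_nonneg_left (by linarith) (mul_nonneg htA hnA)
      have f2 : tB * nB * (aA + aB) ≤ (R + 1) * (nB / aB) * (tB * aB ^ 2) := by
        have : (R + 1) * (nB / aB) * (tB * aB ^ 2) = tB * nB * ((R + 1) * aB) := by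
          field_simp
        rw [this]
        exact mul_le_mul_of_nonneg_left (by linarith) (mul_nonneg htB hnB)
      have f3 : 0 ≤ (R + 1) * (nA / aA) * (tB * aB ^ 2) := by positivity
      have f4 : 0 ≤ (R + 1) * (nB / aB) * (tA * aA ^ 2) := by positivity
      nlinarith
    calc _ ≤ (tA * nA + tB * nB) * (nA + nB + J) * (aA + aB) :=
          mul_le_mul_of_nonneg_right e1 (by positivity)
      _ = (tA * nA + tB * nB) * (aA + aB) * (nA + nB + J) := by ring
      _ ≤ _ := by
          rw [← mul_assoc]
          exact mul_le_mul_of_nonneg_right e2 hpos.le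
  refine h1.trans (mul_le_mul_of_nonneg_left ?_ (by linarith))
  unfold defect
  linarith [hy nA aA hA, hy nB aB hB]

lemma abs_sq_sub_sq_le {n a d : ℝ} (ha : 0 < a) (hd : 0 ≤ d) (hd4 : d ≤ 1 / 4)
    (h : |n - a| ≤ d * a) : |n ^ 2 - a ^ 2| ≤ 9 / 4 * d * a ^ 2 := by
  have hda : d * a ≤ 1 / 4 * a := mul_le_mul_of_nonneg_right hd4 ha.le
  have h' := abs_le.1 h
  have h3 : |n + a| ≤ 9 / 4 * a := by
    rw [abs_le]; constructor <;> linarith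
  rw [show n ^ 2 - a ^ 2 = (n - a) * (n + a) by ring, abs_mul]
  calc _ ≤ (d * a) * (9 / 4 * a) := mul_le_mul h h3 (abs_nonneg _) (by positivity)
    _ = _ := by ring

/-- With d = √D ≤ 1 / 4, each norm is within relative error d, and r and J are of relative size d² ≤
d / 4. The numerator is then off by a factor (9 / 4 + R / 4) d, the denominator by 5 / 4 d, and the
latter keeps at least 3 / 4 of its typical value; (7 / 2 + R / 4) / (3 / 4) ≤ 5 + R. -/
lemma abs_sinrRatio_sub_one_le (hA : 0 < aA) (hB : 0 < aB)
    (hr : 0 ≤ r) (hJ : 0 ≤ J) (htA : 0 ≤ tA) (htB : 0 ≤ tB) (ht : 0 < tA + tB)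
    (hR : 0 ≤ R) (hAB : aA ≤ R * aB) (hBA : aB ≤ R * aA)
    (hD : defect aA aB nA nB r J ≤ 1 / 16) :
    |sinrRatio tA tB aA aB nA nB r J - 1| ≤ (5 + R) * Real.sqrt (defect aA aB nA nB r J) := by
  have hT := weighted_sq_pos hA hB htA htB ht
  have hD0 : 0 ≤ defect aA aB nA nB r J := defect_nonneg hA hB hr hJ
  set D := defect aA aB nA nB r J with hDdef
  set d := Real.sqrt D with hd
  have hd0 : 0 ≤ d := Real.sqrt_nonneg D
  have hdD : d ^ 2 = D := Real.sq_sqrt hD0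
  have hd4 : d ≤ 1 / 4 := by nlinarith
  have g1 : 0 ≤ (nA - aA) ^ 2 / aA ^ 2 := by positivity
  have g2 : 0 ≤ (nB - aB) ^ 2 / aB ^ 2 := by positivity
  have g3 : 0 ≤ r / (aA * aB) := by positivity
  have g4 : 0 ≤ J / (aA + aB) := by positivity
  have hsum : (nA - aA) ^ 2 / aA ^ 2 + (nB - aB) ^ 2 / aB ^ 2 + r / (aA * aB) + J / (aA + aB) =
    d ^ 2 := by rw [hdD, hDdef, defect]
  have hn : ∀ n a : ℝ, 0 < a → (n - a) ^ 2 / a ^ 2 ≤ d ^ 2 → |n - a| ≤ d * a := by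
    intro n a ha h
    rw [div_le_iff₀ (by positivity), ← mul_pow] at h
    exact abs_le_of_sq_le_sq h (by positivity)
  have hnA' := abs_le.1 (hn nA aA hA (by linarith))
  have hnB' := abs_le.1 (hn nB aB hB (by linarith))
  have hr' : r ≤ d ^ 2 * (aA * aB) := by
    rw [← div_le_iff₀ (by positivity)]; linarith
  have hJ' : J ≤ d ^ 2 * (aA + aB) := by
    rw [← div_le_iff₀ (by positivity)]; linarith
  have hd2 : d ^ 2 ≤ d / 4 := by nlinarith
  have hsA := abs_le.1 (abs_sq_sub_sq_le hA hd0 hd4 (abs_le.2 hnA'))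
  have hsB := abs_le.1 (abs_sq_sub_sq_le hB hd0 hd4 (abs_le.2 hnB'))
  have hrA : tA * r ≤ R / 4 * d * (tA * aA ^ 2) := by
    have h : r ≤ R / 4 * d * aA ^ 2 := by
      have h1 : aA * aB ≤ R * aA ^ 2 := by linarith [mul_le_mul_of_nonneg_left hBA hA.le]
      calc r ≤ d ^ 2 * (aA * aB) := hr'
        _ ≤ d / 4 * (R * aA ^ 2) := mul_le_mul hd2 h1 (by positivity) (by positivity)
        _ = _ := by ring
    linarith [mul_le_mul_of_nonneg_left h htA]
  have hrB : tB * r ≤ R / 4 * d * (tB * aB ^ 2) := by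
    have h : r ≤ R / 4 * d * aB ^ 2 := by
      have h1 : aA * aB ≤ R * aB ^ 2 := by linarith [mul_le_mul_of_nonneg_right hAB hB.le]
      calc r ≤ d ^ 2 * (aA * aB) := hr'
        _ ≤ d / 4 * (R * aB ^ 2) := mul_le_mul hd2 h1 (by positivity) (by positivity)
        _ = _ := by ring
    linarith [mul_le_mul_of_nonneg_left h htB]
  set T := tA * aA ^ 2 + tB * aB ^ 2 with hTdef
  set U := tA * (nA ^ 2 + r) + tB * (nB ^ 2 + r) with hU
  have hUle : U - T ≤ (9 / 4 + R / 4) * d * T := by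
    have := mul_le_mul_of_nonneg_left hsA.2 htA
    have := mul_le_mul_of_nonneg_left hsB.2 htB
    rw [hU, hTdef]; linarith
  have hUge : -((9 / 4 + R / 4) * d * T) ≤ U - T := by
    have h1 := mul_le_mul_of_nonneg_left hsA.1 htA
    have h2 := mul_le_mul_of_nonneg_left hsB.1 htB
    have h3 := mul_nonneg htA hr
    have h4 := mul_nonneg htB hr
    have h5 : 0 ≤ R / 4 * d * T := by positivity
    rw [hU]; rw [hTdef] at h5 ⊢; linarith
  have hS : 0 < aA + aB := by linarith
  have hdS : d * (aA + aB) ≤ 1 / 4 * (aA + aB) := mul_le_mul_of_nonneg_right hd4 hS.le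
  have hdS2 : d ^ 2 * (aA + aB) ≤ d / 4 * (aA + aB) := mul_le_mul_of_nonneg_right hd2 hS.le
  have hPge : 3 / 4 * (aA + aB) ≤ nA + nB + J := by linarith
  have hP0 : 0 < nA + nB + J := by linarith
  have hPle1 : nA + nB + J - (aA + aB) ≤ 5 / 4 * d * (aA + aB) := by linarith
  have hPle2 : -(5 / 4 * d * (aA + aB)) ≤ nA + nB + J - (aA + aB) := by
    have : 0 ≤ d * (aA + aB) := by positivity
    linarith
  have hform : sinrRatio tA tB aA aB nA nB r J - 1 =
      ((U - T) * (aA + aB) - T * (nA + nB + J - (aA + aB))) / (T * (nA + nB + J)) := by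
    rw [sinrRatio, ← hU, ← hTdef]
    field_simp
    ring
  rw [hform, abs_div, abs_of_pos (mul_pos hT hP0), div_le_iff₀ (mul_pos hT hP0)]
  have hbig : (7 / 2 + R / 4) * d * (T * (aA + aB)) ≤ (5 + R) * d * (T * (nA + nB + J)) := by
    have h1 : T * (3 / 4 * (aA + aB)) ≤ T * (nA + nB + J) := mul_le_mul_of_nonneg_left hPge hT.le
    have h2 : 0 ≤ (5 + R) * d := by positivity
    have h3 := mul_le_mul_of_nonneg_left h1 h2
    have h4 : 0 ≤ d * (T * (aA + aB)) := by positivity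
    have h5 : 0 ≤ R * (d * (T * (aA + aB))) := by positivity
    linarith
  refine le_trans ?_ hbig
  have k1 := mul_le_mul_of_nonneg_right hUle hS.le
  have k2 := mul_le_mul_of_nonneg_right hUge hS.le
  have k3 := mul_le_mul_of_nonneg_left hPle1 hT.le
  have k4 := mul_le_mul_of_nonneg_left hPle2 hT.le
  rw [abs_le]
  constructor <;> linarith

end RealInequalities

lemma Side.sum_eq {E : Type*} [AddCommMonoid E] (f : Side → E) :
    ∑ X, f X = f Side.A + f Side.B :=
  Finset.sum_pair (by decide)

/-! ### The uplink rate at finitely many antennas. -/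

namespace RelaySystem

variable {M N τ : ℕ} {Ω : Type*} (S : RelaySystem M N τ Ω)

/-- The factor by which estimation errors increase the noise, if all users have power `P`. -/
def noiseFactor (P : ℝ) : ℝ := 1 + P * ∑ X, ∑ j, S.epsVar X j

/-- The interference caused by the channel estimates of the other pairs. -/
def interf (i : Fin N) (ω : Ω) : ℝ :=
  ∑ j ∈ Finset.univ.erase i, ∑ X : Side, ∑ Y : Side, ‖S.cross Y i X j ω‖ ^ 2

/-- With equal powers every error vector contributes a multiple of ‖ĝ_A‖² + ‖ĝ_B‖², just as the
noise does. Errors therefore only scale the noise. -/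
lemma meanDisturbance_eq {P : ℝ} (hP : ∀ X j, S.p X j = P) (i : Fin N) (ω : Ω) :
    S.meanDisturbance i ω =
      (S.normSq Side.A i ω + S.normSq Side.B i ω) * S.noiseFactor P + P * S.interf i ω := by
  have h : ∀ X, ∑ j, S.epsVar X j = S.epsVar X i + ∑ j ∈ Finset.univ.erase i, S.epsVar X j :=
    fun X => (Finset.add_sum_erase _ _ (Finset.mem_univ i)).symm
  simp only [meanDisturbance, noiseFactor, interf, hP, Side.sum_eq, h, Finset.sum_add_distrib,
    ← Finset.mul_sum, ← Finset.sum_mul, mul_add, add_mul]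
  ring

lemma cross_self (X : Side) (i : Fin N) (ω : Ω) :
    S.cross X i X i ω = (S.normSq X i ω : ℂ) := by
  simp only [cross, normSq, dotProduct, Pi.star_apply, Complex.ofReal_sum, Complex.ofReal_pow]
  exact Finset.sum_congr rfl fun m _ => Complex.conj_mul' _

lemma norm_cross_comm (X Y : Side) (i j : Fin N) (ω : Ω) :
    ‖S.cross Y i X j ω‖ = ‖S.cross X j Y i ω‖ := by
  rw [← norm_star (S.cross Y i X j ω)]
  congr 1
  simp only [cross, dotProduct, Pi.star_apply, star_sum, star_mul', star_star, mul_comm]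

lemma normSq_nonneg (X : Side) (i : Fin N) (ω : Ω) : 0 ≤ S.normSq X i ω :=
  Finset.sum_nonneg fun _ _ => by positivity

lemma norm_cross_sq_le (X Y : Side) (i j : Fin N) (ω : Ω) :
    ‖S.cross X i Y j ω‖ ^ 2 ≤ S.normSq X i ω * S.normSq Y j ω := by
  have h1 : ‖S.cross X i Y j ω‖ ≤ ∑ m, ‖S.ghat X i ω m‖ * ‖S.ghat Y j ω m‖ := by
    refine (norm_sum_le (E := ℂ) _ _).trans (Finset.sum_le_sum fun m _ => ?_)
    simp
  calc _ ≤ (∑ m, ‖S.ghat X i ω m‖ * ‖S.ghat Y j ω m‖) ^ 2 := by gcongr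
    _ ≤ _ := Finset.sum_mul_sq_le_sq_mul_sq _ _ _

/-- A weighted sum of the desired signal powers. -/
def weightedPower (θ : Side → ℝ) (i : Fin N) (ω : Ω) : ℝ := ∑ X, θ X * S.signalPower X i ω

lemma signalPower_eq {P : ℝ} (hP : ∀ X j, S.p X j = P) (X : Side) (i : Fin N) (ω : Ω) :
    S.signalPower X i ω =
      P * (S.normSq X i ω ^ 2 + ‖S.cross Side.A i Side.B i ω‖ ^ 2) := by
  have h : ∀ X, ‖S.cross X i X i ω‖ ^ 2 = S.normSq X i ω ^ 2 := fun X => by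
    rw [cross_self, Complex.norm_real, Real.norm_eq_abs, sq_abs]
  have h' : S.signalPower X i ω = P * ∑ Y, ‖S.cross Y i X i ω‖ ^ 2 := by
    rw [signalPower, hP]; rfl
  rw [h', Side.sum_eq]
  cases X
  · rw [h, S.norm_cross_comm Side.A Side.B]
  · rw [h, add_comm]

/-- The typical value of the weighted SINR. -/
def typicalSinr (P : ℝ) (θ : Side → ℝ) (i : Fin N) : ℝ :=
  P * M / S.noiseFactor P * ((θ Side.A * S.sigVar Side.A i ^ 2 + θ Side.B * S.sigVar Side.B i ^ 2) /
    (S.sigVar Side.A i + S.sigVar Side.B i))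

/-- The relative deviation of the channel estimates from their typical behaviour. -/
def estDefect (P : ℝ) (i : Fin N) (ω : Ω) : ℝ :=
  defect (M * S.sigVar Side.A i) (M * S.sigVar Side.B i) (S.normSq Side.A i ω)
    (S.normSq Side.B i ω) (‖S.cross Side.A i Side.B i ω‖ ^ 2) (P / S.noiseFactor P * S.interf i ω)

/-- The ratio of the weighted SINR and its typical value. -/
def estRatio (P : ℝ) (θ : Side → ℝ) (i : Fin N) (ω : Ω) : ℝ :=
  sinrRatio (θ Side.A) (θ Side.B) (M * S.sigVar Side.A i) (M * S.sigVar Side.B i)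
    (S.normSq Side.A i ω) (S.normSq Side.B i ω) (‖S.cross Side.A i Side.B i ω‖ ^ 2)
    (P / S.noiseFactor P * S.interf i ω)

lemma interf_nonneg (i : Fin N) (ω : Ω) : 0 ≤ S.interf i ω :=
  Finset.sum_nonneg fun _ _ => Finset.sum_nonneg fun _ _ => Finset.sum_nonneg fun _ _ =>
    by positivity

variable {S}

lemma one_le_noiseFactor {P : ℝ} (hP : 0 ≤ P) (hε : ∀ X j, 0 ≤ S.epsVar X j) :
    1 ≤ S.noiseFactor P := by
  have : 0 ≤ P * ∑ X, ∑ j, S.epsVar X j :=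
    mul_nonneg hP (Finset.sum_nonneg fun _ _ => Finset.sum_nonneg fun _ _ => hε _ _)
  unfold noiseFactor
  linarith

/-- An exact identity: dividing the disturbance by the noise factor leaves nA + nB + J, where J is
the interference scaled by P over the noise factor. -/
lemma weightedPower_div_meanDisturbance {P : ℝ} (hP0 : 0 ≤ P) (hP : ∀ X j, S.p X j = P)
    (hM : 0 < M) (hσ : ∀ X j, 0 < S.sigVar X j) (hε : ∀ X j, 0 ≤ S.epsVar X j) {θ : Side → ℝ}
    (hθ : ∀ X, 0 ≤ θ X) (hθ0 : 0 < θ Side.A + θ Side.B) (i : Fin N) (ω : Ω) :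
    S.weightedPower θ i ω / S.meanDisturbance i ω =
      S.typicalSinr P θ i * S.estRatio P θ i ω := by
  have hk := one_le_noiseFactor hP0 hε
  have hk0 : S.noiseFactor P ≠ 0 := by linarith
  have hM' : (M : ℝ) ≠ 0 := by positivity
  rw [S.meanDisturbance_eq hP, weightedPower, Side.sum_eq, S.signalPower_eq hP,
    S.signalPower_eq hP, typicalSinr, estRatio, sinrRatio]
  have hA := hσ Side.A i
  have hB := hσ Side.B i
  have hT := weighted_sq_pos hA hB (hθ Side.A) (hθ Side.B) hθ0
  generalize S.sigVar Side.A i = a at *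
  generalize S.sigVar Side.B i = b at *
  generalize S.normSq Side.A i ω = x
  generalize S.normSq Side.B i ω = y
  generalize ‖S.cross Side.A i Side.B i ω‖ ^ 2 = r
  generalize S.interf i ω = I
  generalize S.noiseFactor P = k at *
  have e1 : (x + y) * k + P * I = k * (x + y + P / k * I) := by field_simp
  have e2 : θ Side.A * (M * a) ^ 2 + θ Side.B * (M * b) ^ 2 =
    M ^ 2 * (θ Side.A * a ^ 2 + θ Side.B * b ^ 2) := by ring
  rw [e1, e2, ← mul_add]
  have hab : a + b ≠ 0 := by positivity
  generalize x + y + P / k * I = q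
  have hT' := hT.ne'
  generalize θ Side.A * a ^ 2 + θ Side.B * b ^ 2 = T at *
  rw [show θ Side.A * (P * (x ^ 2 + r)) + θ Side.B * (P * (y ^ 2 + r)) =
    P * (θ Side.A * (x ^ 2 + r) + θ Side.B * (y ^ 2 + r)) by ring]
  generalize θ Side.A * (x ^ 2 + r) + θ Side.B * (y ^ 2 + r) = U
  -- The realizations with zero disturbance need no exclusion: both sides are then 0.
  rcases eq_or_ne q 0 with rfl | hq
  · simp
  · field_simp

variable [MeasurableSpace Ω] {μ : Measure Ω}

/-- The instantaneous rate belonging to a weighted sum of the signal powers. -/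
def weightedLog (S : RelaySystem M N τ Ω) (μ : Measure Ω) (θ : Side → ℝ) (i : Fin N) (ω : Ω) : ℝ :=
  Real.logb 2 (1 + S.weightedPower θ i ω / S.condDisturbance μ i ω)

/-- With weights 1, 1 for the pair and 1, 0 or 0, 1 for a single user, one estimate for
`weightedLog` covers all first-phase rates. -/
lemma pairLog_eq (i : Fin N) : S.pairLog μ i = S.weightedLog μ (fun _ => 1) i := by
  funext ω
  simp [pairLog, weightedLog, weightedPower, Side.sum_eq]

lemma uplinkLog_eq (X : Side) (i : Fin N) :
    S.uplinkLog μ X i = S.weightedLog μ (fun Y => if Y = X then 1 else 0) i := by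
  funext ω
  simp [uplinkLog, weightedLog, weightedPower]

variable (hF : IsGaussianFamily S.estErr S.estErrVar μ)
include hF

lemma integrable_norm_cross_sq (Y : Side) (i : Fin N) (X : Side) (j : Fin N) :
    Integrable (fun ω => ‖S.cross Y i X j ω‖ ^ 2) μ :=
  (memLp_cross hF Y i X j).integrable_norm_pow two_ne_zero

lemma integrable_interf (i : Fin N) : Integrable (S.interf i) μ :=
  integrable_finsetSum _ fun _ _ => integrable_finsetSum _ fun _ _ => integrable_finsetSum _
    fun _ _ => integrable_norm_cross_sq hF _ _ _ _

variable [IsProbabilityMeasure μ]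

lemma integral_interf (i : Fin N) :
    ∫ ω, S.interf i ω ∂μ = (M * S.sigVar Side.A i + M * S.sigVar Side.B i) *
      ∑ j ∈ Finset.univ.erase i, ∑ X, S.sigVar X j := by
  have hc := integrable_norm_cross_sq hF
  simp only [interf]
  rw [integral_finsetSum _ fun _ _ => integrable_finsetSum _ fun _ _ => integrable_finsetSum _
    fun _ _ => hc _ _ _ _, Finset.mul_sum]
  refine Finset.sum_congr rfl fun j hj => ?_
  rw [integral_finsetSum _ fun _ _ => integrable_finsetSum _ fun _ _ => hc _ _ _ _, Finset.mul_sum]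
  refine Finset.sum_congr rfl fun X _ => ?_
  rw [integral_finsetSum _ fun _ _ => hc _ _ _ _]
  have hji : j ≠ i := (Finset.mem_erase.1 hj).1
  have h : ∀ Y, ∫ ω, ‖S.cross Y i X j ω‖ ^ 2 ∂μ = M * (S.sigVar X j * S.sigVar Y i) := fun Y =>
    integral_norm_sq_cross_of_ne hF (by simp [hji])
  simp only [h, Side.sum_eq]
  ring

lemma integrable_estDefect (P : ℝ) (i : Fin N) : Integrable (S.estDefect P i) μ := by
  have h : ∀ X, Integrable (fun ω => (S.normSq X i ω - M * S.sigVar X i) ^ 2) μ := fun X =>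
    ((memLp_normSq hF X i).sub (memLp_const _)).integrable_sq
  exact (((h Side.A).div_const _ |>.add ((h Side.B).div_const _)).add
    ((integrable_norm_cross_sq hF _ _ _ _).div_const _)).add
      (((integrable_interf hF i).const_mul _).div_const _)

/-- The two norms contribute (kurt - 1) / M each and the correlation inside the pair 1 / M. The
interference of the other pairs contributes at most P times the sum of the estimate variances, which
is small because weak pilots give small estimates. -/
lemma integral_estDefect_le {P : ℝ} (hP0 : 0 ≤ P) (hM : 0 < M) (hσ : ∀ X j, 0 < S.sigVar X j)
    (hε : ∀ X j, 0 ≤ S.epsVar X j) (i : Fin N) :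
    ∫ ω, S.estDefect P i ω ∂μ ≤ (2 * kurt - 1) / M + P * ∑ X, ∑ j, S.sigVar X j := by
  have h : ∀ X, Integrable (fun ω => (S.normSq X i ω - M * S.sigVar X i) ^ 2) μ := fun X =>
    ((memLp_normSq hF X i).sub (memLp_const _)).integrable_sq
  have hA := (h Side.A).div_const ((M * S.sigVar Side.A i) ^ 2)
  have hB := (h Side.B).div_const ((M * S.sigVar Side.B i) ^ 2)
  have hC := (integrable_norm_cross_sq hF Side.A i Side.B i).div_const
    ((M * S.sigVar Side.A i) * (M * S.sigVar Side.B i))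
  have hD := ((integrable_interf hF i).const_mul (P / S.noiseFactor P)).div_const
    (M * S.sigVar Side.A i + M * S.sigVar Side.B i)
  have hk := one_le_noiseFactor hP0 hε
  have hsA := hσ Side.A i
  have hsB := hσ Side.B i
  have hM' : (0 : ℝ) < M := by exact_mod_cast hM
  have heq : ∫ ω, S.estDefect P i ω ∂μ = (kurt - 1) / M + (kurt - 1) / M + 1 / M +
      P / S.noiseFactor P * ∑ j ∈ Finset.univ.erase i, ∑ X, S.sigVar X j := by
    refine (integral_add ((hA.add hB).add hC) hD).trans ?_
    rw [integral_add' (hA.add hB) hC, integral_add' hA hB, integral_div, integral_div,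
      integral_div, integral_div, integral_const_mul, integral_normSq_sub_sq hF,
      integral_normSq_sub_sq hF, integral_norm_sq_cross_of_ne hF (by simp), integral_interf hF]
    have e1 : ∀ a : ℝ, 0 < a → M * ((kurt - 1) * a ^ 2) / (M * a) ^ 2 = (kurt - 1) / M :=
      fun a ha => by field_simp
    rw [e1 _ hsA, e1 _ hsB]
    congr 1
    · congr 1
      field_simp
    · generalize ∑ j ∈ Finset.univ.erase i, ∑ X, S.sigVar X j = Q
      have : M * S.sigVar Side.A i + M * S.sigVar Side.B i ≠ 0 := by positivity
      field_simp
  rw [heq]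
  have h1 : ∑ j ∈ Finset.univ.erase i, ∑ X, S.sigVar X j ≤ ∑ X, ∑ j, S.sigVar X j := by
    rw [Finset.sum_comm (s := Finset.univ (α := Side))]
    exact Finset.sum_le_sum_of_subset_of_nonneg (Finset.erase_subset _ _)
      fun j _ _ => Finset.sum_nonneg fun X _ => (hσ X j).le
  have h2 : P / S.noiseFactor P ≤ P := div_le_self hP0 hk
  have h3 : 0 ≤ ∑ j ∈ Finset.univ.erase i, ∑ X, S.sigVar X j :=
    Finset.sum_nonneg fun j _ => Finset.sum_nonneg fun X _ => (hσ X j).le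
  have h4 := mul_le_mul h2 h1 h3 hP0
  have h5 : (kurt - 1) / M + (kurt - 1) / M + 1 / M = (2 * kurt - 1) / M := by ring
  linarith

/-- The mean of the instantaneous rate is close to the rate at the typical SINR. -/
theorem integral_weightedLog_near {P : ℝ} (hP0 : 0 ≤ P) (hP : ∀ X j, S.p X j = P)
    (hM : 0 < M) (hσ : ∀ X j, 0 < S.sigVar X j) (hε : ∀ X j, 0 ≤ S.epsVar X j) {θ : Side → ℝ}
    (hθ : ∀ X, 0 ≤ θ X) (hθ0 : 0 < θ Side.A + θ Side.B) (i : Fin N) {R : ℝ} (hR : 0 ≤ R)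
    (hAB : S.sigVar Side.A i ≤ R * S.sigVar Side.B i)
    (hBA : S.sigVar Side.B i ≤ R * S.sigVar Side.A i) {δ : ℝ} (hδ : 0 < δ)
    (hδ' : (2 * kurt - 1) / M + P * ∑ X, ∑ j, S.sigVar X j ≤ δ) :
    Integrable (S.weightedLog μ θ i) μ ∧
      |∫ ω, S.weightedLog μ θ i ω ∂μ - Real.logb 2 (1 + S.typicalSinr P θ i)| ≤
        (2 * (5 + R) * Real.sqrt δ +
          65 * (5 + R) ^ 3 * (1 + Real.log (1 + S.typicalSinr P θ i)) * δ) / Real.log 2 := by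
  set s := S.typicalSinr P θ i with hs
  have hk := one_le_noiseFactor hP0 hε
  have hM' : (0 : ℝ) < M := by exact_mod_cast hM
  have hsA := hσ Side.A i
  have hsB := hσ Side.B i
  have haA : 0 < M * S.sigVar Side.A i := by positivity
  have haB : 0 < M * S.sigVar Side.B i := by positivity
  have hAB' : M * S.sigVar Side.A i ≤ R * (M * S.sigVar Side.B i) := by nlinarith
  have hBA' : M * S.sigVar Side.B i ≤ R * (M * S.sigVar Side.A i) := by nlinarith
  have hJ : ∀ ω, 0 ≤ P / S.noiseFactor P * S.interf i ω := fun ω =>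
    mul_nonneg (by positivity) (S.interf_nonneg i ω)
  have hs0 : 0 ≤ s := by
    have := hθ Side.A
    have := hθ Side.B
    rw [hs, typicalSinr]; positivity
  have hL : 0 ≤ Real.log (1 + s) := Real.log_nonneg (by linarith)
  have hD0 : ∀ ω, 0 ≤ S.estDefect P i ω := fun ω => defect_nonneg haA haB (by positivity) (hJ ω)
  have hW0 : ∀ ω, 0 ≤ S.estRatio P θ i ω := fun ω =>
    sinrRatio_nonneg haA haB (S.normSq_nonneg _ _ _) (S.normSq_nonneg _ _ _) (by positivity) (hJ ω)
      (hθ _) (hθ _)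
  have hWle : ∀ ω, S.estRatio P θ i ω ≤ (5 + R) * (4 + S.estDefect P i ω) := fun ω => by
    have h1 : S.estRatio P θ i ω ≤ (R + 1) * (4 + S.estDefect P i ω) :=
      sinrRatio_le haA haB (S.normSq_nonneg _ _ _) (S.normSq_nonneg _ _ _)
        (by positivity) (S.norm_cross_sq_le _ _ _ _ _) (hJ ω) (hθ _) (hθ _) hθ0 hR hAB' hBA'
    have := hD0 ω
    linarith
  have hpt : ∀ ω, |Real.log (1 + s * S.estRatio P θ i ω) - Real.log (1 + s)| ≤
      2 * (5 + R) * Real.sqrt (S.estDefect P i ω) +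
        65 * (5 + R) ^ 3 * (1 + Real.log (1 + s)) * S.estDefect P i ω := fun ω =>
    abs_log_one_add_mul_sub_le_of_defect hs0 (hW0 ω) (hD0 ω) (by linarith)
      (abs_sinrRatio_sub_one_le haA haB (by positivity) (hJ ω) (hθ _) (hθ _) hθ0 hR hAB' hBA')
      (hWle ω)
  have hDint := integrable_estDefect hF P i
  have hDle := (integral_estDefect_le hF hP0 hM hσ hε i).trans hδ'
  have hmeas : AEStronglyMeasurable (fun ω => Real.log (1 + s * S.estRatio P θ i ω)) μ := by
    have m1 := (memLp_normSq hF Side.A i).aemeasurable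
    have m2 := (memLp_normSq hF Side.B i).aemeasurable
    have m3 := (integrable_norm_cross_sq hF Side.A i Side.B i).aemeasurable
    have m4 := (integrable_interf hF i).aemeasurable
    refine (Real.measurable_log.comp_aemeasurable ?_).aestronglyMeasurable
    unfold estRatio sinrRatio
    fun_prop
  -- Dominated through log (1 + x) ≤ x and the linear growth of the ratio in the defect.
  have hint : Integrable (fun ω => Real.log (1 + s * S.estRatio P θ i ω)) μ := by
    refine Integrable.mono' (((integrable_const (4 : ℝ)).add hDint).const_mul (s * (5 + R)))
      hmeas (ae_of_all _ fun ω => ?_)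
    have h0 : 0 ≤ s * S.estRatio P θ i ω := mul_nonneg hs0 (hW0 ω)
    rw [Real.norm_of_nonneg (Real.log_nonneg (by linarith))]
    calc _ ≤ s * S.estRatio P θ i ω := by
          have := Real.log_le_sub_one_of_pos (show 0 < 1 + s * S.estRatio P θ i ω by linarith)
          linarith
      _ ≤ s * ((5 + R) * (4 + S.estDefect P i ω)) := mul_le_mul_of_nonneg_left (hWle ω) hs0
      _ = _ := by simp only [Pi.add_apply]; ring
  have hae : S.weightedLog μ θ i =ᵐ[μ]
      fun ω => Real.log (1 + s * S.estRatio P θ i ω) / Real.log 2 := by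
    filter_upwards [condDisturbance_ae_eq hF i] with ω hω
    rw [weightedLog, hω, weightedPower_div_meanDisturbance hP0 hP hM hσ hε hθ hθ0, Real.logb]
  refine ⟨(hint.div_const _).congr hae.symm, ?_⟩
  have hlog2 : 0 < Real.log 2 := Real.log_pos one_lt_two
  rw [integral_congr_ae hae, integral_div, Real.logb, ← sub_div, abs_div, abs_of_pos hlog2]
  refine div_le_div_of_nonneg_right ?_ hlog2.le
  have hconst : Real.log (1 + s) = ∫ _, Real.log (1 + s) ∂μ := by simp
  rw [hconst, ← integral_sub hint (integrable_const _), ← hconst]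
  refine (abs_integral_le_integral_abs).trans ?_
  have hsd : 0 < Real.sqrt δ := Real.sqrt_pos.2 hδ
  -- The arithmetic-geometric mean inequality in place of Jensen: integrated, it bounds the mean of
  -- √D by √δ as soon as the mean of D is at most δ.
  have hsq : ∀ ω, Real.sqrt (S.estDefect P i ω) ≤
      Real.sqrt δ / 2 + S.estDefect P i ω / (2 * Real.sqrt δ) := fun ω => by
    have h1 := sq_nonneg (Real.sqrt (S.estDefect P i ω) - Real.sqrt δ)
    have h2 := Real.sq_sqrt (hD0 ω)
    have e : Real.sqrt δ / 2 + S.estDefect P i ω / (2 * Real.sqrt δ) =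
      (Real.sqrt δ ^ 2 + S.estDefect P i ω) / (2 * Real.sqrt δ) := by field_simp
    rw [e, le_div_iff₀ (by positivity)]
    nlinarith
  set K := 65 * (5 + R) ^ 3 * (1 + Real.log (1 + s)) with hK
  have hK0 : 0 ≤ K := by positivity
  calc ∫ ω, |Real.log (1 + s * S.estRatio P θ i ω) - Real.log (1 + s)| ∂μ
      ≤ ∫ ω, (2 * (5 + R) * (Real.sqrt δ / 2) +
          (2 * (5 + R) / (2 * Real.sqrt δ) + K) * S.estDefect P i ω) ∂μ := by
        refine integral_mono (hint.sub (integrable_const _)).abs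
          ((integrable_const _).add (hDint.const_mul _)) fun ω => (hpt ω).trans ?_
        have := mul_le_mul_of_nonneg_left (hsq ω) (show 0 ≤ 2 * (5 + R) by positivity)
        calc _ ≤ 2 * (5 + R) * (Real.sqrt δ / 2 + S.estDefect P i ω / (2 * Real.sqrt δ)) +
              K * S.estDefect P i ω := by linarith
          _ = _ := by ring
    _ = 2 * (5 + R) * (Real.sqrt δ / 2) +
          (2 * (5 + R) / (2 * Real.sqrt δ) + K) * ∫ ω, S.estDefect P i ω ∂μ := by
        rw [integral_add (integrable_const _) (hDint.const_mul _),
          integral_const_mul (2 * (5 + R) / (2 * Real.sqrt δ) + K)]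
        simp
    _ ≤ 2 * (5 + R) * (Real.sqrt δ / 2) + (2 * (5 + R) / (2 * Real.sqrt δ) + K) * δ := by
        gcongr
    _ = 2 * (5 + R) * Real.sqrt δ + K * δ := by
        have : δ = Real.sqrt δ ^ 2 := (Real.sq_sqrt hδ.le).symm
        have e : 2 * (5 + R) / (2 * Real.sqrt δ) * δ = (5 + R) * Real.sqrt δ := by
          rw [div_mul_eq_mul_div, div_eq_iff (by positivity)]
          nth_rewrite 1 [this]
          ring
        rw [add_mul, e]
        ring

end RelaySystem

/-! ### Closed form of the downlink SINR; existence of the expectations. -/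

namespace RelaySystem

variable {M N τ : ℕ} {Ω : Type*} {S : RelaySystem M N τ Ω} [MeasurableSpace Ω] {μ : Measure Ω}
  [IsProbabilityMeasure μ]

omit [MeasurableSpace Ω] in
lemma sum_sigVar_eq (S : RelaySystem M N τ Ω) (X : Side) (i : Fin N) :
    ∑ Y, ∑ j, S.sigVar Y j = S.sigVar X i + S.sigVar X.other i +
      ∑ j ∈ Finset.univ.erase i, ∑ Y, S.sigVar Y j := by
  rw [Finset.sum_comm, ← Finset.add_sum_erase _ _ (Finset.mem_univ i), Side.sum_eq]
  cases X
  · rfl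
  · simp only [Side.other]
    ring

/-- The downlink SINR in closed form. -/
lemma sinrDown_eq (hF : IsGaussianFamily S.estErr S.estErrVar μ) (hM : 0 < M)
    (hσ : ∀ X j, 0 < S.sigVar X j) (hpr : 0 < S.pr) (X : Side) (i : Fin N) :
    S.sinrDown μ X i = S.pr * M * S.sigVar X i ^ 2 /
      (S.pr * ((S.sigVar X i + S.epsVar X i) * ∑ Y, ∑ j, S.sigVar Y j +
        (kurt - 2) * S.sigVar X i ^ 2) + ∑ Y, ∑ j, S.sigVar Y j) := by
  have hM' : (0 : ℝ) < M := by exact_mod_cast hM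
  have hQ : 0 < ∑ Y, ∑ j, S.sigVar Y j :=
    Finset.sum_pos (fun Y _ => Finset.sum_pos (fun j _ => hσ Y j) ⟨i, Finset.mem_univ i⟩)
      ⟨X, Finset.mem_univ X⟩
  have hrho : S.rho μ ^ 2 = S.pr / (M * ∑ Y, ∑ j, S.sigVar Y j) := by
    rw [rho, integral_precoderNormSq hF, Real.sq_sqrt (by positivity)]
  have hother : (X, i) ≠ (X.other, i) := by cases X <;> simp [Side.other]
  have hsum : ∑ j ∈ Finset.univ.erase i, ∑ Y : Side, ∫ ω, ‖S.gain X i Y j ω‖ ^ 2 ∂μ =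
      M * ((S.sigVar X i + S.epsVar X i) *
        ∑ j ∈ Finset.univ.erase i, ∑ Y, S.sigVar Y j) := by
    rw [Finset.mul_sum, Finset.mul_sum]
    refine Finset.sum_congr rfl fun j hj => ?_
    have hji : i ≠ j := (Finset.mem_erase.1 hj).1.symm
    simp only [(integral_gain_of_ne hF (show (X, i) ≠ (_, j) by simp [hji])).1, Finset.mul_sum]
  obtain ⟨h1, h2⟩ := integral_gain_self hF X i
  rw [sinrDown, h1, h2, (integral_gain_of_ne hF hother).2, hsum, hrho]
  have hq := S.sum_sigVar_eq X i
  generalize ∑ Y, ∑ j, S.sigVar Y j = Q at *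
  generalize ∑ j ∈ Finset.univ.erase i, ∑ Y, S.sigVar Y j = q at *
  have h3 : S.sigVar X.other i = Q - S.sigVar X i - q := by linarith
  rw [h3, norm_mul, Complex.norm_natCast, Complex.norm_real, Real.norm_eq_abs, mul_pow, sq_abs]
  generalize S.sigVar X i = s
  generalize S.epsVar X i = ε
  -- Self-variance, residual self-interference and interference of the other pairs add up to σ + ε
  -- times the total estimate variance Q, plus the kurtosis correction. All terms, including 1 / ρ²,
  -- carry a factor M, so the numerator M² σ² leaves one array gain M.
  have h4 : (M * (s * (s + ε + (kurt - 2) * s)) + M * ((s + ε) * (Q - s - q)) +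
      M * ((s + ε) * q) + 1 / (S.pr / (M * Q))) =
      M / S.pr * (S.pr * ((s + ε) * Q + (kurt - 2) * s ^ 2) + Q) := by
    field_simp
    ring
  rw [h4, ← div_div]
  congr 1
  field_simp

/-- Integrability of the rates is a by-product of `integral_weightedLog_near`; any admissible R and
δ will do, so crude ones are chosen. -/
lemma expectationsExist (hF : IsGaussianFamily S.estErr S.estErrVar μ) {P : ℝ} (hP0 : 0 ≤ P)
    (hP : ∀ X j, S.p X j = P) (hM : 0 < M) (hσ : ∀ X j, 0 < S.sigVar X j)
    (hε : ∀ X j, 0 ≤ S.epsVar X j) (i : Fin N) : S.ExpectationsExist μ i := by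
  have hint : ∀ θ : Side → ℝ, (∀ X, 0 ≤ θ X) → 0 < θ Side.A + θ Side.B →
      Integrable (S.weightedLog μ θ i) μ := fun θ hθ hθ0 => by
    have hA := hσ Side.A i
    have hB := hσ Side.B i
    refine (integral_weightedLog_near hF hP0 hP hM hσ hε hθ hθ0 i
      (R := S.sigVar Side.A i / S.sigVar Side.B i + S.sigVar Side.B i / S.sigVar Side.A i)
      (by positivity) ?_ ?_
      (δ := |(2 * kurt - 1) / M + P * ∑ X, ∑ j, S.sigVar X j| + 1) (by positivity) ?_).1
    · rw [add_mul, div_mul_cancel₀ _ hB.ne']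
      have : 0 ≤ S.sigVar Side.B i / S.sigVar Side.A i * S.sigVar Side.B i := by positivity
      linarith
    · rw [add_mul, div_mul_cancel₀ _ hA.ne']
      have : 0 ≤ S.sigVar Side.A i / S.sigVar Side.B i * S.sigVar Side.A i := by positivity
      linarith
    · linarith [le_abs_self ((2 * kurt - 1) / M + P * ∑ X, ∑ j, S.sigVar X j)]
  refine ⟨integrable_disturbance hF i, ?_, fun X => ?_, integrable_precoderNormSq hF,
    fun X Y j => memLp_gain hF X i Y j⟩
  · rw [pairLog_eq]
    exact hint _ (fun _ => zero_le_one) (by norm_num)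
  · rw [uplinkLog_eq]
    refine hint _ (fun Y => ?_) ?_
    · split_ifs <;> norm_num
    · cases X <;> simp

omit [IsProbabilityMeasure μ] in
-- Without antennas the pilot power Ep / 0 ^ c is 0 and the Gaussian description with positive
-- variances is not available, but all sums over antennas are empty.
lemma expectationsExist_zero {S : RelaySystem 0 N τ Ω} (i : Fin N) : S.ExpectationsExist μ i := by
  have hs : ∀ X, S.signalPower X i = fun _ => 0 := fun X => by
    funext ω; simp [signalPower, dotProduct]
  have hd : S.disturbance i = fun _ => 0 := by
    funext ω; simp [disturbance, errorPower, interferencePower, noisePower, dotProduct]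
  refine ⟨?_, ?_, fun X => ?_, ?_, fun X Y j => ?_⟩
  · rw [hd]; exact integrable_zero _ _ _
  · have : S.pairLog μ i = fun _ => 0 := by funext ω; simp [pairLog, hs]
    rw [this]; exact integrable_zero _ _ _
  · have : S.uplinkLog μ X i = fun _ => 0 := by funext ω; simp [uplinkLog, hs]
    rw [this]; exact integrable_zero _ _ _
  · have : S.precoderNormSq = fun _ => 0 := by funext ω; simp [precoderNormSq]
    rw [this]; exact integrable_zero _ _ _
  · have : S.gain X i Y j = fun _ => 0 := by funext ω; simp [gain, dotProduct]
    rw [this]; exact MemLp.zero'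

end RelaySystem

/-! ### Minima of rates and their bottlenecks. -/

section Combination

variable {f f' g g' : ℕ → ℝ}

lemma tendsto_min_sub_min (hf : Tendsto (fun M => f M - f' M) atTop (𝓝 0))
    (hg : Tendsto (fun M => g M - g' M) atTop (𝓝 0)) :
    Tendsto (fun M => min (f M) (g M) - min (f' M) (g' M)) atTop (𝓝 0) := by
  rw [tendsto_zero_iff_abs_tendsto_zero] at *
  have h := hf.add hg
  rw [add_zero] at h
  refine squeeze_zero (fun _ => abs_nonneg _) (fun M => ?_) h
  refine (abs_min_sub_min_le_max _ _ _ _).trans (max_le ?_ ?_)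
  · exact le_add_of_nonneg_right (abs_nonneg _)
  · exact le_add_of_nonneg_left (abs_nonneg _)

/-- The rate belonging to an SINR. -/
def rate (z : ℝ) : ℝ := 1 / 2 * Real.logb 2 (1 + z)

lemma rate_nonneg {z : ℝ} (hz : 0 ≤ z) : 0 ≤ rate z := by
  have := Real.logb_nonneg one_lt_two (show 1 ≤ 1 + z by linarith)
  unfold rate; positivity

lemma rate_le_rate {z z' : ℝ} (hz : 0 ≤ z) (h : z ≤ z') : rate z ≤ rate z' := by
  have := Real.logb_le_logb_of_le one_lt_two (show 0 < 1 + z by linarith)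
    (show 1 + z ≤ 1 + z' by linarith)
  unfold rate; linarith

/-- Since (1 + z)(1 + z') = 1 + z + z' + z z', the product term decides when a sum of two downlink
rates stays below a single uplink rate. -/
lemma rate_add_rate {z z' : ℝ} (hz : 0 ≤ z) (hz' : 0 ≤ z') :
    rate z + rate z' = rate (z + z' + z * z') := by
  unfold rate
  rw [← mul_add, ← Real.logb_mul (by linarith) (by linarith)]
  congr 2
  ring

lemma tendsto_rate_zero {z : ℕ → ℝ} (hz : Tendsto z atTop (𝓝 0)) :
    Tendsto (fun M => rate (z M)) atTop (𝓝 0) := by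
  have h : Tendsto rate (𝓝 0) (𝓝 (rate 0)) := by
    refine ContinuousAt.tendsto (f := rate) ?_
    unfold rate Real.logb
    fun_prop (disch := norm_num)
  have h0 : rate 0 = 0 := by simp [rate]
  rw [h0] at h
  exact h.comp hz

/-- A vanishing relative error of the SINR costs a vanishing absolute error of the rate, whatever
the size of x, because `abs_log_one_add_mul_sub_le_of_near` is uniform in s. -/
lemma tendsto_rate_mul_sub {x v : ℕ → ℝ} {w : ℝ} (hx : ∀ᶠ M in atTop, 0 ≤ x M) (hw : 0 < w)
    (hv : Tendsto v atTop (𝓝 w)) :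
    Tendsto (fun M => rate (x M * v M) - rate (x M * w)) atTop (𝓝 0) := by
  have h1 : Tendsto (fun M => |v M / w - 1|) atTop (𝓝 0) := by
    have := ((hv.div_const w).sub_const 1).abs
    rwa [div_self hw.ne', sub_self, abs_zero] at this
  have h2 : ∀ᶠ M in atTop, |v M / w - 1| ≤ 1 / 2 := h1.eventually_le_const (by norm_num)
  have h3 := h1.const_mul (1 / Real.log 2)
  rw [mul_zero] at h3
  rw [tendsto_zero_iff_abs_tendsto_zero]
  refine squeeze_zero' (Eventually.of_forall fun _ => abs_nonneg _) ?_ h3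
  filter_upwards [hx, h2] with M hM hM2
  have h4 := abs_log_one_add_mul_sub_le_of_near (mul_nonneg hM hw.le) hM2
  have h5 : x M * w * (v M / w) = x M * v M := by field_simp
  rw [h5] at h4
  have hlog2 : 0 < Real.log 2 := Real.log_pos one_lt_two
  simp only [rate, Real.logb, Function.comp_apply]
  rw [← mul_sub, ← sub_div, abs_mul, abs_of_pos (one_half_pos (α := ℝ)), abs_div,
    abs_of_pos hlog2]
  calc _ ≤ 1 / 2 * (2 * |v M / w - 1| / Real.log 2) := by gcongr
    _ = _ := by ring

/-- The decode-and-forward rate for given SINR profiles: `x` and `y` are the uplink and downlink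
scalings. -/
def combinedRate (x y u uA uB dA dB : ℝ) : ℝ :=
  min (rate (x * u)) (min (rate (x * uA)) (rate (y * dB)) + min (rate (x * uB)) (rate (y * dA)))

variable {x y : ℕ → ℝ} {u uA uB dA dB u' uA' uB' dA' dB' : ℝ}

lemma combinedRate_nonneg {x y : ℝ} (hx : 0 ≤ x) (hy : 0 ≤ y) (hu : 0 ≤ u) (huA : 0 ≤ uA)
    (huB : 0 ≤ uB) (hdA : 0 ≤ dA) (hdB : 0 ≤ dB) : 0 ≤ combinedRate x y u uA uB dA dB :=
  le_min (rate_nonneg (mul_nonneg hx hu)) (add_nonneg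
    (le_min (rate_nonneg (mul_nonneg hx huA)) (rate_nonneg (mul_nonneg hy hdB)))
    (le_min (rate_nonneg (mul_nonneg hx huB)) (rate_nonneg (mul_nonneg hy hdA))))

lemma tendsto_combinedRate_of_uplink (hx : ∀ᶠ M in atTop, 0 ≤ x M)
    (hy : ∀ᶠ M in atTop, 0 ≤ y M) (hu : 0 ≤ u) (huA : 0 ≤ uA)
    (huB : 0 ≤ uB) (hdA : 0 ≤ dA) (hdB : 0 ≤ dB) (h : Tendsto x atTop (𝓝 0)) :
    Tendsto (fun M => combinedRate (x M) (y M) u uA uB dA dB) atTop (𝓝 0) := by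
  have h1 := tendsto_rate_zero (by simpa using h.mul_const u)
  refine squeeze_zero' ?_ (Eventually.of_forall fun M => min_le_left _ _) h1
  filter_upwards [hx, hy] with M h1 h2 using combinedRate_nonneg h1 h2 hu huA huB hdA hdB

lemma tendsto_combinedRate_of_downlink (hx : ∀ᶠ M in atTop, 0 ≤ x M)
    (hy : ∀ᶠ M in atTop, 0 ≤ y M) (hu : 0 ≤ u) (huA : 0 ≤ uA)
    (huB : 0 ≤ uB) (hdA : 0 ≤ dA) (hdB : 0 ≤ dB) (h : Tendsto y atTop (𝓝 0)) :
    Tendsto (fun M => combinedRate (x M) (y M) u uA uB dA dB) atTop (𝓝 0) := by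
  have h1 := (tendsto_rate_zero (by simpa using h.mul_const dB)).add
    (tendsto_rate_zero (by simpa using h.mul_const dA))
  rw [add_zero] at h1
  refine squeeze_zero' ?_ (Eventually.of_forall fun M => (min_le_right _ _).trans
    (add_le_add (min_le_right _ _) (min_le_right _ _))) h1
  filter_upwards [hx, hy] with M h1 h2 using combinedRate_nonneg h1 h2 hu huA huB hdA hdB

lemma eventually_mul_le (hx : ∀ᶠ M in atTop, 0 < x M) (hu : 0 < u)
    (h : Tendsto (fun M => y M / x M) atTop (𝓝 0)) (d : ℝ) :
    ∀ᶠ M in atTop, y M * d ≤ x M * u := by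
  have h1 := h.mul_const d
  rw [zero_mul] at h1
  filter_upwards [hx, h1.eventually_le_const hu] with M h1 h2
  rw [div_mul_eq_mul_div, div_le_iff₀ h1] at h2
  linarith

/-- Both inner minima select the uplink, so the downlink constants dA and dB drop out. -/
lemma eventually_combinedRate_of_uplink_small (hx : ∀ᶠ M in atTop, 0 < x M)
    (hy : ∀ᶠ M in atTop, 0 < y M) (huA : 0 < uA)
    (huB : 0 < uB) (hdA : 0 < dA) (hdB : 0 < dB)
    (h : Tendsto (fun M => x M / y M) atTop (𝓝 0)) :
    ∀ᶠ M in atTop, combinedRate (x M) (y M) u uA uB dA dB =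
      min (rate (x M * u)) (rate (x M * uA) + rate (x M * uB)) := by
  filter_upwards [hx, eventually_mul_le hy hdB h uA, eventually_mul_le hy hdA h uB]
    with M h1 h2 h3
  rw [combinedRate, min_eq_left (rate_le_rate (by positivity) h2),
    min_eq_left (rate_le_rate (by positivity) h3)]

/-- The inner minima select the downlink, and the first-phase rate is not active once y (dA + dB) +
y² dA dB ≤ x u. This needs y² / x → 0 besides y / x → 0; half of u is spent on each term. -/
lemma eventually_combinedRate_of_downlink_small (hx : ∀ᶠ M in atTop, 0 < x M)
    (hy : ∀ᶠ M in atTop, 0 < y M) (hu : 0 < u) (huA : 0 < uA)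
    (huB : 0 < uB) (hdA : 0 < dA) (hdB : 0 < dB)
    (h : Tendsto (fun M => y M / x M) atTop (𝓝 0))
    (h2 : Tendsto (fun M => y M ^ 2 / x M) atTop (𝓝 0)) :
    ∀ᶠ M in atTop, combinedRate (x M) (y M) u uA uB dA dB =
      rate (y M * dB) + rate (y M * dA) := by
  filter_upwards [hx, hy, eventually_mul_le hx huA h dB, eventually_mul_le hx huB h dA,
    eventually_mul_le hx (half_pos hu) h (dB + dA),
    eventually_mul_le (y := fun M => y M ^ 2) hx (half_pos hu) h2 (dB * dA)] with M h1 h1' h2 h3 h4 h5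
  rw [combinedRate, min_eq_right (rate_le_rate (by positivity) h2),
    min_eq_right (rate_le_rate (by positivity) h3), min_eq_right]
  rw [rate_add_rate (by positivity) (by positivity)]
  exact rate_le_rate (by positivity) (by nlinarith)

end Combination

lemma estVar_le {t b : ℝ} (ht : 0 ≤ t) (hb : 0 ≤ b) : estVar t b ≤ t * b ^ 2 := by
  have := mul_nonneg ht hb
  exact div_le_self (by positivity) (by linarith)

/-- The quotient of the variances is b'² / b² times (1 + t b) / (1 + t b') ≤ 1 + b / b', a bound
free of t. It keeps the two estimates of a pair comparable for all M. -/
lemma estVar_le_mul_estVar {t b b' : ℝ} (ht : 0 < t) (hb : 0 < b) (hb' : 0 < b') :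
    estVar t b' ≤ b' ^ 2 / b ^ 2 * (1 + b / b') * estVar t b := by
  unfold estVar
  have e : b' ^ 2 / b ^ 2 * (1 + b / b') * (t * b ^ 2 / (1 + t * b)) =
      t * b' * (b' + b) / (1 + t * b) := by
    field_simp
  rw [e, div_le_div_iff₀ (by positivity) (by positivity)]
  have h1 : 0 ≤ t * b' * b := by positivity
  have h2 : 0 ≤ t * (t * b' * b) * b' := by positivity
  have h3 : 0 ≤ t * t * b' ^ 3 := by positivity
  nlinarith

/-! ### Limits of power laws. -/

section PowerLaws

/-- The limit of `E / M ^ a`. -/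
def limitPower (E a : ℝ) : ℝ := if a = 0 then E else 0

lemma limitPower_nonneg {E a : ℝ} (hE : 0 ≤ E) : 0 ≤ limitPower E a := by
  unfold limitPower; split_ifs <;> simp [hE]

lemma tendsto_div_rpow_zero (E : ℝ) {a : ℝ} (ha : 0 < a) :
    Tendsto (fun M : ℕ => E / (M : ℝ) ^ a) atTop (𝓝 0) :=
  tendsto_const_nhds.div_atTop ((tendsto_rpow_atTop ha).comp tendsto_natCast_atTop_atTop)

lemma tendsto_div_rpow (E : ℝ) {a : ℝ} (ha : 0 ≤ a) :
    Tendsto (fun M : ℕ => E / (M : ℝ) ^ a) atTop (𝓝 (limitPower E a)) := by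
  rcases ha.lt_or_eq with h | rfl
  · rw [limitPower, if_neg h.ne']
    exact tendsto_div_rpow_zero E h
  · simp [limitPower]

lemma tendsto_div_rpow_mul_log (E : ℝ) {a : ℝ} (ha : 0 < a) :
    Tendsto (fun M : ℕ => E / (M : ℝ) ^ a * Real.log M) atTop (𝓝 0) := by
  have h := ((isLittleO_log_rpow_atTop ha).tendsto_div_nhds_zero.comp
    tendsto_natCast_atTop_atTop).const_mul E
  rw [mul_zero] at h
  refine h.congr fun M => ?_
  simp only [Function.comp_apply]
  ring

lemma div_rpow_le_self {E a : ℝ} (hE : 0 ≤ E) (ha : 0 ≤ a) {M : ℕ} (hM : 0 < M) :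
    E / (M : ℝ) ^ a ≤ E :=
  div_le_self hE (Real.one_le_rpow (by exact_mod_cast hM) ha)

end PowerLaws

/-- A sequence of relay systems, indexed by the number of antennas, with the power scaling laws
`p_u = Eu / M ^ a`, `p_r = Er / M ^ b`, `p_p = Ep / M ^ c`. -/
structure IsScaled {N τ : ℕ} (β : Side → Fin N → ℝ) (Eu Er Ep a b c : ℝ)
    {Ω : ℕ → Type*} [∀ M, MeasurableSpace (Ω M)] (μ : ∀ M, Measure (Ω M))
    (S : ∀ M, RelaySystem M N τ (Ω M)) : Prop where
  β_pos : ∀ X i, 0 < β X i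
  Eu_pos : 0 < Eu
  Er_pos : 0 < Er
  Ep_pos : 0 < Ep
  a_nonneg : 0 ≤ a
  b_nonneg : 0 ≤ b
  c_pos : 0 < c
  τ_pos : 0 < τ
  model : ∀ M, (S M).IsModel (μ M)
  β_eq : ∀ M, (S M).β = β
  p_eq : ∀ M X j, (S M).p X j = Eu / (M : ℝ) ^ a
  pr_eq : ∀ M, (S M).pr = Er / (M : ℝ) ^ b
  pp_eq : ∀ M, (S M).pp = Ep / (M : ℝ) ^ c

/-- A column of length 0 has norm 0 and cannot be normalized. -/
lemma RelaySystem.IsModel.pilot_length_pos {M N τ : ℕ} {Ω : Type*} [MeasurableSpace Ω]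
    {μ : Measure Ω} {S : RelaySystem M N τ Ω} (hS : S.IsModel μ) (i : Fin N) : 0 < τ := by
  rcases Nat.eq_zero_or_pos τ with h | h
  · subst h
    have := hS.sum_pilot Side.A Side.A i i
    simp at this
  · exact h

/-! ### Asymptotics of the single-link rates under power scaling. -/

namespace IsScaled

variable {N τ : ℕ} {β : Side → Fin N → ℝ} {Eu Er Ep a b c : ℝ} {Ω : ℕ → Type*}
  [∀ M, MeasurableSpace (Ω M)] {μ : ∀ M, Measure (Ω M)} {S : ∀ M, RelaySystem M N τ (Ω M)}

/-- The total energy of a pilot sequence. -/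
def pilotEnergy (τ : ℕ) (Ep c : ℝ) (M : ℕ) : ℝ := τ * (Ep / (M : ℝ) ^ c)

variable (h : IsScaled β Eu Er Ep a b c μ S)
include h

lemma energy_eq (M : ℕ) : τ * (S M).pp = pilotEnergy τ Ep c M := by rw [h.pp_eq]; rfl

lemma energy_pos {M : ℕ} (hM : 0 < M) : 0 < pilotEnergy τ Ep c M := by
  have := h.Ep_pos
  have := h.τ_pos
  unfold pilotEnergy; positivity

lemma sigVar_eq (M : ℕ) (X : Side) (j : Fin N) :
    (S M).sigVar X j = estVar (pilotEnergy τ Ep c M) (β X j) := by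
  rw [RelaySystem.sigVar, h.energy_eq, h.β_eq]

lemma epsVar_eq (M : ℕ) (X : Side) (j : Fin N) :
    (S M).epsVar X j = errVar (pilotEnergy τ Ep c M) (β X j) := by
  rw [RelaySystem.epsVar, h.energy_eq, h.β_eq]

lemma sigVar_pos {M : ℕ} (hM : 0 < M) (X : Side) (j : Fin N) : 0 < (S M).sigVar X j := by
  rw [h.sigVar_eq]; exact estVar_pos (h.energy_pos hM) (h.β_pos _ _)

lemma epsVar_pos {M : ℕ} (hM : 0 < M) (X : Side) (j : Fin N) : 0 < (S M).epsVar X j := by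
  rw [h.epsVar_eq]; exact errVar_pos (h.energy_pos hM) (h.β_pos _ _)

lemma sigVar_add_epsVar {M : ℕ} (hM : 0 < M) (X : Side) (j : Fin N) :
    (S M).sigVar X j + (S M).epsVar X j = β X j := by
  rw [h.sigVar_eq, h.epsVar_eq, estVar_add_errVar (h.energy_pos hM) (h.β_pos _ _)]

lemma tendsto_energy : Tendsto (pilotEnergy τ Ep c) atTop (𝓝 0) := by
  have := (tendsto_div_rpow_zero Ep h.c_pos).const_mul (τ : ℝ)
  rwa [mul_zero] at this

lemma tendsto_one_add_energy_mul (x : ℝ) :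
    Tendsto (fun M => 1 + pilotEnergy τ Ep c M * x) atTop (𝓝 1) := by
  simpa using (h.tendsto_energy.mul_const x).const_add 1

lemma tendsto_epsVar (X : Side) (j : Fin N) :
    Tendsto (fun M => (S M).epsVar X j) atTop (𝓝 (β X j)) := by
  simp only [h.epsVar_eq, errVar]
  have := (tendsto_const_nhds (x := β X j)).div (h.tendsto_one_add_energy_mul (β X j))
    one_ne_zero
  rwa [div_one] at this

omit h in
/-- The variance of the estimates relative to the pilot energy. -/
def relVar (τ : ℕ) (Ep c : ℝ) (x : ℝ) (M : ℕ) : ℝ := x ^ 2 / (1 + pilotEnergy τ Ep c M * x)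

lemma sigVar_eq_mul (M : ℕ) (X : Side) (j : Fin N) :
    (S M).sigVar X j = pilotEnergy τ Ep c M * relVar τ Ep c (β X j) M := by
  rw [h.sigVar_eq, estVar, relVar, mul_div_assoc]

lemma tendsto_relVar (x : ℝ) : Tendsto (relVar τ Ep c x) atTop (𝓝 (x ^ 2)) := by
  have := (tendsto_const_nhds (x := x ^ 2)).div (h.tendsto_one_add_energy_mul x) one_ne_zero
  rwa [div_one] at this

omit h in
-- The origin of the exponent d + c - 1: transmit power M^(-d), array gain M, pilot energy M^(-c).
lemma power_mul_energy {E : ℝ} {d : ℝ} {M : ℕ} (hM : 0 < M) :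
    E / (M : ℝ) ^ d * M * pilotEnergy τ Ep c M = τ * E * Ep / (M : ℝ) ^ (d + c - 1) := by
  have hM' : (0 : ℝ) < M := by exact_mod_cast hM
  rw [pilotEnergy, Real.rpow_sub hM', Real.rpow_add hM', Real.rpow_one]
  field_simp

lemma power_nonneg (M : ℕ) : 0 ≤ Eu / (M : ℝ) ^ a := by
  have := h.Eu_pos
  positivity

variable [∀ M, IsProbabilityMeasure (μ M)]

lemma isGaussianFamily {M : ℕ} (hM : 0 < M) :
    IsGaussianFamily (S M).estErr (S M).estErrVar (μ M) := by
  refine (h.model M).isGaussianFamily_estErr (fun X i => ?_) ?_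
  · rw [h.β_eq]; exact h.β_pos X i
  · rw [h.energy_eq]; exact h.energy_pos hM

lemma expectationsExist (i : Fin N) (M : ℕ) : (S M).ExpectationsExist (μ M) i := by
  rcases Nat.eq_zero_or_pos M with rfl | hM
  · exact RelaySystem.expectationsExist_zero i
  · exact RelaySystem.expectationsExist (h.isGaussianFamily hM) (h.power_nonneg M) (h.p_eq M) hM
      (h.sigVar_pos hM) (fun X j => (h.epsVar_pos hM X j).le) i

/-- The mean of the instantaneous rate is asymptotically the rate at the typical SINR. -/
theorem tendsto_integral_weightedLog_sub {θ : Side → ℝ}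
    (hθ : ∀ X, 0 ≤ θ X) (hθ0 : 0 < θ Side.A + θ Side.B) (i : Fin N) :
    Tendsto (fun M => 1 / 2 * ∫ ω, (S M).weightedLog (μ M) θ i ω ∂(μ M) -
      rate ((S M).typicalSinr (Eu / (M : ℝ) ^ a) θ i)) atTop (𝓝 0) := by
  have hA := h.β_pos Side.A i
  have hB := h.β_pos Side.B i
  have hEu := h.Eu_pos
  have hEp := h.Ep_pos
  have hτ : (0 : ℝ) < τ := by exact_mod_cast h.τ_pos
  -- One R for all M, the sum of the two comparison constants of `estVar_le_mul_estVar`.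
  obtain ⟨R, hR0, hR1, hR2⟩ : ∃ R : ℝ, 0 ≤ R ∧
      (∀ M, 0 < M → (S M).sigVar Side.A i ≤ R * (S M).sigVar Side.B i) ∧
      (∀ M, 0 < M → (S M).sigVar Side.B i ≤ R * (S M).sigVar Side.A i) := by
    refine ⟨β Side.A i ^ 2 / β Side.B i ^ 2 * (1 + β Side.B i / β Side.A i) +
      β Side.B i ^ 2 / β Side.A i ^ 2 * (1 + β Side.A i / β Side.B i), by positivity,
      fun M hM => ?_, fun M hM => ?_⟩
    · rw [h.sigVar_eq, h.sigVar_eq, add_mul]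
      have h1 := estVar_le_mul_estVar (h.energy_pos hM) hB hA
      have h2 := estVar_pos (h.energy_pos hM) hB
      have h3 : 0 ≤ β Side.B i ^ 2 / β Side.A i ^ 2 * (1 + β Side.A i / β Side.B i) *
        estVar (pilotEnergy τ Ep c M) (β Side.B i) := by positivity
      linarith
    · rw [h.sigVar_eq, h.sigVar_eq, add_mul]
      have h1 := estVar_le_mul_estVar (h.energy_pos hM) hA hB
      have h2 := estVar_pos (h.energy_pos hM) hA
      have h3 : 0 ≤ β Side.A i ^ 2 / β Side.B i ^ 2 * (1 + β Side.B i / β Side.A i) *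
        estVar (pilotEnergy τ Ep c M) (β Side.A i) := by positivity
      linarith
  set C := Eu * (τ * Ep) * ∑ X, ∑ j, β X j ^ 2 with hC
  have hC0 : 0 ≤ C := by positivity
  -- A bound for the mean defect: 1 / M from channel hardening, and M^(-c) from the interference, by
  -- power at most Eu and `estVar t β ≤ t β²`.
  set δ : ℕ → ℝ := fun M => (2 * |kurt| + 1) / (M : ℝ) ^ (1 : ℝ) + C / (M : ℝ) ^ c with hδ
  set K := Eu * ((θ Side.A + θ Side.B) * (β Side.A i + β Side.B i)) with hK
  have hK0 : 0 ≤ K := by positivity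
  have hδ0 : Tendsto δ atTop (𝓝 0) := by
    have := (tendsto_div_rpow_zero (2 * |kurt| + 1) one_pos).add
      (tendsto_div_rpow_zero C h.c_pos)
    rwa [add_zero] at this
  have hδlog : Tendsto (fun M => δ M * Real.log M) atTop (𝓝 0) := by
    have := (tendsto_div_rpow_mul_log (2 * |kurt| + 1) one_pos).add
      (tendsto_div_rpow_mul_log C h.c_pos)
    simpa only [hδ, add_mul, add_zero] using this
  have hbound : Tendsto (fun M => (2 * (5 + R) * Real.sqrt (δ M) + 65 * (5 + R) ^ 3 *
      ((1 + Real.log (1 + K)) * δ M + δ M * Real.log M)) / Real.log 2) atTop (𝓝 0) := by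
    have h1 : Tendsto (fun M => Real.sqrt (δ M)) atTop (𝓝 0) := by
      simpa using hδ0.sqrt
    have := (((h1.const_mul (2 * (5 + R))).add (((hδ0.const_mul (1 + Real.log (1 + K))).add
      hδlog).const_mul (65 * (5 + R) ^ 3)))).div_const (Real.log 2)
    simpa using this
  have hbound2 := hbound.const_mul (1 / 2)
  rw [mul_zero] at hbound2
  rw [tendsto_zero_iff_abs_tendsto_zero]
  refine squeeze_zero' (Eventually.of_forall fun _ => abs_nonneg _) ?_ hbound2
  filter_upwards [eventually_gt_atTop 0] with M hM
  have hM' : (0 : ℝ) < M := by exact_mod_cast hM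
  have hM1 : (1 : ℝ) ≤ M := by exact_mod_cast hM
  have ht := h.energy_pos hM
  have hδpos : 0 < δ M := by simp only [hδ]; positivity
  have hP := div_rpow_le_self hEu.le h.a_nonneg hM
  have hδ' : (2 * kurt - 1) / M + Eu / (M : ℝ) ^ a * ∑ X, ∑ j, (S M).sigVar X j ≤ δ M := by
    have h1 : (2 * kurt - 1) / M ≤ (2 * |kurt| + 1) / (M : ℝ) ^ (1 : ℝ) := by
      rw [Real.rpow_one]
      gcongr
      linarith [le_abs_self kurt]
    have h2 : ∑ X, ∑ j, (S M).sigVar X j ≤ pilotEnergy τ Ep c M * ∑ X, ∑ j, β X j ^ 2 := by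
      simp only [Finset.mul_sum]
      refine Finset.sum_le_sum fun X _ => Finset.sum_le_sum fun j _ => ?_
      rw [h.sigVar_eq]
      exact estVar_le ht.le (h.β_pos X j).le
    have h3 : 0 ≤ ∑ X, ∑ j, (S M).sigVar X j :=
      Finset.sum_nonneg fun X _ => Finset.sum_nonneg fun j _ => (h.sigVar_pos hM X j).le
    have h4 := mul_le_mul hP h2 h3 hEu.le
    have h5 : Eu * (pilotEnergy τ Ep c M * ∑ X, ∑ j, β X j ^ 2) = C / (M : ℝ) ^ c := by
      rw [hC, pilotEnergy]; ring
    simp only [hδ]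
    linarith
  obtain ⟨-, hnear⟩ := RelaySystem.integral_weightedLog_near (h.isGaussianFamily hM)
    (h.power_nonneg M) (h.p_eq M) hM (h.sigVar_pos hM) (fun X j => (h.epsVar_pos hM X j).le)
    hθ hθ0 i hR0 (hR1 M hM) (hR2 M hM) hδpos hδ'
  have hk := RelaySystem.one_le_noiseFactor (h.power_nonneg M)
    (fun X j => (h.epsVar_pos hM X j).le)
  have hsA := h.sigVar_pos hM Side.A i
  have hsB := h.sigVar_pos hM Side.B i
  have hsA' : (S M).sigVar Side.A i ≤ β Side.A i := by
    linarith [h.sigVar_add_epsVar hM Side.A i, h.epsVar_pos hM Side.A i]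
  have hsB' : (S M).sigVar Side.B i ≤ β Side.B i := by
    linarith [h.sigVar_add_epsVar hM Side.B i, h.epsVar_pos hM Side.B i]
  have hθA := hθ Side.A
  have hθB := hθ Side.B
  have hs0 : 0 ≤ (S M).typicalSinr (Eu / (M : ℝ) ^ a) θ i := by
    unfold RelaySystem.typicalSinr; positivity
  have hsK : (S M).typicalSinr (Eu / (M : ℝ) ^ a) θ i ≤ K * M := by
    have h1 : Eu / (M : ℝ) ^ a * M / (S M).noiseFactor (Eu / (M : ℝ) ^ a) ≤ Eu * M :=
      (div_le_self (mul_nonneg (h.power_nonneg M) hM'.le) hk).trans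
        (mul_le_mul_of_nonneg_right hP hM'.le)
    have h2 : (θ Side.A * (S M).sigVar Side.A i ^ 2 + θ Side.B * (S M).sigVar Side.B i ^ 2) /
        ((S M).sigVar Side.A i + (S M).sigVar Side.B i) ≤
          (θ Side.A + θ Side.B) * (β Side.A i + β Side.B i) := by
      refine le_trans ?_ (mul_le_mul_of_nonneg_left (add_le_add hsA' hsB') hθ0.le)
      rw [div_le_iff₀ (by positivity)]
      have e1 : 0 ≤ θ Side.A * ((S M).sigVar Side.A i * (S M).sigVar Side.B i) := by positivity
      have e2 : 0 ≤ θ Side.B * ((S M).sigVar Side.A i * (S M).sigVar Side.B i) := by positivity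
      have e3 : 0 ≤ θ Side.A * (S M).sigVar Side.B i ^ 2 := by positivity
      have e4 : 0 ≤ θ Side.B * (S M).sigVar Side.A i ^ 2 := by positivity
      nlinarith
    have h3 := mul_le_mul h1 h2 (by positivity) (by positivity)
    unfold RelaySystem.typicalSinr
    rw [hK]
    linarith
  have hlog : Real.log (1 + (S M).typicalSinr (Eu / (M : ℝ) ^ a) θ i) ≤
      Real.log (1 + K) + Real.log M := by
    rw [← Real.log_mul (by positivity) hM'.ne']
    exact Real.log_le_log (by linarith) (by nlinarith)
  have hlog2 : 0 < Real.log 2 := Real.log_pos one_lt_two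
  change |1 / 2 * _ - 1 / 2 * _| ≤ _
  rw [← mul_sub, abs_mul, abs_of_pos (one_half_pos (α := ℝ))]
  refine mul_le_mul_of_nonneg_left (hnear.trans ?_) (by norm_num)
  refine div_le_div_of_nonneg_right (add_le_add le_rfl ?_) hlog2.le
  rw [mul_assoc (65 * (5 + R) ^ 3)]
  refine mul_le_mul_of_nonneg_left ?_ (by positivity)
  have := mul_le_mul_of_nonneg_right hlog hδpos.le
  linarith

/-- The uplink rates, up to a vanishing error. -/
theorem tendsto_uplink {θ : Side → ℝ}
    (hθ : ∀ X, 0 ≤ θ X) (hθ0 : 0 < θ Side.A + θ Side.B) (i : Fin N) :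
    Tendsto (fun M => 1 / 2 * ∫ ω, (S M).weightedLog (μ M) θ i ω ∂(μ M) -
      rate (τ * Eu * Ep / (M : ℝ) ^ (a + c - 1) *
        ((θ Side.A * β Side.A i ^ 4 + θ Side.B * β Side.B i ^ 4) /
          (β Side.A i ^ 2 + β Side.B i ^ 2) / (1 + limitPower Eu a * ∑ X, ∑ j, β X j))))
      atTop (𝓝 0) := by
  have hA := h.β_pos Side.A i
  have hB := h.β_pos Side.B i
  have hEu := h.Eu_pos
  have hEp := h.Ep_pos
  have hT : 0 < θ Side.A * β Side.A i ^ 4 + θ Side.B * β Side.B i ^ 4 := by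
    have := weighted_sq_pos (pow_pos hA 2) (pow_pos hB 2) (hθ Side.A) (hθ Side.B) hθ0
    simpa only [← pow_mul] using this
  have hL := limitPower_nonneg (a := a) hEu.le
  have hsumβ : 0 ≤ ∑ X, ∑ j, β X j :=
    Finset.sum_nonneg fun X _ => Finset.sum_nonneg fun j _ => (h.β_pos X j).le
  have hk0 : 0 < 1 + limitPower Eu a * ∑ X, ∑ j, β X j := by positivity
  have hv : Tendsto (fun M => (θ Side.A * relVar τ Ep c (β Side.A i) M ^ 2 +
      θ Side.B * relVar τ Ep c (β Side.B i) M ^ 2) /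
        (relVar τ Ep c (β Side.A i) M + relVar τ Ep c (β Side.B i) M) /
          (1 + Eu / (M : ℝ) ^ a * ∑ X, ∑ j, (S M).epsVar X j)) atTop
      (𝓝 ((θ Side.A * β Side.A i ^ 4 + θ Side.B * β Side.B i ^ 4) /
          (β Side.A i ^ 2 + β Side.B i ^ 2) / (1 + limitPower Eu a * ∑ X, ∑ j, β X j))) := by
    have h1 := h.tendsto_relVar (β Side.A i)
    have h2 := h.tendsto_relVar (β Side.B i)
    have h3 : Tendsto (fun M => ∑ X, ∑ j, (S M).epsVar X j) atTop (𝓝 (∑ X, ∑ j, β X j)) :=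
      tendsto_finsetSum _ fun X _ => tendsto_finsetSum _ fun j _ => h.tendsto_epsVar X j
    have h4 := ((((h1.pow 2).const_mul (θ Side.A)).add ((h2.pow 2).const_mul (θ Side.B))).div
      (h1.add h2) (by positivity)).div (((tendsto_div_rpow Eu h.a_nonneg).mul h3).const_add 1)
        hk0.ne'
    simp only [← pow_mul] at h4
    exact h4
  have hx : ∀ᶠ M : ℕ in atTop, 0 ≤ τ * Eu * Ep / (M : ℝ) ^ (a + c - 1) :=
    Eventually.of_forall fun M => by positivity
  have h5 := (h.tendsto_integral_weightedLog_sub hθ hθ0 i).add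
    (tendsto_rate_mul_sub hx (by positivity) hv)
  rw [add_zero] at h5
  refine h5.congr' ?_
  filter_upwards [eventually_gt_atTop 0] with M hM
  have ht := h.energy_pos hM
  -- One of the two pilot energies in the squared variances cancels against the denominator; the
  -- other joins the power and the array gain.
  have heq : (S M).typicalSinr (Eu / (M : ℝ) ^ a) θ i = τ * Eu * Ep / (M : ℝ) ^ (a + c - 1) *
      ((θ Side.A * relVar τ Ep c (β Side.A i) M ^ 2 +
      θ Side.B * relVar τ Ep c (β Side.B i) M ^ 2) /
        (relVar τ Ep c (β Side.A i) M + relVar τ Ep c (β Side.B i) M) /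
          (1 + Eu / (M : ℝ) ^ a * ∑ X, ∑ j, (S M).epsVar X j)) := by
    rw [RelaySystem.typicalSinr, RelaySystem.noiseFactor, h.sigVar_eq_mul, h.sigVar_eq_mul,
      ← power_mul_energy hM]
    generalize pilotEnergy τ Ep c M = t at *
    generalize relVar τ Ep c (β Side.A i) M = x
    generalize relVar τ Ep c (β Side.B i) M = y
    rw [← mul_add, show θ Side.A * (t * x) ^ 2 + θ Side.B * (t * y) ^ 2 =
      t * (t * (θ Side.A * x ^ 2 + θ Side.B * y ^ 2)) by ring, mul_div_mul_left _ _ ht.ne']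
    ring
  rw [heq]
  ring

/-- The downlink rates, up to a vanishing error. -/
theorem tendsto_downlink (X : Side) (i : Fin N) :
    Tendsto (fun M => (S M).RDown (μ M) X i - rate (τ * Er * Ep / (M : ℝ) ^ (b + c - 1) *
        (β X i ^ 4 / (∑ Y, ∑ j, β Y j ^ 2) / (1 + limitPower Er b * β X i)))) atTop (𝓝 0) := by
  have hEr := h.Er_pos
  have hEp := h.Ep_pos
  have hβX := h.β_pos X i
  have hL := limitPower_nonneg (a := b) hEr.le
  have hsumβ : 0 < ∑ Y, ∑ j, β Y j ^ 2 :=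
    Finset.sum_pos (fun Y _ => Finset.sum_pos (fun j _ => pow_pos (h.β_pos Y j) 2)
      ⟨i, Finset.mem_univ i⟩) ⟨X, Finset.mem_univ X⟩
  set q : ℕ → ℝ := fun M => ∑ Y, ∑ j, relVar τ Ep c (β Y j) M with hq
  have hqlim : Tendsto q atTop (𝓝 (∑ Y, ∑ j, β Y j ^ 2)) :=
    tendsto_finsetSum _ fun Y _ => tendsto_finsetSum _ fun j _ => h.tendsto_relVar (β Y j)
  -- The kurtosis correction is quadratic in the estimate variance, so after cancelling one pilot
  -- energy it still carries another and vanishes.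
  have hv : Tendsto (fun M => relVar τ Ep c (β X i) M ^ 2 / (Er / (M : ℝ) ^ b *
      (β X i * q M + (kurt - 2) * (pilotEnergy τ Ep c M * relVar τ Ep c (β X i) M ^ 2)) + q M))
      atTop (𝓝 (β X i ^ 4 / (∑ Y, ∑ j, β Y j ^ 2) / (1 + limitPower Er b * β X i))) := by
    have h1 := (h.tendsto_relVar (β X i)).pow 2
    have h2 := ((tendsto_div_rpow Er h.b_nonneg).mul ((hqlim.const_mul (β X i)).add
      ((h.tendsto_energy.mul h1).const_mul (kurt - 2)))).add hqlim
    rw [zero_mul, mul_zero, add_zero] at h2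
    have h3 := h1.div h2 (by positivity)
    have e : β X i ^ 4 / (∑ Y, ∑ j, β Y j ^ 2) / (1 + limitPower Er b * β X i) =
        (β X i ^ 2) ^ 2 / (limitPower Er b * (β X i * ∑ Y, ∑ j, β Y j ^ 2) +
          ∑ Y, ∑ j, β Y j ^ 2) := by
      rw [div_div, ← pow_mul]
      congr 1
      ring
    rw [e]
    exact h3
  have hy : ∀ᶠ M : ℕ in atTop, 0 ≤ τ * Er * Ep / (M : ℝ) ^ (b + c - 1) :=
    Eventually.of_forall fun M => by positivity
  refine (tendsto_rate_mul_sub hy (by positivity) hv).congr' ?_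
  filter_upwards [eventually_gt_atTop 0] with M hM
  have ht := h.energy_pos hM
  have hM' : (0 : ℝ) < M := by exact_mod_cast hM
  have hsum : ∑ Y, ∑ j, (S M).sigVar Y j = pilotEnergy τ Ep c M * q M := by
    simp only [hq, h.sigVar_eq_mul, Finset.mul_sum]
  have heq : (S M).sinrDown (μ M) X i = τ * Er * Ep / (M : ℝ) ^ (b + c - 1) *
      (relVar τ Ep c (β X i) M ^ 2 / (Er / (M : ℝ) ^ b * (β X i * q M + (kurt - 2) *
        (pilotEnergy τ Ep c M * relVar τ Ep c (β X i) M ^ 2)) + q M)) := by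
    rw [RelaySystem.sinrDown_eq (h.isGaussianFamily hM) hM (h.sigVar_pos hM)
      (by rw [h.pr_eq]; positivity), h.sigVar_add_epsVar hM, hsum, h.pr_eq, h.sigVar_eq_mul,
      ← power_mul_energy hM]
    generalize pilotEnergy τ Ep c M = t at *
    generalize relVar τ Ep c (β X i) M = x
    generalize Er / (M : ℝ) ^ b = p
    rw [show p * (β X i * (t * q M) + (kurt - 2) * (t * x) ^ 2) + t * q M =
      t * (p * (β X i * q M + (kurt - 2) * (t * x ^ 2)) + q M) by ring,
      show p * M * (t * x) ^ 2 = t * (p * M * t * x ^ 2) by ring, mul_div_mul_left _ _ ht.ne']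
    ring
  rw [RelaySystem.RDown, heq, rate]

end IsScaled

/-! ### Removing the constant factors left at non-vanishing power. -/

lemma tendsto_powerLaw_div {x0 y0 e d : ℝ} (hy : 0 < y0) (hde : d < e) :
    Tendsto (fun M : ℕ => x0 / (M : ℝ) ^ e / (y0 / (M : ℝ) ^ d)) atTop (𝓝 0) := by
  refine (tendsto_div_rpow_zero (x0 / y0) (sub_pos.2 hde)).congr' ?_
  filter_upwards [eventually_gt_atTop 0] with M hM
  have hM' : (0 : ℝ) < M := by exact_mod_cast hM
  rw [Real.rpow_sub hM']
  field_simp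

/-- Constant factors lost to the estimation errors at non-vanishing transmit powers do not change
the asymptotic decode-and-forward rate. -/
lemma tendsto_combinedRate_sub {x0 y0 a b c u uA uB dA dB u' uA' uB' dA' dB' : ℝ} (hx0 : 0 < x0)
    (hy0 : 0 < y0) (ha : 0 ≤ a) (hb : 0 ≤ b) (hab : 0 < a ∨ 1 < 2 * b + c)
    (hu : 0 < u) (huA : 0 < uA) (huB : 0 < uB) (hdA : 0 < dA) (hdB : 0 < dB)
    (hu' : 0 < u') (huA' : 0 < uA') (huB' : 0 < uB') (hdA' : 0 < dA') (hdB' : 0 < dB')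
    (hua : 0 < a → u = u' ∧ uA = uA' ∧ uB = uB') (hdb : 0 < b → dA = dA' ∧ dB = dB') :
    Tendsto (fun M : ℕ =>
      combinedRate (x0 / (M : ℝ) ^ (a + c - 1)) (y0 / (M : ℝ) ^ (b + c - 1)) u uA uB dA dB -
      combinedRate (x0 / (M : ℝ) ^ (a + c - 1)) (y0 / (M : ℝ) ^ (b + c - 1)) u' uA' uB' dA' dB')
      atTop (𝓝 0) := by
  have hx : ∀ᶠ M : ℕ in atTop, 0 < x0 / (M : ℝ) ^ (a + c - 1) := by
    filter_upwards [eventually_gt_atTop 0] with M hM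
    positivity
  have hy : ∀ᶠ M : ℕ in atTop, 0 < y0 / (M : ℝ) ^ (b + c - 1) := by
    filter_upwards [eventually_gt_atTop 0] with M hM
    positivity
  have hx' := hx.mono fun M h => h.le
  have hy' := hy.mono fun M h => h.le
  -- If either scaling tends to 0, both combined rates do, and the constants are irrelevant.
  by_cases h1 : 1 < a + c
  · have h := tendsto_div_rpow_zero x0 (show 0 < a + c - 1 by linarith)
    simpa using (tendsto_combinedRate_of_uplink hx' hy' hu.le huA.le huB.le hdA.le hdB.le h).sub
      (tendsto_combinedRate_of_uplink hx' hy' hu'.le huA'.le huB'.le hdA'.le hdB'.le h)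
  by_cases h2 : 1 < b + c
  · have h := tendsto_div_rpow_zero y0 (show 0 < b + c - 1 by linarith)
    simpa using (tendsto_combinedRate_of_downlink hx' hy' hu.le huA.le huB.le hdA.le hdB.le h).sub
      (tendsto_combinedRate_of_downlink hx' hy' hu'.le huA'.le huB'.le hdA'.le hdB'.le h)
  rcases ha.lt_or_eq with ha0 | ha0
  · obtain ⟨rfl, rfl, rfl⟩ := hua ha0
    rcases hb.lt_or_eq with hb0 | hb0
    · obtain ⟨rfl, rfl⟩ := hdb hb0
      simp
    -- Here b = 0 < a: only the downlink constants differ, and the uplink is the bottleneck.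
    · have h := tendsto_powerLaw_div (x0 := x0) hy0 (show b + c - 1 < a + c - 1 by linarith)
      refine tendsto_const_nhds.congr' ?_
      filter_upwards [
        eventually_combinedRate_of_uplink_small (u := u) hx hy huA huB hdA hdB h,
        eventually_combinedRate_of_uplink_small (u := u) hx hy huA huB hdA' hdB' h] with M e1 e2
      rw [e1, e2, sub_self]
  -- Here a = 0. As c ≤ 1 in this branch, 2b + c > 1 forces b > 0. The differing uplink constants
  -- are hidden by the downlink bottleneck; y² / x → 0 is the inequality c - 1 < 2 (b + c - 1),
  -- again 2b + c > 1.
  · have hb0 : 0 < b := by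
      rcases hab with h | h <;> linarith
    have hbc : 1 < 2 * b + c := by
      rcases hab with h | h
      · linarith
      · exact h
    obtain ⟨rfl, rfl⟩ := hdb hb0
    have h := tendsto_powerLaw_div (x0 := y0) hx0 (show a + c - 1 < b + c - 1 by linarith)
    have h' : Tendsto (fun M : ℕ => (y0 / (M : ℝ) ^ (b + c - 1)) ^ 2 /
        (x0 / (M : ℝ) ^ (a + c - 1))) atTop (𝓝 0) := by
      refine (tendsto_powerLaw_div (x0 := y0 ^ 2) hx0
        (show a + c - 1 < 2 * (b + c - 1) by linarith)).congr fun M => ?_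
      rw [div_pow, mul_comm 2 (b + c - 1), Real.rpow_mul (Nat.cast_nonneg M), Real.rpow_two]
    refine tendsto_const_nhds.congr' ?_
    filter_upwards [
      eventually_combinedRate_of_downlink_small hx hy hu huA huB hdA hdB h h',
      eventually_combinedRate_of_downlink_small hx hy hu' huA' huB' hdA hdB h h'] with M e1 e2
    rw [e1, e2, sub_self]

lemma min_Rbar_eq {N : ℕ} (τ : ℕ) (β : Side → Fin N → ℝ) (Eu Er Ep a b c : ℝ) (M : ℕ)
    (i : Fin N) :
    min (Rbar1 τ β Eu Ep a c M i) (Rbar2 τ β Eu Er Ep a b c M i) =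
      combinedRate (τ * Eu * Ep / (M : ℝ) ^ (a + c - 1)) (τ * Er * Ep / (M : ℝ) ^ (b + c - 1))
        ((β Side.A i ^ 4 + β Side.B i ^ 4) / (β Side.A i ^ 2 + β Side.B i ^ 2))
        (β Side.A i ^ 4 / (β Side.A i ^ 2 + β Side.B i ^ 2))
        (β Side.B i ^ 4 / (β Side.A i ^ 2 + β Side.B i ^ 2))
        (β Side.A i ^ 4 / ∑ Y, ∑ j, β Y j ^ 2) (β Side.B i ^ 4 / ∑ Y, ∑ j, β Y j ^ 2) := by
  simp only [Rbar1, Rbar2, RbarUp, RbarDown, combinedRate, rate, Side.sum_eq,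
    Finset.sum_add_distrib]

end TwoWayRelay

end

/-! ### The main theorem. -/

theorem theorem9 {N τ : ℕ} (β : TwoWayRelay.Side → Fin N → ℝ) (hβ : ∀ X i, 0 < β X i)
    (Eu Er Ep : ℝ) (hEu : 0 < Eu) (hEr : 0 < Er) (hEp : 0 < Ep)
    (a b c : ℝ) (ha : 0 ≤ a) (hb : 0 ≤ b) (hc : 0 < c)
    (hab : 0 < a ∨ 1 < 2 * b + c)
    {Ω : ℕ → Type*} [∀ M, MeasurableSpace (Ω M)]
    (μ : ∀ M, Measure (Ω M)) [∀ M, IsProbabilityMeasure (μ M)]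
    (S : ∀ M, TwoWayRelay.RelaySystem M N τ (Ω M))
    (hS : ∀ M, (S M).IsModel (μ M))
    (hSβ : ∀ M, (S M).β = β)
    (hpu : ∀ M X j, (S M).p X j = Eu / (M : ℝ) ^ a)
    (hpr : ∀ M, (S M).pr = Er / (M : ℝ) ^ b)
    (hpp : ∀ M, (S M).pp = Ep / (M : ℝ) ^ c)
    (i : Fin N) :
    (∀ M, (S M).ExpectationsExist (μ M) i) ∧
    Tendsto
      (fun M => (S M).RDF (μ M) i -
        min (TwoWayRelay.Rbar1 τ β Eu Ep a c M i)
          (TwoWayRelay.Rbar2 τ β Eu Er Ep a b c M i))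
      atTop (𝓝 0) := by
  open TwoWayRelay in
  have hτ : 0 < τ := (hS 0).pilot_length_pos i
  have h : IsScaled β Eu Er Ep a b c μ S :=
    ⟨hβ, hEu, hEr, hEp, ha, hb, hc, hτ, hS, hSβ, hpu, hpr, hpp⟩
  refine ⟨h.expectationsExist i, ?_⟩
  have hA := hβ Side.A i
  have hB := hβ Side.B i
  have hLu := limitPower_nonneg (a := a) hEu.le
  have hLr := limitPower_nonneg (a := b) hEr.le
  have hsum : 0 < ∑ Y, ∑ j, β Y j ^ 2 :=
    Finset.sum_pos (fun Y _ => Finset.sum_pos (fun j _ => pow_pos (hβ Y j) 2)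
      ⟨i, Finset.mem_univ i⟩) ⟨Side.A, Finset.mem_univ _⟩
  have hsum1 : 0 ≤ ∑ Y, ∑ j, β Y j :=
    Finset.sum_nonneg fun Y _ => Finset.sum_nonneg fun j _ => (hβ Y j).le
  have hk : 0 < 1 + limitPower Eu a * ∑ Y, ∑ j, β Y j := by positivity
  have hR1 : Tendsto (fun M => (S M).R1 (μ M) i - rate (τ * Eu * Ep / (M : ℝ) ^ (a + c - 1) *
      ((β Side.A i ^ 4 + β Side.B i ^ 4) / (β Side.A i ^ 2 + β Side.B i ^ 2) /
        (1 + limitPower Eu a * ∑ Y, ∑ j, β Y j)))) atTop (𝓝 0) := by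
    have := h.tendsto_uplink (θ := fun _ => 1) (fun _ => zero_le_one) (by norm_num) i
    simpa only [one_mul, RelaySystem.R1, RelaySystem.pairLog_eq] using this
  have hUp : ∀ X, Tendsto (fun M => (S M).RUp (μ M) X i -
      rate (τ * Eu * Ep / (M : ℝ) ^ (a + c - 1) *
        (β X i ^ 4 / (β Side.A i ^ 2 + β Side.B i ^ 2) /
          (1 + limitPower Eu a * ∑ Y, ∑ j, β Y j)))) atTop (𝓝 0) := fun X => by
    have := h.tendsto_uplink (θ := fun Y => if Y = X then 1 else 0)
      (fun Y => by split_ifs <;> norm_num) (by cases X <;> simp) i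
    simp only [RelaySystem.RUp, RelaySystem.uplinkLog_eq]
    cases X <;> simpa using this
  have hmain := tendsto_min_sub_min hR1
    (((tendsto_min_sub_min (hUp Side.A) (h.tendsto_downlink Side.B i)).add
      (tendsto_min_sub_min (hUp Side.B) (h.tendsto_downlink Side.A i))).congr
        (fun M => (add_sub_add_comm _ _ _ _).symm) |>.trans_eq (by rw [add_zero]))
  -- The unprimed constants are the true limits with their loss factors, the primed ones those of
  -- the claimed rates; they agree when the corresponding exponent is positive, since `limitPower`
  -- is then 0.
  have hcmp := tendsto_combinedRate_sub (c := c) (a := a) (b := b)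
    (x0 := τ * Eu * Ep) (y0 := τ * Er * Ep)
    (u := (β Side.A i ^ 4 + β Side.B i ^ 4) / (β Side.A i ^ 2 + β Side.B i ^ 2) /
        (1 + limitPower Eu a * ∑ Y, ∑ j, β Y j))
    (uA := β Side.A i ^ 4 / (β Side.A i ^ 2 + β Side.B i ^ 2) /
        (1 + limitPower Eu a * ∑ Y, ∑ j, β Y j))
    (uB := β Side.B i ^ 4 / (β Side.A i ^ 2 + β Side.B i ^ 2) /
        (1 + limitPower Eu a * ∑ Y, ∑ j, β Y j))
    (dA := β Side.A i ^ 4 / (∑ Y, ∑ j, β Y j ^ 2) / (1 + limitPower Er b * β Side.A i))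
    (dB := β Side.B i ^ 4 / (∑ Y, ∑ j, β Y j ^ 2) / (1 + limitPower Er b * β Side.B i))
    (u' := (β Side.A i ^ 4 + β Side.B i ^ 4) / (β Side.A i ^ 2 + β Side.B i ^ 2))
    (uA' := β Side.A i ^ 4 / (β Side.A i ^ 2 + β Side.B i ^ 2))
    (uB' := β Side.B i ^ 4 / (β Side.A i ^ 2 + β Side.B i ^ 2))
    (dA' := β Side.A i ^ 4 / ∑ Y, ∑ j, β Y j ^ 2) (dB' := β Side.B i ^ 4 / ∑ Y, ∑ j, β Y j ^ 2)
    (by positivity) (by positivity) ha hb hab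
    (by positivity) (by positivity) (by positivity) (by positivity) (by positivity)
    (by positivity) (by positivity) (by positivity) (by positivity) (by positivity)
    (fun h0 => by simp [limitPower, h0.ne']) (fun h0 => by simp [limitPower, h0.ne'])
  have hfin := hmain.add hcmp
  rw [add_zero] at hfin
  refine hfin.congr fun M => ?_
  rw [min_Rbar_eq]
  exact sub_add_sub_cancel _ _ _
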